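/- Let $E$ be a Euclidean space of dimension $n\ge 1$, and for $x\in E\setminus\{0\}$ let $p_x$ denote the orthogonal projection of $E$ onto the line $\mathbb R x$. Let $(e_1,\dots,e_n)$ and $(e'_1,\dots,e'_n)$ be two linearly independent systems of vectors of $E$ such that $\mathbb R e_i\ne\mathbb R e'_j$ for all $i,j$. Let $\Lambda_0$, $\Lambda'_0$ be the subgroups of $E$ generated by the $e_i$ and by the $e'_j$ respectively, and assume that $\Lambda=\Lambda_0+\Lambda'_0$ is a lattice of which all the $e_i$ and $e'_j$ are minimal vectors (non-zero vectors of smallest norm). Assume that there are strictly positive real numbers $\lambda_i,\lambda'_i$ with $$\sum_{i=1}^n\lambda_i\,p_{e_i}=\sum_{i=1}^n\lambda'_i\,p_{e'_i},$$ that $\Lambda$ is *perf-irreducible*, i.e. that there are no partitions $\{1,\dots,n\}=I_1\sqcup I_2=J_1\sqcup J_2$ into non-empty parts such that, for $k=1,2$, every $e'_j$ with $j\in J_k$ lies in the real span of $\{e_i : i\in I_k\}$, and that $\Lambda/\Lambda_0$ is $2$-elementary, i.e. $2\Lambda\subseteq\Lambda_0$. For a system $(e_i)$ with annihilator $d$ of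 $\Lambda/\Lambda_0$ (the exponent of this finite group), its code over $\mathbb Z/d\mathbb Z$ is the set of all $(a_1,\dots,a_n)\bmod d$ with $a_i\in\mathbb Z$ and $\frac{a_1e_1+\dots+a_ne_n}{d}\in\Lambda$; the annihilator $d'$ and the code of $(e'_i)$ are defined likewise from $\Lambda/\Lambda'_0$. The relation is *regular* if $d=d'$ and the two codes coincide up to a permutation and sign changes of the coordinates. Then one of the following holds. 1. The relation is regular, and moreover it is of the form $\lambda_i=\lambda'_i=c$ for all $i$, with one constant $c>0$ and with each of the systems $(e_i)$, $(e'_i)$ mutually orthogonal; and $\Lambda$ is similar to one of the root lattices $\mathbb D_n$ (with $n\ge 4$ even), $\mathbb E_7$, $\mathbb E_8$. 2. $n=8$, $\Lambda$ is similar to $\mathbb E_8$, and, after renumbering each of the two systems, replacing some of their vectors by their opposites, and multiplying the relation by a positive constant, the following holds: the $e_i$ are mutually orthogonal of equal norm, and with $$f_1=e_4+e_6+e_8,\quad f_3=e_2-e_4+e_8,\quad f_5=e_2+e_4-e_6,\quad f_7=e_2+e_6-e_8$$ one has $e'_i=\frac{e_i+f_i}2$ and $e'_{i+1}=\frac{-e_i+f_i}2$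 for $i=1,3,5,7$, the relation being $$\sum_{i\ \mathrm{odd}}p_{e_i}+3\sum_{i\ \mathrm{even}}p_{e_i}=2\sum_{j=1}^8p_{e'_j}.$$ -/

import Mathlib

open Submodule

namespace PerfRel

section Euclidean

variable {E : Type*} [NormedAddCommGroup E] [InnerProductSpace ℝ E]

/-- The orthogonal projection of `E` onto the line `ℝ x` (as an endomorphism of `E`). -/
noncomputable def lineProj (x : E) : E →L[ℝ] E := (span ℝ {x}).starProjection

/-- `x` is a minimal vector of `L`: a non-zero element of `L` of smallest norm. -/
def IsMinimalVector (L : Submodule ℤ E) (x : E) : Prop :=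
  x ∈ L ∧ x ≠ 0 ∧ ∀ y ∈ L, y ≠ 0 → ‖x‖ ≤ ‖y‖

/-- `{e_i, e'_j}` is perf-irreducible: there are no partitions `I ∪ Iᶜ` and `J ∪ Jᶜ` of the two
index sets into non-empty parts such that `e'_j ∈ span {e_i, i ∈ I}` for all `j ∈ J` and
`e'_j ∈ span {e_i, i ∉ I}` for all `j ∉ J`. -/
def PerfIrreducible {n : ℕ} (e e' : Fin n → E) : Prop :=
  ¬ ∃ I J : Set (Fin n), I.Nonempty ∧ Iᶜ.Nonempty ∧ J.Nonempty ∧ Jᶜ.Nonempty ∧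
    (∀ j ∈ J, e' j ∈ span ℝ (e '' I)) ∧ (∀ j ∈ Jᶜ, e' j ∈ span ℝ (e '' Iᶜ))

/-- The quotient `L / L₀`, for `L₀` a subgroup of `L`. -/
abbrev LatQuot (L L₀ : Submodule ℤ E) : Type _ := L ⧸ L₀.submoduleOf L

/-- The annihilator of `L / L₀`, where `L₀` is generated by the `e_i`: the smallest `d > 0`
with `d L ⊆ L₀`. -/
noncomputable def annihilator {n : ℕ} (L : Submodule ℤ E) (e : Fin n → E) : ℕ :=
  AddMonoid.exponent (LatQuot L (span ℤ (Set.range e)))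

/-- The code over `ℤ/dℤ` defined by `L` and the `e_i`: the words `(a_1, …, a_n) mod d` such that
`(a_1 e_1 + ⋯ + a_n e_n) / d ∈ L`. -/
def code {n : ℕ} (L : Submodule ℤ E) (e : Fin n → E) (d : ℕ) : Set (Fin n → ZMod d) :=
  {w | ∃ a : Fin n → ℤ, (∑ i, ((a i : ℝ) / (d : ℝ)) • e i) ∈ L ∧ ∀ i, w i = (a i : ZMod d)}

/-- Equivalence of codes: they agree up to a permutation and sign changes of the coordinates. -/
def CodeEquivalent {n d : ℕ} (C C' : Set (Fin n → ZMod d)) : Prop :=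
  ∃ (σ : Equiv.Perm (Fin n)) (s : Fin n → ℤˣ),
    ∀ w : Fin n → ZMod d, w ∈ C ↔ (fun i => s i • w (σ i)) ∈ C'

/-- The pair of systems is regular in `L`: same annihilator and equivalent codes. -/
def IsRegular {n : ℕ} (L : Submodule ℤ E) (e e' : Fin n → E) : Prop :=
  annihilator L e = annihilator L e' ∧
    CodeEquivalent (code L e (annihilator L e)) (code L e' (annihilator L e))

/-- The relation is, up to a scalar, `∑ p_{e_i} = ∑ p_{e'_i}` with each of the two systems
mutually orthogonal. -/
def IsOrthogonalFrameRelation {n : ℕ} (e e' : Fin n → E) (a a' : Fin n → ℝ) : Prop :=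
  (Pairwise fun i j => inner ℝ (e i) (e j) = 0) ∧
  (Pairwise fun i j => inner ℝ (e' i) (e' j) = 0) ∧
  ∃ c : ℝ, 0 < c ∧ ∀ i, a i = c ∧ a' i = c

/-- The explicit irregular relation, up to numbering and signs of the vectors of the two systems
and up to a scalar factor `c`. With the numbering `f_1, …, f_8` (in the code `f 0, …, f 7`) of the
first and `g_1, …, g_8` of the second system, the `f_i` are mutually orthogonal of equal norm,
`2 g_1 = f_1 + (f_4 + f_6 + f_8)`, `2 g_2 = -f_1 + (f_4 + f_6 + f_8)`, and so on, and the relation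
is `∑_{i odd} p_{f_i} + 3 ∑_{i even} p_{f_i} = 2 ∑_j p_{g_j}`. -/
def IsIrregularE8Relation {n : ℕ} (e e' : Fin n → E) (a a' : Fin n → ℝ) : Prop :=
  ∃ (σ τ : Fin 8 ≃ Fin n) (s t : Fin 8 → ℤˣ) (f g : Fin 8 → E) (c : ℝ),
    (∀ i, f i = s i • e (σ i)) ∧ (∀ j, g j = t j • e' (τ j)) ∧
    (Pairwise fun i j => inner ℝ (f i) (f j) = 0) ∧ (∀ i j, ‖f i‖ = ‖f j‖) ∧
    g 0 = (1 / 2 : ℝ) • (f 0 + (f 3 + f 5 + f 7)) ∧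
    g 1 = (1 / 2 : ℝ) • (-f 0 + (f 3 + f 5 + f 7)) ∧
    g 2 = (1 / 2 : ℝ) • (f 2 + (f 1 - f 3 + f 7)) ∧
    g 3 = (1 / 2 : ℝ) • (-f 2 + (f 1 - f 3 + f 7)) ∧
    g 4 = (1 / 2 : ℝ) • (f 4 + (f 1 + f 3 - f 5)) ∧
    g 5 = (1 / 2 : ℝ) • (-f 4 + (f 1 + f 3 - f 5)) ∧
    g 6 = (1 / 2 : ℝ) • (f 6 + (f 1 + f 5 - f 7)) ∧
    g 7 = (1 / 2 : ℝ) • (-f 6 + (f 1 + f 5 - f 7)) ∧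
    0 < c ∧
    (∀ i, a (σ i) = if i = 0 ∨ i = 2 ∨ i = 4 ∨ i = 6 then c else 3 * c) ∧
    (∀ j, a' (τ j) = 2 * c)

/-- `L`, which spans `E`, is similar to `M`: some similarity (a positive multiple of a linear
isometry) of `E` into `F` maps `L` onto `M`. The space `F` is allowed to be larger than the span
of `M`. -/
def IsSimilar {F : Type*} [NormedAddCommGroup F] [InnerProductSpace ℝ F]
    (L : Submodule ℤ E) (M : Submodule ℤ F) : Prop :=
  ∃ (r : ℝ) (φ : E →ₗᵢ[ℝ] F), 0 < r ∧ (M : Set F) = (fun x => r • φ x) '' (L : Set E)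

end Euclidean

section RootLattices

/-- `D_n`: the vectors of `ℤⁿ` with even coordinate sum. -/
def latticeD (n : ℕ) : Submodule ℤ (EuclideanSpace ℝ (Fin n)) where
  carrier := {x | ∃ a : Fin n → ℤ, (∀ i, x i = (a i : ℝ)) ∧ Even (∑ i, a i)}
  zero_mem' := ⟨0, by simp, by simp⟩
  add_mem' := by
    rintro x y ⟨a, ha, hae⟩ ⟨b, hb, hbe⟩
    refine ⟨a + b, fun i => by simp [ha, hb], ?_⟩
    simpa [Finset.sum_add_distrib] using hae.add hbe
  smul_mem' := by
    rintro m x ⟨a, ha, hae⟩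
    refine ⟨fun i => m * a i, fun i => by simp [ha], ?_⟩
    rw [← Finset.mul_sum]
    exact hae.mul_left m

/-- `E_8`: generated by `D_8` and `(1/2, …, 1/2)`, i.e. `D_8 ∪ ((1/2, …, 1/2) + D_8)`. -/
noncomputable def latticeE8 : Submodule ℤ (EuclideanSpace ℝ (Fin 8)) :=
  latticeD 8 ⊔ span ℤ {WithLp.toLp 2 (fun _ => (1 / 2 : ℝ))}

/-- `E_7`: the vectors of `E_8` orthogonal to the root `ε_7 - ε_8`. -/
noncomputable def latticeE7 : Submodule ℤ (EuclideanSpace ℝ (Fin 8)) where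
  carrier := {x | x ∈ latticeE8 ∧ x 6 = x 7}
  zero_mem' := ⟨zero_mem _, by simp⟩
  add_mem' := by
    rintro x y ⟨hx, hx'⟩ ⟨hy, hy'⟩
    exact ⟨add_mem hx hy, by simp [hx', hy']⟩
  smul_mem' := by
    rintro m x ⟨hx, hx'⟩
    exact ⟨Submodule.smul_mem _ m hx, by simp [hx']⟩

end RootLattices

end PerfRel

/-!
Since `2 L` is contained in the span of the `e_i`, one can write `e'_j = (1 / 2) ∑ A_ij e_i` with an
integer matrix `A`, and comparing coordinates in the relation gives
`λ_i e_i = (1 / 2) ∑ λ'_j A_ij e'_j`. So the rows and the columns of `A` are orthogonal for suitable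
weights. Two minimal vectors on different lines form an angle of at least `60` degrees; this bound,
inserted into the last identity, forces the entries of `A` to be `0` or `±1` and its columns to have
exactly four non-zero entries (`isHalfSystem_of_relation`).

The sets `S` such that the half sum of the `e_i`, `i ∈ S`, belongs to `L` form a binary code. No half sum
with signs is shorter than the minimal vectors, and a good choice of signs shows that words have weight
at least four and that the `e_i` of a word of weight four, a tetrad, are orthogonal. The tetrads given by
the columns generate the code, and they meet evenly. Perf-irreducibility says that the bipartite graph of
`A` is connected, and this implies that any two coordinates lie in a common tetrad
(`IsHalfSystem.isTetradCode`). In particular the `e_i` form an orthogonal frame. There are only three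
types of such codes (`IsTetradCode.classification`): the unions of an even number of pairs, the simplex
code of length `7` and the extended Hamming code of length `8`. The code determines `L` up to similarity
(`IsFrame.isSimilar`), and the three types belong to `D_n` with `n` even, to `E_7` and to `E_8`.

It remains to determine the weights. On the support `T` of a column, consider the graph in which two rows
`x`, `y` are adjacent if another support meets `T` exactly in `x` and `y`. Orthogonality shows that
adjacent rows have the same weight and that the weight of a row of `T` is proportional to one plus its
degree. Hence adjacent vertices have equal degrees, and a graph on four vertices with this property is
regular, or a triangle with an isolated vertex, or an edge with two isolated vertices; a parity argument
excludes the last possibility (`IsWeightedFrame.lam_const_or_isSpecial`).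

If all these graphs are regular, the weights are constant by connectedness. The two systems then play
symmetric roles, both are orthogonal frames of the same lattice, and their codes are equivalent: they have
the same length, and the two types of length `8` are distinguished by the fact that `E_8`, but not `D_8`,
is its own dual up to scaling (`codeEquivalent_and_isSimilar`). If on the other hand a triangle occurs,
the supports next to `T` are of the same kind, the four supports found in this way cover a whole
component, and normalising signs leads to the irregular relation
(`IsWeightedFrame.IsSpecial.exists_irregular`), whose supports generate the extended Hamming code.
-/

open scoped symmDiff

namespace PerfRel

/-! ### Tetrad codes and their parity checks -/

section TetradCodes

variable {ι : Type*} [DecidableEq ι]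

/-- The sums (symmetric differences) of finitely many members of `𝒯`. -/
inductive SymmDiffSpan (𝒯 : Set (Finset ι)) : Finset ι → Prop
  | empty : SymmDiffSpan 𝒯 ∅
  | step {S T : Finset ι} : SymmDiffSpan 𝒯 S → T ∈ 𝒯 → SymmDiffSpan 𝒯 (S ∆ T)

/-- A binary code (its words being given by their supports) of minimal weight at least `4` which is
self-orthogonal, generated by its tetrads (words of weight `4`), and in which any two coordinates
belong to a common tetrad. -/
structure IsTetradCode (𝒞 : Set (Finset ι)) : Prop where
  symmDiff_mem : ∀ {S T}, S ∈ 𝒞 → T ∈ 𝒞 → S ∆ T ∈ 𝒞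
  four_le_card : ∀ {S}, S ∈ 𝒞 → S.Nonempty → 4 ≤ S.card
  generated : ∀ {S}, S ∈ 𝒞 → SymmDiffSpan {T | T ∈ 𝒞 ∧ T.card = 4} S
  even_inter : ∀ {S T}, S ∈ 𝒞 → T ∈ 𝒞 → Even (S ∩ T).card
  exists_tetrad : ∀ i k, ∃ T ∈ 𝒞, T.card = 4 ∧ i ∈ T ∧ k ∈ T

theorem card_symmDiff_add (S T : Finset ι) :
    (S ∆ T).card + 2 * (S ∩ T).card = S.card + T.card := by
  have h : (S ∆ T) = (S ∪ T) \ (S ∩ T) := by ext x; simp [Finset.mem_symmDiff]; tauto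
  have h1 : (S ∩ T) ⊆ S ∪ T := Finset.inter_subset_left.trans Finset.subset_union_left
  have h2 := Finset.card_sdiff_add_card_eq_card h1
  have h3 := Finset.card_union_add_card_inter S T
  rw [h]; omega

theorem even_card_symmDiff_inter (S T P : Finset ι) :
    Even ((S ∆ T) ∩ P).card ↔ (Even (S ∩ P).card ↔ Even (T ∩ P).card) := by
  have h : (S ∆ T) ∩ P = (S ∩ P) ∆ (T ∩ P) := by
    ext x; simp [Finset.mem_symmDiff]; tauto
  have := card_symmDiff_add (S ∩ P) (T ∩ P)
  rw [h]; grind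

theorem SymmDiffSpan.symmDiff {𝒯 : Set (Finset ι)} {S T : Finset ι} (hS : SymmDiffSpan 𝒯 S)
    (hT : SymmDiffSpan 𝒯 T) : SymmDiffSpan 𝒯 (S ∆ T) := by
  induction hT with
  | empty => simpa [symmDiff_def] using hS
  | step _ hT ih => rw [← symmDiff_assoc]; exact ih.step hT

theorem SymmDiffSpan.mono {𝒯 𝒯' : Set (Finset ι)} (h : 𝒯 ⊆ 𝒯') {S : Finset ι}
    (hS : SymmDiffSpan 𝒯 S) : SymmDiffSpan 𝒯' S := by
  induction hS with
  | empty => exact .empty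
  | step _ hT ih => exact ih.step (h hT)

theorem SymmDiffSpan.even_inter {𝒯 : Set (Finset ι)} {P : Finset ι}
    (h : ∀ T ∈ 𝒯, Even (T ∩ P).card) {S : Finset ι} (hS : SymmDiffSpan 𝒯 S) :
    Even (S ∩ P).card := by
  induction hS with
  | empty => simp
  | step _ hT ih => exact (even_card_symmDiff_inter _ _ _).2 (iff_of_true ih (h _ hT))

/-- A self-orthogonal code generated by tetrads is doubly even. -/
theorem SymmDiffSpan.four_dvd_card {𝒯 : Set (Finset ι)}
    (h : ∀ T ∈ 𝒯, ∀ T' ∈ 𝒯, Even (T ∩ T').card) (h4 : ∀ T ∈ 𝒯, T.card = 4)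
    {S : Finset ι} (hS : SymmDiffSpan 𝒯 S) : 4 ∣ S.card := by
  induction hS with
  | empty => simp
  | @step S T hS hT ih =>
    have h1 := card_symmDiff_add S T
    have h2 : Even (S ∩ T).card := hS.even_inter fun T' hT' => h _ hT' _ hT
    have h3 := h4 T hT
    grind

/-- Two different tetrads of a self-orthogonal code with one common coordinate share exactly two
coordinates. -/
theorem card_inter_eq_two {S T : Finset ι} (hS : S.card = 4) (hT : T.card = 4)
    (heven : Even (S ∩ T).card) (hne : S ≠ T) {x : ι} (hxS : x ∈ S) (hxT : x ∈ T) :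
    (S ∩ T).card = 2 := by
  have h0 : 0 < (S ∩ T).card := Finset.card_pos.2 ⟨x, by simp [hxS, hxT]⟩
  have h4 : (S ∩ T).card < 4 := by
    by_contra h
    apply hne
    have h1 : S ∩ T = S := Finset.eq_of_subset_of_card_le Finset.inter_subset_left (by omega)
    have h2 : S ∩ T = T := Finset.eq_of_subset_of_card_le Finset.inter_subset_right (by omega)
    rw [← h1, h2]
  grind

theorem IsTetradCode.four_dvd_card {𝒞 : Set (Finset ι)} (h : IsTetradCode 𝒞) {S : Finset ι}
    (hS : S ∈ 𝒞) : 4 ∣ S.card :=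
  (h.generated hS).four_dvd_card (fun _ hT _ hT' => h.even_inter hT.1 hT'.1) fun _ hT => hT.2

end TetradCodes

section OddSet

variable {ι : Type*} [Fintype ι]

/-- The positions of the odd entries of an integer vector: the support of its reduction mod `2`. -/
def oddSet (a : ι → ℤ) : Finset ι := Finset.univ.filter fun i => Odd (a i)

@[simp] theorem mem_oddSet {a : ι → ℤ} {i : ι} : i ∈ oddSet a ↔ Odd (a i) := by simp [oddSet]

theorem oddSet_congr {a b : ι → ℤ} (hab : ∀ i, Even (a i - b i)) : oddSet a = oddSet b := by
  ext i; have := hab i; simp only [mem_oddSet]; grind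

variable [DecidableEq ι]

theorem oddSet_add (a b : ι → ℤ) : oddSet (a + b) = oddSet a ∆ oddSet b := by
  ext i; simp [Finset.mem_symmDiff, Int.odd_add]; grind

theorem oddSet_indicator (S : Finset ι) : oddSet (fun i => if i ∈ S then 1 else 0) = S := by
  ext i; by_cases h : i ∈ S <;> simp [h]

theorem even_sum_iff_even_card (a : ι → ℤ) (P : Finset ι) :
    Even (∑ i ∈ P, a i) ↔ Even (oddSet a ∩ P).card := by
  induction P using Finset.induction_on with
  | empty => simp
  | insert x P hx ih =>
    rw [Finset.sum_insert hx, Int.even_add, ih, Finset.inter_comm _ (insert x P),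
      Finset.inter_comm _ P]
    by_cases h : x ∈ oddSet a
    · rw [Finset.insert_inter_of_mem h, Finset.card_insert_of_notMem (by simp [hx]),
        Nat.even_add_one]
      have : ¬ Even (a x) := by simpa using h
      tauto
    · rw [Finset.insert_inter_of_notMem h]
      have : Even (a x) := by simpa using h
      tauto

theorem IsTetradCode.even_sum_tetrad {𝒞 : Set (Finset ι)} (h : IsTetradCode 𝒞) {a : ι → ℤ}
    (ha : oddSet a ∈ 𝒞) {p q r s : ι} (hT : {p, q, r, s} ∈ 𝒞)
    (hpq : p ≠ q) (hpr : p ≠ r) (hps : p ≠ s) (hqr : q ≠ r) (hqs : q ≠ s) (hrs : r ≠ s) :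
    Even (a p + a q + a r + a s) := by
  have h1 := (even_sum_iff_even_card a {p, q, r, s}).2 (h.even_inter ha hT)
  rw [Finset.sum_insert (by simp [*]), Finset.sum_insert (by simp [*]),
    Finset.sum_insert (by simp [*]), Finset.sum_singleton] at h1
  convert h1 using 1; ring

/-- The group of integer vectors whose reduction mod `2` is a word of the code. -/
def IsTetradCode.lift {𝒞 : Set (Finset ι)} (h : IsTetradCode 𝒞) (h0 : ∅ ∈ 𝒞) :
    AddSubgroup (ι → ℤ) where
  carrier := {a | oddSet a ∈ 𝒞}
  zero_mem' := by
    have : oddSet (0 : ι → ℤ) = ∅ := by ext; simp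
    simpa [this] using h0
  add_mem' := by
    intro a b ha hb
    simp only [Set.mem_ofPred_eq, oddSet_add] at *
    exact h.symmDiff_mem ha hb
  neg_mem' := by
    intro a ha
    have : oddSet (-a) = oddSet a := by ext; simp
    simpa only [Set.mem_ofPred_eq, this] using ha

/-- The parity checks of the code of length `2 k` whose words are the unions of an even number of `k`
disjoint pairs of coordinates. It belongs to the root lattice `D_{2k}`. -/
def NormD {k : ℕ} (a : Fin k × Bool → ℤ) : Prop :=
  (∀ b, Even (a (b, true) + a (b, false))) ∧ Even (∑ b, a (b, true))

/-- The parity checks of the `[7, 3, 4]` simplex code. It belongs to the root lattice `E_7`. -/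
def NormE7 (a : Fin 7 → ℤ) : Prop :=
  Even (a 0 + a 1 + a 2 + a 3) ∧ Even (a 0 + a 1 + a 4 + a 5) ∧ Even (a 0 + a 1 + a 6) ∧
    Even (a 0 + a 2 + a 4 + a 6)

/-- The parity checks of the `[8, 4, 4]` extended Hamming code. It belongs to the root lattice
`E_8`. -/
def NormE8 (a : Fin 8 → ℤ) : Prop :=
  Even (a 0 + a 1 + a 2 + a 3) ∧ Even (a 0 + a 1 + a 4 + a 5) ∧ Even (a 0 + a 1 + a 6 + a 7) ∧
    Even (a 0 + a 2 + a 4 + a 6)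

/-- A tetrad code of length `8` which contains four suitable tetrads is the extended Hamming code: these
tetrads are parity checks by self-orthogonality, and they generate all words that satisfy them. -/
theorem IsTetradCode.normE8 {𝒞 : Set (Finset ι)} (h : IsTetradCode 𝒞) (π : Fin 8 ≃ ι)
    (h1 : {π 0, π 1, π 2, π 3} ∈ 𝒞) (h2 : {π 0, π 1, π 4, π 5} ∈ 𝒞)
    (h3 : {π 0, π 1, π 6, π 7} ∈ 𝒞) (h4 : {π 0, π 2, π 4, π 6} ∈ 𝒞) (a : ι → ℤ) :
    oddSet a ∈ 𝒞 ↔ NormE8 (a ∘ π) := by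
  constructor
  · intro ha
    refine ⟨h.even_sum_tetrad ha h1 ?_ ?_ ?_ ?_ ?_ ?_, h.even_sum_tetrad ha h2 ?_ ?_ ?_ ?_ ?_ ?_,
      h.even_sum_tetrad ha h3 ?_ ?_ ?_ ?_ ?_ ?_, h.even_sum_tetrad ha h4 ?_ ?_ ?_ ?_ ?_ ?_⟩ <;>
      simp
  · rintro ⟨e1, e2, e3, e4⟩
    have h0 : ∅ ∈ 𝒞 := by simpa using h.symmDiff_mem h1 h1
    have key : ∀ T ∈ 𝒞, ∀ z : ℤ, z • (fun i => if i ∈ T then (1 : ℤ) else 0) ∈ h.lift h0 :=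
      fun T hT z => zsmul_mem (by change oddSet _ ∈ 𝒞; rwa [oddSet_indicator]) z
    have := add_mem (add_mem (key _ h1 (a (π 3))) (key _ h2 (a (π 5))))
      (add_mem (key _ h3 (a (π 7))) (key _ h4 (a (π 2) - a (π 3))))
    change oddSet _ ∈ 𝒞 at this
    rwa [oddSet_congr]
    simp only [Function.comp] at e1 e2 e3 e4
    intro i
    obtain ⟨j, rfl⟩ := π.surjective i
    fin_cases j <;> simp <;> grind

/-- A tetrad code of length `7` which contains three suitable tetrads is the simplex code. The parity
check of weight `3` is the sum of two tetrads and of the all-ones word, which is a parity check since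
all words have even weight. -/
theorem IsTetradCode.normE7 {𝒞 : Set (Finset ι)} (h : IsTetradCode 𝒞) (π : Fin 7 ≃ ι)
    (h1 : {π 0, π 1, π 2, π 3} ∈ 𝒞) (h2 : {π 0, π 1, π 4, π 5} ∈ 𝒞)
    (h4 : {π 0, π 2, π 4, π 6} ∈ 𝒞) (a : ι → ℤ) :
    oddSet a ∈ 𝒞 ↔ NormE7 (a ∘ π) := by
  constructor
  · intro ha
    have e1 : Even (a (π 0) + a (π 1) + a (π 2) + a (π 3)) :=
      h.even_sum_tetrad ha h1 (by simp) (by simp) (by simp) (by simp) (by simp) (by simp)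
    have e2 : Even (a (π 0) + a (π 1) + a (π 4) + a (π 5)) :=
      h.even_sum_tetrad ha h2 (by simp) (by simp) (by simp) (by simp) (by simp) (by simp)
    -- the sum of all coordinates is even, since the code is doubly even
    have e3 : Even (∑ i, a i) := by
      rw [even_sum_iff_even_card, Finset.inter_univ]
      exact even_iff_two_dvd.2 (dvd_trans (by norm_num) (h.four_dvd_card ha))
    rw [← π.sum_comp, Fin.sum_univ_seven] at e3
    refine ⟨e1, e2, ?_, h.even_sum_tetrad ha h4 ?_ ?_ ?_ ?_ ?_ ?_⟩ <;> simp
    grind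
  · rintro ⟨e1, e2, e3, e4⟩
    have h0 : ∅ ∈ 𝒞 := by simpa using h.symmDiff_mem h1 h1
    have key : ∀ T ∈ 𝒞, ∀ z : ℤ, z • (fun i => if i ∈ T then (1 : ℤ) else 0) ∈ h.lift h0 :=
      fun T hT z => zsmul_mem (by change oddSet _ ∈ 𝒞; rwa [oddSet_indicator]) z
    have := add_mem (add_mem (key _ h1 (a (π 3))) (key _ h2 (a (π 5))))
      (key _ h4 (a (π 6)))
    change oddSet _ ∈ 𝒞 at this
    rwa [oddSet_congr]
    simp only [Function.comp] at e1 e2 e3 e4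
    intro i
    obtain ⟨j, rfl⟩ := π.surjective i
    fin_cases j <;> simp <;> grind

end OddSet

/-! ### Classification of tetrad codes -/

section Classification

variable {ι : Type*} [DecidableEq ι] {𝒞 : Set (Finset ι)}

theorem card_four {p q r s : ι} (hpq : p ≠ q) (hpr : p ≠ r) (hps : p ≠ s) (hqr : q ≠ r)
    (hqs : q ≠ s) (hrs : r ≠ s) : ({p, q, r, s} : Finset ι).card = 4 := by
  simp [*]

/-- A set of four elements with two prescribed ones. -/
theorem exists_eq_of_card_four {T : Finset ι} (hT : T.card = 4) {i k : ι} (hi : i ∈ T)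
    (hk : k ∈ T) (hik : i ≠ k) : ∃ p q, p ≠ q ∧ i ≠ p ∧ i ≠ q ∧ k ≠ p ∧ k ≠ q ∧ T = {i, k, p, q} := by
  have h2 : ((T.erase i).erase k).card = 2 := by
    rw [Finset.card_erase_of_mem (by simp [hk, hik.symm]), Finset.card_erase_of_mem hi, hT]
  obtain ⟨p, q, hpq, h⟩ := Finset.card_eq_two.1 h2
  have hp : p ∈ (T.erase i).erase k := by simp [h]
  have hq : q ∈ (T.erase i).erase k := by simp [h]
  simp only [Finset.mem_erase] at hp hq
  refine ⟨p, q, hpq, hp.2.1.symm, hq.2.1.symm, hp.1.symm, hq.1.symm, ?_⟩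
  rw [← h, Finset.insert_erase (by simp [hk, hik.symm]), Finset.insert_erase hi]

/-- Two tetrads with three common coordinates are equal. -/
theorem IsTetradCode.eq_of_triple (h : IsTetradCode 𝒞) {p q r s t : ι}
    (h1 : {p, q, r, s} ∈ 𝒞) (h2 : {p, q, r, t} ∈ 𝒞) (hs : s ∉ ({p, q, r} : Finset ι))
    (ht : t ∉ ({p, q, r} : Finset ι)) : s = t := by
  by_contra hst
  have h3 := h.symmDiff_mem h1 h2
  have h4 : ({p, q, r, s} : Finset ι) ∆ {p, q, r, t} = {s, t} := by
    ext x; simp only [Finset.mem_symmDiff, Finset.mem_insert, Finset.mem_singleton] at *; grind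
  rw [h4] at h3
  have := h.four_le_card h3 (by simp)
  have := Finset.card_le_two (a := s) (b := t)
  omega

/-- If every coordinate lies in a tetrad through `i` and `k`, then the fourth points of these
tetrads define a fixed point free involution which exchanges `i` and `k`. -/
theorem IsTetradCode.exists_involution (h : IsTetradCode 𝒞) {i k : ι} (hik : i ≠ k)
    (hsat : ∀ l, ∃ T ∈ 𝒞, T.card = 4 ∧ i ∈ T ∧ k ∈ T ∧ l ∈ T) :
    ∃ τ : ι → ι, (∀ l, τ l ≠ l) ∧ (∀ l, τ (τ l) = l) ∧ τ i = k ∧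
      (∀ l, l ≠ i → l ≠ k → {i, k, l, τ l} ∈ 𝒞) := by
  have : ∀ l, ∃ l', l' ≠ l ∧ (l = i → l' = k) ∧ (l = k → l' = i) ∧
      (l ≠ i → l ≠ k → l' ≠ i ∧ l' ≠ k ∧ {i, k, l, l'} ∈ 𝒞) := by
    intro l
    by_cases hli : l = i
    · exact ⟨k, by grind⟩
    by_cases hlk : l = k
    · exact ⟨i, by grind⟩
    obtain ⟨T, hT, hc, hi, hk, hl⟩ := hsat l
    obtain ⟨p, q, hpq, hip, hiq, hkp, hkq, rfl⟩ := exists_eq_of_card_four hc hi hk hik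
    have hl' : l = p ∨ l = q := by simpa [hli, hlk] using hl
    rcases hl' with rfl | rfl
    · exact ⟨q, by grind⟩
    · refine ⟨p, hpq, by grind, by grind, fun _ _ => ⟨by grind, by grind, ?_⟩⟩
      convert hT using 1
      grind
  choose τ h1 h2 h3 h4 using this
  refine ⟨τ, h1, fun l => ?_, h2 i rfl, fun l hi hk => (h4 l hi hk).2.2⟩
  by_cases hli : l = i
  · rw [h2 l hli, h3 k rfl, hli]
  by_cases hlk : l = k
  · rw [h3 l hlk, h2 i rfl, hlk]
  obtain ⟨ha, hb, hc⟩ := h4 l hli hlk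
  obtain ⟨ha', hb', hc'⟩ := h4 _ ha hb
  refine (h.eq_of_triple (p := i) (q := k) (r := τ l) (s := l) ?_ hc' ?_ ?_).symm
  · convert hc using 1; grind
  · have := h1 l; grind
  · have := h1 (τ l); grind

section Involution

variable {i k : ι} {τ : ι → ι}

/-- The union of two pairs of the involution is a tetrad. -/
theorem IsTetradCode.pairs_mem (h : IsTetradCode 𝒞) (h1 : ∀ l, τ l ≠ l)
    (h2 : ∀ l, τ (τ l) = l) (h3 : τ i = k) (h4 : ∀ l, l ≠ i → l ≠ k → {i, k, l, τ l} ∈ 𝒞)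
    {l l' : ι} (hl : l' ≠ l) (hl' : l' ≠ τ l) : {l, τ l, l', τ l'} ∈ 𝒞 := by
  have h3' : τ k = i := by rw [← h3, h2]
  have e : ∀ x y, τ x = y ↔ x = τ y := fun x y => ⟨fun h => by rw [← h, h2], fun h => by rw [h, h2]⟩
  by_cases a1 : l = i
  · subst a1; rw [h3]; exact h4 _ hl (by rwa [h3] at hl')
  by_cases a2 : l = k
  · subst a2; rw [h3']; convert h4 l' (by rwa [h3'] at hl') hl using 1; grind
  by_cases b1 : l' = i
  · subst b1; rw [h3]; convert h4 l a1 a2 using 1; grind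
  by_cases b2 : l' = k
  · subst b2; rw [h3']; convert h4 l a1 a2 using 1; grind
  have c1 : τ l ≠ i := by rw [Ne, e, h3]; exact a2
  have c2 : τ l ≠ k := by rw [Ne, e, h3']; exact a1
  have c3 : τ l' ≠ i := by rw [Ne, e, h3]; exact b2
  have c4 : τ l' ≠ k := by rw [Ne, e, h3']; exact b1
  have c5 : τ l' ≠ l := by rw [Ne, e]; exact hl'
  have c6 : τ l' ≠ τ l := by rw [Ne, e, h2]; exact hl
  have := h.symmDiff_mem (h4 l a1 a2) (h4 l' b1 b2)
  convert this using 1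
  ext x
  have := h1 l
  have := h1 l'
  simp only [Finset.mem_symmDiff, Finset.mem_insert, Finset.mem_singleton]
  grind

/-- All pairs of the involution meet a word in the same number of points, modulo `2`. -/
theorem IsTetradCode.mem_iff_pairs (h : IsTetradCode 𝒞)
    (hp : ∀ {l l' : ι}, l' ≠ l → l' ≠ τ l → {l, τ l, l', τ l'} ∈ 𝒞) (h1 : ∀ l, τ l ≠ l)
    (h2 : ∀ l, τ (τ l) = l) {S : Finset ι} (hS : S ∈ 𝒞) (l l' : ι) :
    ((l ∈ S ↔ τ l ∈ S) ↔ (l' ∈ S ↔ τ l' ∈ S)) := by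
  by_cases a1 : l' = l
  · rw [a1]
  by_cases a2 : l' = τ l
  · rw [a2, h2]; tauto
  have e1 : τ l' ≠ l := fun e => a2 (by rw [← e, h2])
  have e2 : τ l' ≠ τ l := fun e => a1 (by rw [← h2 l', e, h2])
  have h3 := h.even_inter (hp a1 a2) hS
  have := h1 l
  have := h1 l'
  have hd : ∀ x : ι, ∀ Q : Finset ι, x ∉ Q →
      (Even ((insert x Q) ∩ S).card ↔ (x ∈ S ↔ ¬ Even (Q ∩ S).card)) := by
    intro x Q hx
    by_cases hxS : x ∈ S
    · rw [Finset.insert_inter_of_mem hxS, Finset.card_insert_of_notMem (by simp [hx]),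
        Nat.even_add_one]
      tauto
    · rw [Finset.insert_inter_of_notMem hxS]; tauto
  rw [hd _ _ (by simp; grind), hd _ _ (by simp; grind), hd _ _ (by simp; grind),
    ← insert_empty_eq, hd _ _ (by simp)] at h3
  simp at h3
  tauto

variable [Fintype ι]

/-- A numbering of the pairs of a fixed point free involution. -/
theorem exists_equiv_of_involution {ι : Type*} [Fintype ι] {τ : ι → ι} (h1 : ∀ l, τ l ≠ l)
    (h2 : ∀ l, τ (τ l) = l) :
    ∃ (m : ℕ) (π : Fin m × Bool ≃ ι), ∀ b, π (b, false) = τ (π (b, true)) := by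
  -- of each pair, the point which comes first in some enumeration is marked `true`
  let r := Fintype.equivFin ι
  let P : Finset ι := Finset.univ.filter fun l => r l < r (τ l)
  let f : Fin P.card → ι := fun b => (P.equivFin.symm b : ι)
  have hf : ∀ b, r (f b) < r (τ (f b)) := fun b =>
    (Finset.mem_filter.1 (P.equivFin.symm b).2).2
  have hfinj : Function.Injective f := Subtype.val_injective.comp P.equivFin.symm.injective
  have hfsurj : ∀ l, r l < r (τ l) → ∃ b, f b = l := fun l hl =>
    ⟨P.equivFin ⟨l, by simp [P, hl]⟩, by simp [f]⟩
  let F : Fin P.card × Bool → ι := fun x => if x.2 then f x.1 else τ (f x.1)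
  have hF : Function.Bijective F := by
    constructor
    · rintro ⟨b, s⟩ ⟨b', s'⟩ hbb
      have hb := hf b
      have hb' := hf b'
      cases s <;> cases s' <;> simp only [F, Bool.false_eq_true, if_false, if_true] at hbb
      · have hbb' : f b = f b' := by rw [← h2 (f b), hbb, h2]
        rw [hfinj hbb']
      · rw [← hbb, h2] at hb'; exact absurd hb (not_lt.2 hb'.le)
      · rw [hbb, h2] at hb; exact absurd hb (not_lt.2 hb'.le)
      · rw [hfinj hbb]
    · intro l
      rcases lt_or_gt_of_ne (fun e => h1 l (r.injective e).symm : r l ≠ r (τ l)) with hl | hl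
      · obtain ⟨b, hb⟩ := hfsurj l hl
        exact ⟨(b, true), by simp [F, hb]⟩
      · obtain ⟨b, hb⟩ := hfsurj (τ l) (by rwa [h2])
        exact ⟨(b, false), by simp [F, hb, h2]⟩
  exact ⟨P.card, Equiv.ofBijective F hF, fun b => by simp [F]⟩

/-- If all words are unions of pairs, the code consists of all unions of an even number of pairs. -/
theorem IsTetradCode.normD (h : IsTetradCode 𝒞)
    (h2 : ∀ l, τ (τ l) = l) (h3 : τ i = k) (h4 : ∀ l, l ≠ i → l ≠ k → {i, k, l, τ l} ∈ 𝒞)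
    (hinv : ∀ S ∈ 𝒞, ∀ l, l ∈ S ↔ τ l ∈ S) {m : ℕ} (π : Fin m × Bool ≃ ι)
    (hπ : ∀ b, π (b, false) = τ (π (b, true))) (a : ι → ℤ) :
    oddSet a ∈ 𝒞 ↔ NormD (a ∘ π) := by
  have h3' : τ k = i := by rw [← h3, h2]
  constructor
  · intro ha
    have e1 : ∀ b, Even (a (π (b, true)) + a (π (b, false))) := by
      intro b
      have := hinv _ ha (π (b, true))
      rw [← hπ, mem_oddSet, mem_oddSet] at this
      grind
    refine ⟨e1, ?_⟩
    have h4 := h.four_dvd_card ha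
    have h5 : (oddSet a).card = ∑ x : Fin m × Bool, if Odd (a (π x)) then 1 else 0 := by
      rw [oddSet, Finset.card_filter, ← π.sum_comp]
    have h6 : (oddSet a).card = 2 * ∑ b : Fin m, if Odd (a (π (b, true))) then 1 else 0 := by
      rw [h5, Fintype.sum_prod_type, Finset.mul_sum]
      refine Finset.sum_congr rfl fun b _ => ?_
      have := e1 b
      rw [Fintype.sum_bool]
      grind
    have h7 : Even (∑ b : Fin m, if Odd (a (π (b, true))) then 1 else 0) := by grind
    rw [← Finset.card_filter] at h7
    have h8 := even_sum_iff_even_card (fun b => a (π (b, true))) Finset.univ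
    rw [Finset.inter_univ] at h8
    exact h8.2 h7
  · rintro ⟨e1, e2⟩
    obtain ⟨T, hT, -⟩ := h.exists_tetrad i i
    have h0 : ∅ ∈ 𝒞 := by simpa using h.symmDiff_mem hT hT
    let ind : Finset ι → ι → ℤ := fun S l => if l ∈ S then 1 else 0
    have key : ∀ l, ind {l, τ l} + ind {i, k} ∈ h.lift h0 := by
      intro l
      change oddSet _ ∈ 𝒞
      rw [oddSet_add, oddSet_indicator, oddSet_indicator]
      by_cases hl : l = i
      · rw [hl, h3]; simpa using h0
      by_cases hl' : l = k
      · rw [hl', h3', Finset.pair_comm]; simpa using h0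
      convert h4 l hl hl' using 1
      have c1 : τ l ≠ i := fun e => hl' (by rw [← h2 l, e, h3])
      have c2 : τ l ≠ k := fun e => hl (by rw [← h2 l, e, h3'])
      ext x
      simp only [Finset.mem_symmDiff, Finset.mem_insert, Finset.mem_singleton]
      grind
    have hsum : ∑ b, a (π (b, true)) • (ind {π (b, true), τ (π (b, true))} + ind {i, k}) ∈
        h.lift h0 := sum_mem fun b _ => zsmul_mem (key _) _
    change oddSet _ ∈ 𝒞 at hsum
    rwa [oddSet_congr]
    intro l
    obtain ⟨⟨b, s⟩, rfl⟩ := π.surjective l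
    have hind : ∀ b', ind {π (b', true), τ (π (b', true))} (π (b, s)) =
        if b' = b then 1 else 0 := by
      intro b'
      rw [← hπ]
      cases s <;> simp [ind, eq_comm]
    have : (∑ b, a (π (b, true)) • (ind {π (b, true), τ (π (b, true))} + ind {i, k})) (π (b, s)) =
        a (π (b, true)) + (∑ b, a (π (b, true))) * ind {i, k} (π (b, s)) := by
      simp [Finset.sum_apply, Finset.sum_add_distrib, Finset.sum_mul, hind]
    rw [this]
    have h5 : Even (a (π (b, s)) - a (π (b, true))) := by
      have := e1 b
      cases s <;> grind
    have h6 := Even.mul_right e2 (ind {i, k} (π (b, s)))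
    simp only [Function.comp] at h6
    grind

/-- If some tetrad is not a union of pairs, it meets every pair in one point, and the code is the
extended Hamming code. -/
theorem IsTetradCode.exists_normE8 (h : IsTetradCode 𝒞)
    (hp : ∀ {l l' : ι}, l' ≠ l → l' ≠ τ l → {l, τ l, l', τ l'} ∈ 𝒞) (h1 : ∀ l, τ l ≠ l)
    (h2 : ∀ l, τ (τ l) = l) {T : Finset ι} (hT : T ∈ 𝒞) (hT4 : T.card = 4) {l : ι}
    (hl : ¬ (l ∈ T ↔ τ l ∈ T)) :
    ∃ π : Fin 8 ≃ ι, ∀ a : ι → ℤ, oddSet a ∈ 𝒞 ↔ NormE8 (a ∘ π) := by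
  have hall : ∀ l', ¬ (l' ∈ T ↔ τ l' ∈ T) := fun l' => by
    rwa [h.mem_iff_pairs hp h1 h2 hT l' l]
  obtain ⟨p, q, r, s, hpq, hpr, hps, hqr, hqs, hrs, rfl⟩ := Finset.card_eq_four.1 hT4
  have hτ : ∀ x y, τ x = τ y → x = y := fun x y e => by rw [← h2 x, e, h2]
  have hτ' : ∀ x y, τ x = y → x = τ y := fun x y e => by rw [← e, h2]
  have ap := hall p
  have aq := hall q
  have ar := hall r
  have as := hall s
  simp only [Finset.mem_insert, Finset.mem_singleton, true_or, or_true, true_iff, not_or] at ap aq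
  simp only [Finset.mem_insert, Finset.mem_singleton, true_or, or_true, true_iff, not_or] at ar as
  let F : Fin 8 → ι := ![p, τ p, q, τ q, r, τ r, s, τ s]
  have hF : Function.Bijective F := by
    constructor
    · rw [← List.nodup_ofFn]
      have : List.ofFn F = [p, τ p, q, τ q, r, τ r, s, τ s] := by simp [F, List.ofFn_succ]
      rw [this]
      simp only [List.nodup_cons, List.mem_cons, List.not_mem_nil, not_or, or_false, not_false_iff,
        List.nodup_nil, and_true]
      grind
    · intro x
      have hx := hall x
      simp only [Finset.mem_insert, Finset.mem_singleton] at hx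
      have : x = p ∨ x = q ∨ x = r ∨ x = s ∨ x = τ p ∨ x = τ q ∨ x = τ r ∨ x = τ s := by grind
      rcases this with e | e | e | e | e | e | e | e
      · exact ⟨0, e.symm⟩
      · exact ⟨2, e.symm⟩
      · exact ⟨4, e.symm⟩
      · exact ⟨6, e.symm⟩
      · exact ⟨1, e.symm⟩
      · exact ⟨3, e.symm⟩
      · exact ⟨5, e.symm⟩
      · exact ⟨7, e.symm⟩
  refine ⟨Equiv.ofBijective F hF, h.normE8 _ ?_ ?_ ?_ ?_⟩
  · exact hp (l := p) (l' := q) hpq.symm (by grind)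
  · exact hp (l := p) (l' := r) hpr.symm (by grind)
  · exact hp (l := p) (l' := s) hps.symm (by grind)
  · exact hT

end Involution

/-- A set of four elements with three prescribed ones. -/
theorem exists_fourth {T : Finset ι} (hT : T.card = 4) {p q r : ι} (hp : p ∈ T) (hq : q ∈ T)
    (hr : r ∈ T) (hpq : p ≠ q) (hpr : p ≠ r) (hqr : q ≠ r) :
    ∃ s, p ≠ s ∧ q ≠ s ∧ r ≠ s ∧ T = {p, q, r, s} := by
  obtain ⟨x, y, hxy, hpx, hpy, hqx, hqy, rfl⟩ := exists_eq_of_card_four hT hp hq hpq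
  have hr' : r = x ∨ r = y := by simpa [hpr.symm, hqr.symm] using hr
  rcases hr' with rfl | rfl
  · exact ⟨y, hpy, hqy, hxy, rfl⟩
  · exact ⟨x, hpx, hqx, hxy.symm, by rw [Finset.pair_comm]⟩

/-- A tetrad which shares a point `i` with another one has exactly one further point in common
with it. -/
theorem IsTetradCode.exists_inter_eq (h : IsTetradCode 𝒞) {S T : Finset ι} (hS : S ∈ 𝒞)
    (hT : T ∈ 𝒞) (hS4 : S.card = 4) (hT4 : T.card = 4) (hne : S ≠ T) {i : ι} (hiS : i ∈ S)
    (hiT : i ∈ T) : ∃ x, x ≠ i ∧ x ∈ S ∧ x ∈ T ∧ ∀ z ∈ S, z ∈ T → z = i ∨ z = x := by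
  have h2 := card_inter_eq_two hS4 hT4 (h.even_inter hS hT) hne hiS hiT
  obtain ⟨x, y, hxy, e⟩ := Finset.card_eq_two.1 h2
  have hmem : ∀ z, z ∈ S ∧ z ∈ T ↔ z = x ∨ z = y := fun z => by
    rw [← Finset.mem_inter, e, Finset.mem_insert, Finset.mem_singleton]
  rcases (hmem i).1 ⟨hiS, hiT⟩ with rfl | rfl
  · have := (hmem y).2 (Or.inr rfl)
    exact ⟨y, hxy.symm, this.1, this.2, fun z h1 h2 => (hmem z).1 ⟨h1, h2⟩⟩
  · have := (hmem x).2 (Or.inl rfl)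
    exact ⟨x, hxy, this.1, this.2, fun z h1 h2 => ((hmem z).1 ⟨h1, h2⟩).symm⟩

/-- Three tetrads through `i` in the position of the lines of a Fano plane minus a point, the last
one containing a point `x` outside of the tetrads through `i` and `a`, leave room for no further
point. -/
theorem IsTetradCode.eq_of_fano (h : IsTetradCode 𝒞) {i a y b z m x : ι}
    (hT : {i, a, y, b} ∈ 𝒞) (hT' : {i, a, z, m} ∈ 𝒞) (hT'' : {i, y, z, x} ∈ 𝒞)
    (hd : [i, a, y, b, z, m, x].Nodup)
    (hx : ∀ T ∈ 𝒞, T.card = 4 → i ∈ T → a ∈ T → x ∉ T) (w : ι) :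
    w = i ∨ w = a ∨ w = y ∨ w = b ∨ w = z ∨ w = m ∨ w = x := by
  simp only [List.nodup_cons, List.mem_cons, List.not_mem_nil, not_or, or_false, not_false_iff,
    List.nodup_nil, and_true] at hd
  by_contra! hw
  obtain ⟨Y, hY, hY4, hiY, hwY⟩ := h.exists_tetrad i w
  have hne : ∀ p q r : ι, w ≠ p → w ≠ q → w ≠ r → Y ≠ {i, p, q, r} := by
    rintro p q r h1 h2 h3 rfl
    simp only [Finset.mem_insert, Finset.mem_singleton] at hwY
    grind
  -- a tetrad through `i` and `w` meets each of the three tetrads in one further point, and adding it to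
  -- two of them would produce a tetrad which contains `i`, `a` and `x`
  have hfar : {w, x, i, a} ∉ 𝒞 := fun hm => by
    refine hx _ hm (card_four ?_ ?_ ?_ ?_ ?_ ?_) (by simp) (by simp) (by simp) <;> grind
  obtain ⟨u, hui, huY, huT, hu⟩ := h.exists_inter_eq hY hT hY4 (card_four (by grind) (by grind)
    (by grind) (by grind) (by grind) (by grind)) (hne _ _ _ hw.2.1 hw.2.2.1 hw.2.2.2.1) hiY (by simp)
  obtain ⟨v, hvi, hvY, hvT, hv⟩ := h.exists_inter_eq hY hT' hY4 (card_four (by grind) (by grind)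
    (by grind) (by grind) (by grind) (by grind)) (hne _ _ _ (by grind) (by grind) (by grind)) hiY
    (by simp)
  obtain ⟨t, hti, htY, htT, ht⟩ := h.exists_inter_eq hY hT'' hY4 (card_four (by grind) (by grind)
    (by grind) (by grind) (by grind) (by grind)) (hne _ _ _ (by grind) (by grind) (by grind)) hiY
    (by simp)
  simp only [Finset.mem_insert, Finset.mem_singleton] at hu hv ht huT hvT htT
  by_cases haY : a ∈ Y
  · have hxY := hx Y hY hY4 hiY haY
    have e1 : u = a := ((hu a haY (by simp)).resolve_left (by grind)).symm
    have e2 : v = a := ((hv a haY (by simp)).resolve_left (by grind)).symm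
    have : t = y ∨ t = z := by grind
    rcases this with rfl | rfl
    · have := hu t htY (by simp); grind
    · have := hv t htY (by simp); grind
  have hu' : u = y ∨ u = b := by grind
  have hv' : v = z ∨ v = m := by grind
  obtain ⟨s, hs1, hs2, hs3, rfl⟩ := exists_fourth hY4 hiY hwY huY (by grind) (by grind)
    (by grind)
  have hvs : v = s := by
    simp only [Finset.mem_insert, Finset.mem_singleton] at hvY
    grind
  subst hvs
  simp only [Finset.mem_insert, Finset.mem_singleton] at htY
  have hcase : u = y ∧ v = m ∨ u = b ∧ v = z := by
    rcases hu' with rfl | rfl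
    · have := ht u (by simp) (by simp)
      rcases hv' with rfl | rfl
      · have := ht v (by simp) (by simp); grind
      · exact Or.inl ⟨rfl, rfl⟩
    · grind
  rcases hcase with ⟨rfl, rfl⟩ | ⟨rfl, rfl⟩
  · refine hfar ?_
    convert h.symmDiff_mem (h.symmDiff_mem hY hT'') hT' using 1
    ext q
    simp only [Finset.mem_symmDiff, Finset.mem_insert, Finset.mem_singleton]
    grind
  · refine hfar ?_
    convert h.symmDiff_mem (h.symmDiff_mem hY hT'') hT using 1
    ext q
    simp only [Finset.mem_symmDiff, Finset.mem_insert, Finset.mem_singleton]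
    grind

/-- If for every pair of coordinates the tetrads through it miss some coordinate, the code is the
simplex code of length `7`. -/
theorem IsTetradCode.exists_normE7 [Fintype ι] (h : IsTetradCode 𝒞) {i k : ι} (hik : i ≠ k)
    (hunsat : ∀ i k : ι, i ≠ k → ∃ l, ∀ T ∈ 𝒞, T.card = 4 → i ∈ T → k ∈ T → l ∉ T) :
    ∃ π : Fin 7 ≃ ι, ∀ a : ι → ℤ, oddSet a ∈ 𝒞 ↔ NormE7 (a ∘ π) := by
  -- two tetrads with exactly two points `i` and `a` in common
  obtain ⟨l₀, hl₀⟩ := hunsat i k hik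
  obtain ⟨T, hT, hT4, hiT, hkT⟩ := h.exists_tetrad i k
  obtain ⟨T', hT', hT'4, hiT', hlT'⟩ := h.exists_tetrad i l₀
  have hkT' : k ∉ T' := fun hk => hl₀ T' hT' hT'4 hiT' hk hlT'
  obtain ⟨a, hai, haT, haT', hTT'⟩ := h.exists_inter_eq hT hT' hT4 hT'4
    (by rintro rfl; exact hkT' hkT) hiT hiT'
  -- a point `x` outside of the tetrads through `i` and `a`, and a tetrad through `i` and `x`
  obtain ⟨x, hx⟩ := hunsat i a hai.symm
  have hx1 := hx _ hT hT4 hiT haT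
  have hx2 := hx _ hT' hT'4 hiT' haT'
  obtain ⟨T'', hT'', hT''4, hiT'', hxT''⟩ := h.exists_tetrad i x
  have haT'' : a ∉ T'' := fun ha => hx T'' hT'' hT''4 hiT'' ha hxT''
  obtain ⟨y, hyi, hyT'', hyT, hy⟩ := h.exists_inter_eq hT'' hT hT''4 hT4
    (by rintro rfl; exact hx1 hxT'') hiT'' hiT
  obtain ⟨z, hzi, hzT'', hzT', hz⟩ := h.exists_inter_eq hT'' hT' hT''4 hT'4
    (by rintro rfl; exact hx2 hxT'') hiT'' hiT'
  have hya : y ≠ a := by rintro rfl; exact haT'' hyT''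
  have hza : z ≠ a := by rintro rfl; exact haT'' hzT''
  have hyz : y ≠ z := by rintro rfl; have := hTT' y hyT hzT'; tauto
  obtain ⟨b, hib, hab, hyb, rfl⟩ := exists_fourth hT4 hiT haT hyT hai.symm hyi.symm hya.symm
  obtain ⟨m, him, ham, hzm, rfl⟩ := exists_fourth hT'4 hiT' haT' hzT' hai.symm hzi.symm hza.symm
  obtain ⟨x', hix, hyx, hzx, rfl⟩ := exists_fourth hT''4 hiT'' hyT'' hzT'' hyi.symm hzi.symm hyz
  simp only [Finset.mem_insert, Finset.mem_singleton, not_or] at hx1 hx2 hxT'' hTT'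
  obtain rfl : x = x' := by tauto
  have hnd : [i, a, y, b, z, m, x].Nodup := by
    have := hTT' z
    have := hTT' y
    have := hTT' b
    simp only [List.nodup_cons, List.mem_cons, List.not_mem_nil, not_or, or_false, not_false_iff,
      List.nodup_nil, and_true]
    clear hl₀ hx hy hz hTT' hunsat
    grind
  have hsurj := h.eq_of_fano hT hT' hT'' hnd hx
  let F : Fin 7 → ι := ![i, a, y, b, z, m, x]
  have hF : Function.Bijective F := by
    constructor
    · rw [← List.nodup_ofFn]
      have : List.ofFn F = [i, a, y, b, z, m, x] := by simp [F, List.ofFn_succ]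
      rwa [this]
    · intro w
      rcases hsurj w with e | e | e | e | e | e | e
      · exact ⟨0, e.symm⟩
      · exact ⟨1, e.symm⟩
      · exact ⟨2, e.symm⟩
      · exact ⟨3, e.symm⟩
      · exact ⟨4, e.symm⟩
      · exact ⟨5, e.symm⟩
      · exact ⟨6, e.symm⟩
  exact ⟨Equiv.ofBijective F hF, h.normE7 _ hT hT' hT''⟩

/-- The classification of tetrad codes. The cases are distinguished by whether the tetrads through some
pair of coordinates cover all coordinates; if so, these tetrads partition the coordinates into pairs, and
it remains to see whether all tetrads are unions of such pairs. -/
theorem IsTetradCode.classification [Fintype ι] [Nonempty ι] (h : IsTetradCode 𝒞) :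
    (∃ k, 2 ≤ k ∧ ∃ π : Fin k × Bool ≃ ι, ∀ a : ι → ℤ, oddSet a ∈ 𝒞 ↔ NormD (a ∘ π)) ∨
    (∃ π : Fin 7 ≃ ι, ∀ a : ι → ℤ, oddSet a ∈ 𝒞 ↔ NormE7 (a ∘ π)) ∨
    (∃ π : Fin 8 ≃ ι, ∀ a : ι → ℤ, oddSet a ∈ 𝒞 ↔ NormE8 (a ∘ π)) := by
  obtain ⟨j⟩ := ‹Nonempty ι›
  obtain ⟨T₀, hT₀, hT₀4, -, -⟩ := h.exists_tetrad j j
  obtain ⟨i₀, k₀, -, -, hne, -⟩ := Finset.card_eq_four.1 hT₀4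
  by_cases hsat : ∃ i k : ι, i ≠ k ∧ ∀ l, ∃ T ∈ 𝒞, T.card = 4 ∧ i ∈ T ∧ k ∈ T ∧ l ∈ T
  · obtain ⟨i, k, hik, hsat⟩ := hsat
    obtain ⟨τ, h1, h2, h3, h4⟩ := h.exists_involution hik hsat
    have hp : ∀ {l l' : ι}, l' ≠ l → l' ≠ τ l → {l, τ l, l', τ l'} ∈ 𝒞 :=
      fun hl hl' => h.pairs_mem h1 h2 h3 h4 hl hl'
    by_cases hinv : ∀ T ∈ 𝒞, T.card = 4 → ∀ l, l ∈ T ↔ τ l ∈ T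
    · left
      obtain ⟨m, π, hπ⟩ := exists_equiv_of_involution h1 h2
      refine ⟨m, ?_, π, h.normD h2 h3 h4 (fun S hS l => ?_) π hπ⟩
      · have e1 := Fintype.card_congr π
        have e2 := Finset.card_le_univ T₀
        simp only [Fintype.card_prod, Fintype.card_fin, Fintype.card_bool] at e1
        omega
      · have := h.generated hS
        clear hS
        induction this with
        | empty => simp
        | step _ hT ih =>
          have := hinv _ hT.1 hT.2 l
          rw [Finset.mem_symmDiff, Finset.mem_symmDiff]; tauto
    · right; right
      push Not at hinv
      obtain ⟨T, hT, hT4, l, hl⟩ := hinv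
      exact h.exists_normE8 hp h1 h2 hT hT4 (l := l) (by tauto)
  · right; left
    push Not at hsat
    exact h.exists_normE7 hne hsat

end Classification

/-! ### Weighted frames and the weights on one column -/

section Weights

variable {ι κ : Type*} [Fintype ι]

/-- The support of the column `j` of an integer matrix. -/
def colSupp (A : ι → κ → ℤ) (j : κ) : Finset ι := Finset.univ.filter fun i => A i j ≠ 0

@[simp] theorem mem_colSupp {A : ι → κ → ℤ} {i : ι} {j : κ} : i ∈ colSupp A j ↔ A i j ≠ 0 := by
  simp [colSupp]

variable [Fintype κ] [DecidableEq ι]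

/-- The combinatorial content of a perfection relation `∑ lam i p_{e_i} = ∑ lam' j p_{e'_j}` with
`e'_j = (1 / 2) ∑ A i j e_i`: the matrix `A` has entries `0, ±1` and columns of weight `4`, its rows
and columns are orthogonal for the given weights, supports of columns meet evenly, and the bipartite
graph defined by `A` is connected. -/
structure IsWeightedFrame (A : ι → κ → ℤ) (lam : ι → ℝ) (lam' : κ → ℝ) : Prop where
  pos : ∀ i, 0 < lam i
  pos' : ∀ j, 0 < lam' j
  entry : ∀ i j, A i j = 0 ∨ A i j = 1 ∨ A i j = -1
  card_col : ∀ j, (colSupp A j).card = 4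
  row_orth : ∀ i k, i ≠ k → ∑ j, lam' j * ((A i j : ℝ) * A k j) = 0
  row_norm : ∀ i, ∑ j, lam' j * (A i j : ℝ) ^ 2 = 4 * lam i
  col_orth : ∀ j k, j ≠ k → ∑ i, (A i j : ℝ) * A i k / lam i = 0
  col_norm : ∀ j, ∑ i, (A i j : ℝ) ^ 2 / lam i = 4 / lam' j
  even_inter : ∀ j k, Even (colSupp A j ∩ colSupp A k).card
  connected : ∀ I : Set ι, I.Nonempty →
    (∀ j, (∀ i ∈ colSupp A j, i ∈ I) ∨ (∀ i ∈ colSupp A j, i ∉ I)) → ∀ i, i ∈ I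

/-- The columns with the same support as the column `j`. -/
def sameSupp (A : ι → κ → ℤ) (j : κ) : Finset κ :=
  Finset.univ.filter fun u => colSupp A u = colSupp A j

/-- The columns through the rows `x` and `y` whose support is not that of the column `j`. -/
def otherCols (A : ι → κ → ℤ) (j : κ) (x y : ι) : Finset κ :=
  Finset.univ.filter fun w => x ∈ colSupp A w ∧ y ∈ colSupp A w ∧ colSupp A w ≠ colSupp A j

/-- The number of rows `y` of the support of the column `j` such that some column meets this support
exactly in `x` and `y`. -/
def linkDegree (A : ι → κ → ℤ) (j : κ) (x : ι) : ℕ :=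
  (((colSupp A j).erase x).filter fun y => (otherCols A j x y).Nonempty).card

namespace IsWeightedFrame

variable {A : ι → κ → ℤ} {lam : ι → ℝ} {lam' : κ → ℝ}

theorem entry_of_mem (h : IsWeightedFrame A lam lam') {i : ι} {j : κ} (hi : i ∈ colSupp A j) :
    A i j = 1 ∨ A i j = -1 := by
  have := h.entry i j
  rw [mem_colSupp] at hi
  tauto

theorem sq_entry (h : IsWeightedFrame A lam lam') {i : ι} {j : κ} (hi : i ∈ colSupp A j) :
    A i j * A i j = 1 := by
  rcases h.entry_of_mem hi with e | e <;> simp [e]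

theorem card_inter (h : IsWeightedFrame A lam lam') {j w : κ} (hne : colSupp A w ≠ colSupp A j)
    {x : ι} (hx : x ∈ colSupp A j) (hxw : x ∈ colSupp A w) :
    (colSupp A j ∩ colSupp A w).card = 2 :=
  card_inter_eq_two (h.card_col j) (h.card_col w) (h.even_inter j w) hne.symm hx hxw

theorem inter_eq (h : IsWeightedFrame A lam lam') {j w : κ} (hne : colSupp A w ≠ colSupp A j)
    {x y : ι} (hxy : x ≠ y) (hx : x ∈ colSupp A j) (hxw : x ∈ colSupp A w)
    (hy : y ∈ colSupp A j) (hyw : y ∈ colSupp A w) : colSupp A j ∩ colSupp A w = {x, y} := by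
  refine (Finset.eq_of_subset_of_card_le ?_ ?_).symm
  · intro z hz
    simp only [Finset.mem_insert, Finset.mem_singleton] at hz
    rcases hz with rfl | rfl <;> simp_all
  · rw [h.card_inter hne hx hxw, Finset.card_pair hxy]

/-- Two columns with different supports through the rows `x` and `y` have no other row in common, so
their orthogonality has only two terms. -/
theorem link (h : IsWeightedFrame A lam lam') {j w : κ} (hne : colSupp A w ≠ colSupp A j)
    {x y : ι} (hxy : x ≠ y) (hx : x ∈ colSupp A j) (hxw : x ∈ colSupp A w)
    (hy : y ∈ colSupp A j) (hyw : y ∈ colSupp A w) :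
    lam x = lam y ∧ A x j * A y j = -(A x w * A y w) := by
  have h1 := h.col_orth j w (by rintro rfl; exact hne rfl)
  rw [← Finset.sum_subset (Finset.subset_univ (colSupp A j ∩ colSupp A w)),
    h.inter_eq hne hxy hx hxw hy hyw, Finset.sum_pair hxy] at h1
  · have p1 := h.pos x
    have p2 := h.pos y
    field_simp at h1
    rcases h.entry_of_mem hx with e1 | e1 <;> rcases h.entry_of_mem hxw with e2 | e2 <;>
    rcases h.entry_of_mem hy with e3 | e3 <;> rcases h.entry_of_mem hyw with e4 | e4 <;>
    simp only [e1, e2, e3, e4] at h1 ⊢ <;> norm_num at h1 ⊢ <;> linarith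
  · intro i _ hi
    have : A i j = 0 ∨ A i w = 0 := by
      by_contra! hc
      exact hi (by simp [hc])
    rcases this with e | e <;> simp [e]

theorem col_norm' (h : IsWeightedFrame A lam lam') (j : κ) :
    ∑ i ∈ colSupp A j, 1 / lam i = 4 / lam' j := by
  rw [← h.col_norm j, ← Finset.sum_subset (Finset.subset_univ (colSupp A j))]
  · refine Finset.sum_congr rfl fun i hi => ?_
    have := h.sq_entry hi
    rw [sq]; norm_cast; rw [this]; simp
  · intro i _ hi
    have : A i j = 0 := by simpa using hi
    simp [this]

theorem lam'_eq (h : IsWeightedFrame A lam lam') {j u : κ} (hu : colSupp A u = colSupp A j) :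
    lam' u = lam' j := by
  have h1 := h.col_norm' u
  rw [hu, h.col_norm' j] at h1
  have := h.pos' u
  have := h.pos' j
  field_simp at h1
  linarith

theorem sum_sameSupp (h : IsWeightedFrame A lam lam') (j : κ) :
    ∑ u ∈ sameSupp A j, lam' u = (sameSupp A j).card * lam' j := by
  rw [← nsmul_eq_mul]
  exact Finset.sum_eq_card_nsmul fun u hu => h.lam'_eq (Finset.mem_filter.1 hu).2

/-- The orthogonality of the rows `x` and `y`, the columns being sorted by their supports. -/
theorem row_orth' (h : IsWeightedFrame A lam lam') {j : κ} {x y : ι} (hxy : x ≠ y)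
    (hx : x ∈ colSupp A j) (hy : y ∈ colSupp A j) :
    lam' j * ((∑ u ∈ sameSupp A j, A x u * A y u : ℤ) : ℝ) =
      ∑ w ∈ otherCols A j x y, lam' w * ((A x j : ℝ) * A y j) := by
  classical
  have h1 := h.row_orth x y hxy
  have hdisj : Disjoint (sameSupp A j) (otherCols A j x y) := by
    rw [Finset.disjoint_left]
    intro u hu hu'
    simp only [sameSupp, otherCols, Finset.mem_filter] at hu hu'
    exact hu'.2.2.2 hu.2
  rw [← Finset.sum_subset (Finset.subset_univ (sameSupp A j ∪ otherCols A j x y)),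
    Finset.sum_union hdisj] at h1
  · have h2 : ∑ u ∈ sameSupp A j, lam' u * ((A x u : ℝ) * A y u) =
        lam' j * ((∑ u ∈ sameSupp A j, A x u * A y u : ℤ) : ℝ) := by
      push_cast
      rw [Finset.mul_sum]
      refine Finset.sum_congr rfl fun u hu => ?_
      rw [h.lam'_eq (Finset.mem_filter.1 hu).2]
    have h3 : ∑ w ∈ otherCols A j x y, lam' w * ((A x w : ℝ) * A y w) =
        -∑ w ∈ otherCols A j x y, lam' w * ((A x j : ℝ) * A y j) := by
      rw [← Finset.sum_neg_distrib]
      refine Finset.sum_congr rfl fun w hw => ?_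
      simp only [otherCols, Finset.mem_filter] at hw
      have := (h.link hw.2.2.2 hxy hx hw.2.1 hy hw.2.2.1).2
      have h4 : (A x j : ℝ) * A y j = -((A x w : ℝ) * A y w) := by exact_mod_cast this
      rw [h4]; ring
    rw [h2, h3] at h1
    linarith
  · intro i _ hi
    have : A x i = 0 ∨ A y i = 0 := by
      by_contra! hc
      refine hi ?_
      simp only [sameSupp, otherCols, Finset.mem_union, Finset.mem_filter, Finset.mem_univ,
        true_and, mem_colSupp]
      tauto
    rcases this with e | e <;> simp [e]

/-- If some column meets the support `T` of the column `j` exactly in `x` and `y`, these columns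
have the same total weight as the columns of support `T`. -/
theorem sum_otherCols (h : IsWeightedFrame A lam lam') {j : κ} {x y : ι} (hxy : x ≠ y)
    (hx : x ∈ colSupp A j) (hy : y ∈ colSupp A j) (hne : (otherCols A j x y).Nonempty) :
    ∑ w ∈ otherCols A j x y, lam' w = (sameSupp A j).card * lam' j := by
  obtain ⟨w, hw⟩ := hne
  simp only [otherCols, Finset.mem_filter, Finset.mem_univ, true_and] at hw
  have h1 := h.row_orth' hxy hx hy
  have h2 : ∑ u ∈ sameSupp A j, A x u * A y u = (sameSupp A j).card * (A x j * A y j) := by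
    rw [← nsmul_eq_mul]
    refine Finset.sum_eq_card_nsmul fun u hu => ?_
    have hu' := (Finset.mem_filter.1 hu).2
    rw [(h.link hw.2.2 hxy hx hw.1 hy hw.2.1).2]
    exact (h.link (j := u) (by rw [hu']; exact hw.2.2) hxy (by rwa [hu']) hw.1
      (by rwa [hu']) hw.2.1).2
  rw [h2, ← Finset.sum_mul] at h1
  push_cast at h1
  have h3 : ((A x j : ℝ) * A y j) * ((A x j : ℝ) * A y j) = 1 := by
    have e1 := h.sq_entry hx
    have e2 := h.sq_entry hy
    have : (A x j * A y j) * (A x j * A y j) = 1 := by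
      calc _ = (A x j * A x j) * (A y j * A y j) := by ring
        _ = 1 := by rw [e1, e2]; ring
    exact_mod_cast this
  linear_combination -((A x j : ℝ) * A y j) * h1 +
    (-(∑ w ∈ otherCols A j x y, lam' w) + (sameSupp A j).card * lam' j) * h3

/-- If no other support meets that of the column `j` in `x` and `y`, the columns with this support are
equally often of equal and of opposite signs in these rows. -/
theorem even_card_sameSupp (h : IsWeightedFrame A lam lam') {j : κ} {x y : ι} (hxy : x ≠ y)
    (hx : x ∈ colSupp A j) (hy : y ∈ colSupp A j) (hne : ¬ (otherCols A j x y).Nonempty) :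
    Even (sameSupp A j).card := by
  have h1 := h.row_orth' hxy hx hy
  rw [Finset.not_nonempty_iff_eq_empty.1 hne, Finset.sum_empty] at h1
  have h2 : ∑ u ∈ sameSupp A j, A x u * A y u = 0 := by
    have := (mul_eq_zero.1 h1).resolve_left (h.pos' j).ne'
    exact_mod_cast this
  have h3 : Even (∑ u ∈ sameSupp A j, (A x u * A y u + 1)) := by
    refine Finset.even_sum _ fun u hu => ?_
    have hu' := (Finset.mem_filter.1 hu).2
    rcases h.entry_of_mem (i := x) (j := u) (by rwa [hu']) with e1 | e1 <;>
    rcases h.entry_of_mem (i := y) (j := u) (by rwa [hu']) with e2 | e2 <;> simp [e1, e2]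
  rw [Finset.sum_add_distrib, h2] at h3
  simpa using h3

/-- The weight of the row `x` as the norm of this row: besides the columns with the support of `j`, every
neighbour of `x` contributes columns of the same total weight. -/
theorem lam_eq_linkDegree (h : IsWeightedFrame A lam lam') {j : κ} {x : ι}
    (hx : x ∈ colSupp A j) :
    4 * lam x = (sameSupp A j).card * lam' j * (1 + linkDegree A j x) := by
  -- the columns through `x` of another support are sorted by their second point on that of `j`
  have h1 : ∑ w ∈ Finset.univ.filter (fun w => x ∈ colSupp A w ∧ colSupp A w ≠ colSupp A j), lam' w
      = ∑ y ∈ (colSupp A j).erase x, ∑ w ∈ otherCols A j x y, lam' w := by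
    have h2 : ∀ y, otherCols A j x y = (Finset.univ.filter
        (fun w => x ∈ colSupp A w ∧ colSupp A w ≠ colSupp A j)).filter
          fun w => y ∈ colSupp A w := by
      intro y; ext w
      simp only [otherCols, Finset.mem_filter]; tauto
    have h3 : ∀ y, ∑ w ∈ otherCols A j x y, lam' w = ∑ w ∈ Finset.univ.filter
        (fun w => x ∈ colSupp A w ∧ colSupp A w ≠ colSupp A j),
          if y ∈ colSupp A w then lam' w else 0 := fun y => by rw [h2, Finset.sum_filter]
    rw [Finset.sum_congr rfl fun y _ => h3 y, Finset.sum_comm]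
    refine Finset.sum_congr rfl fun w hw => ?_
    have hw := (Finset.mem_filter.1 hw).2
    rw [← Finset.sum_filter, Finset.sum_const]
    have : ((colSupp A j).erase x).filter (fun y => y ∈ colSupp A w) =
        (colSupp A j ∩ colSupp A w).erase x := by
      ext y; simp only [Finset.mem_filter, Finset.mem_erase, Finset.mem_inter]; tauto
    rw [this, Finset.card_erase_of_mem (Finset.mem_inter.2 ⟨hx, hw.1⟩), h.card_inter hw.2 hx hw.1]
    simp
  have h3 : ∑ y ∈ (colSupp A j).erase x, ∑ w ∈ otherCols A j x y, lam' w =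
      linkDegree A j x * ((sameSupp A j).card * lam' j) := by
    rw [linkDegree, ← nsmul_eq_mul, ← Finset.sum_const, Finset.sum_filter]
    refine Finset.sum_congr rfl fun y hy => ?_
    rw [Finset.mem_erase] at hy
    split_ifs with hne
    · exact h.sum_otherCols hy.1.symm hx hy.2 hne
    · rw [Finset.not_nonempty_iff_eq_empty.1 hne, Finset.sum_empty]
  have h4 : 4 * lam x = ∑ w ∈ Finset.univ.filter (fun w => x ∈ colSupp A w), lam' w := by
    rw [← h.row_norm x, Finset.sum_filter]
    refine Finset.sum_congr rfl fun w _ => ?_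
    split_ifs with hw
    · have : (A x w : ℝ) * A x w = 1 := by exact_mod_cast h.sq_entry hw
      rw [sq, this, mul_one]
    · have : A x w = 0 := by simpa using hw
      simp [this]
  classical
  have h5 : ∑ w ∈ Finset.univ.filter (fun w => x ∈ colSupp A w), lam' w =
      ∑ w ∈ sameSupp A j, lam' w + ∑ w ∈ Finset.univ.filter
        (fun w => x ∈ colSupp A w ∧ colSupp A w ≠ colSupp A j), lam' w := by
    rw [← Finset.sum_union]
    · congr 1
      ext w
      simp only [sameSupp, Finset.mem_union, Finset.mem_filter, Finset.mem_univ, true_and]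
      by_cases e : colSupp A w = colSupp A j
      · simp [e, hx]
      · simp [e]
    · rw [Finset.disjoint_left]
      intro u hu hu'
      simp only [sameSupp, Finset.mem_filter] at hu hu'
      exact hu'.2.2 hu.2
  rw [h4, h5, h.sum_sameSupp, h1, h3]; ring

theorem card_sameSupp_pos (j : κ) : 0 < (sameSupp A j).card :=
  Finset.card_pos.2 ⟨j, by simp [sameSupp]⟩

/-- The norm of the column `j`, rewritten in terms of degrees. -/
theorem sum_inv_linkDegree (h : IsWeightedFrame A lam lam') (j : κ) :
    ∑ x ∈ colSupp A j, 1 / (1 + linkDegree A j x : ℝ) = (sameSupp A j).card := by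
  have h1 := h.col_norm' j
  have hm : (0 : ℝ) < (sameSupp A j).card := by exact_mod_cast card_sameSupp_pos j
  have hp := h.pos' j
  have h2 : ∑ x ∈ colSupp A j, 1 / (1 + linkDegree A j x : ℝ) =
      ∑ x ∈ colSupp A j, ((sameSupp A j).card * lam' j / 4) * (1 / lam x) := by
    refine Finset.sum_congr rfl fun x hx => ?_
    have := h.lam_eq_linkDegree hx
    have hx' := h.pos x
    field_simp
    linarith
  rw [h2, ← Finset.mul_sum, h1]
  field_simp

end IsWeightedFrame
end Weights

/-! ### Columns with non-constant weights -/

section FourVertices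

variable {ι : Type*} [DecidableEq ι]

/-- A graph on four vertices in which adjacent vertices have the same degree is regular, or consists
of a triangle and an isolated vertex, or of an edge and two isolated vertices. -/
theorem four_vertices {x y z t : ι} (hxy : x ≠ y) (hxz : x ≠ z) (hxt : x ≠ t) (hyz : y ≠ z)
    (hyt : y ≠ t) (hzt : z ≠ t) {r : ι → ι → Prop} [DecidableRel r]
    (hsymm : ∀ u v, r u v → r v u) {d : ι → ℕ}
    (hd : ∀ u, d u = ((({x, y, z, t} : Finset ι).erase u).filter (r u)).card)
    (hr : ∀ u ∈ ({x, y, z, t} : Finset ι), ∀ v ∈ ({x, y, z, t} : Finset ι), u ≠ v → r u v →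
      d u = d v) :
    (d x = d y ∧ d x = d z ∧ d x = d t) ∨
    (d x = 0 ∧ d y = 2 ∧ d z = 2 ∧ d t = 2) ∨ (d x = 2 ∧ d y = 0 ∧ d z = 2 ∧ d t = 2) ∨
    (d x = 2 ∧ d y = 2 ∧ d z = 0 ∧ d t = 2) ∨ (d x = 2 ∧ d y = 2 ∧ d z = 2 ∧ d t = 0) ∨
    (d x + d y + d z + d t = 2 ∧ d x ≤ 1 ∧ d y ≤ 1 ∧ d z ≤ 1 ∧ d t ≤ 1) := by
  have hs : ∀ u v, r u v ↔ r v u := fun u v => ⟨hsymm u v, hsymm v u⟩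
  have dx : d x = (if r x y then 1 else 0) + (if r x z then 1 else 0) + (if r x t then 1 else 0) := by
    have : ({x, y, z, t} : Finset ι).erase x = {y, z, t} := by ext; simp; grind
    rw [hd, this, Finset.card_filter, Finset.sum_insert (by simp [*]),
      Finset.sum_insert (by simp [*]), Finset.sum_singleton, add_assoc]
  have dy : d y = (if r x y then 1 else 0) + (if r y z then 1 else 0) + (if r y t then 1 else 0) := by
    have : ({x, y, z, t} : Finset ι).erase y = {x, z, t} := by ext; simp; grind
    rw [hd, this, Finset.card_filter, Finset.sum_insert (by simp [*]),
      Finset.sum_insert (by simp [*]), Finset.sum_singleton, add_assoc]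
    simp only [hs y x]
  have dz : d z = (if r x z then 1 else 0) + (if r y z then 1 else 0) + (if r z t then 1 else 0) := by
    have : ({x, y, z, t} : Finset ι).erase z = {x, y, t} := by ext; simp; grind
    rw [hd, this, Finset.card_filter, Finset.sum_insert (by simp [*]),
      Finset.sum_insert (by simp [*]), Finset.sum_singleton, add_assoc]
    simp only [hs z x, hs z y]
  have dt : d t = (if r x t then 1 else 0) + (if r y t then 1 else 0) + (if r z t then 1 else 0) := by
    have : ({x, y, z, t} : Finset ι).erase t = {x, y, z} := by ext; simp; grind
    rw [hd, this, Finset.card_filter, Finset.sum_insert (by simp [*]),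
      Finset.sum_insert (by simp [*]), Finset.sum_singleton, add_assoc]
    simp only [hs t x, hs t y, hs t z]
  have r1 := hr x (by simp) y (by simp) hxy
  have r2 := hr x (by simp) z (by simp) hxz
  have r3 := hr x (by simp) t (by simp) hxt
  have r4 := hr y (by simp) z (by simp) hyz
  have r5 := hr y (by simp) t (by simp) hyt
  have r6 := hr z (by simp) t (by simp) hzt
  clear hd hr hs hsymm
  by_cases b1 : r x y <;> by_cases b2 : r x z <;> by_cases b3 : r x t <;> by_cases b4 : r y z <;>
  by_cases b5 : r y t <;> by_cases b6 : r z t <;>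
  simp only [b1, b2, b3, b4, b5, b6, if_true, if_false, forall_const, false_imp_iff]
    at dx dy dz dt r1 r2 r3 r4 r5 r6 <;> omega

end FourVertices

namespace IsWeightedFrame

variable {ι κ : Type*} [Fintype ι] [Fintype κ] [DecidableEq ι]
variable {A : ι → κ → ℤ} {lam : ι → ℝ} {lam' : κ → ℝ}

/-- The columns with the support `T` of the column `j` are two in number, no other column goes
through the row `p` of `T`, any two other rows of `T` form the intersection of `T` with some support,
and the weights of the rows of `T` are `c` for `p` and `3 c` for the others. -/
structure IsSpecial (A : ι → κ → ℤ) (lam : ι → ℝ) (lam' : κ → ℝ) (j : κ) (p : ι) : Prop where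
  mem : p ∈ colSupp A j
  lam_eq : ∀ x ∈ colSupp A j, x ≠ p → lam x = 3 * lam p
  lam'_eq : lam' j = 2 * lam p
  card_sameSupp : (sameSupp A j).card = 2
  eq_of_mem : ∀ w, p ∈ colSupp A w → colSupp A w = colSupp A j
  nonempty : ∀ x ∈ colSupp A j, ∀ y ∈ colSupp A j, x ≠ p → y ≠ p → x ≠ y →
    (otherCols A j x y).Nonempty

/-- A triangle and an isolated vertex `p`: by `sum_inv_linkDegree`, the number of columns with this
support is `1 + 3 · (1 / 3) = 2`. -/
theorem isSpecial_of_linkDegree (h : IsWeightedFrame A lam lam') {j : κ} {p : ι}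
    (hp : p ∈ colSupp A j) (h0 : linkDegree A j p = 0)
    (h2 : ∀ x ∈ colSupp A j, x ≠ p → linkDegree A j x = 2) : IsSpecial A lam lam' j p := by
  have hm : (sameSupp A j).card = 2 := by
    have h1 := h.sum_inv_linkDegree j
    rw [← Finset.add_sum_erase _ _ hp, h0, Finset.sum_congr rfl (g := fun _ => (1 / 3 : ℝ)),
      Finset.sum_const, Finset.card_erase_of_mem hp, h.card_col] at h1
    · have : ((sameSupp A j).card : ℝ) = 2 := by rw [← h1]; norm_num
      exact_mod_cast this
    · intro x hx
      rw [Finset.mem_erase] at hx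
      rw [h2 x hx.2 hx.1]; norm_num
  have hlp := h.lam_eq_linkDegree hp
  rw [hm, h0] at hlp
  push_cast at hlp
  have hiso : ∀ y ∈ colSupp A j, y ≠ p → ¬ (otherCols A j p y).Nonempty := by
    intro y hy hyp hne
    rw [linkDegree, Finset.card_eq_zero, Finset.filter_eq_empty_iff] at h0
    exact h0 (Finset.mem_erase.2 ⟨hyp, hy⟩) hne
  refine ⟨hp, fun x hx hxp => ?_, by linarith, hm, fun w hpw => ?_, fun x hx y hy hxp hyp hxy => ?_⟩
  · have hlx := h.lam_eq_linkDegree hx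
    rw [hm, h2 x hx hxp] at hlx
    push_cast at hlx
    linarith
  · by_contra hne
    have hc := h.card_inter hne hp hpw
    obtain ⟨y, hy, hyp⟩ := Finset.exists_mem_ne (by omega : 1 < (colSupp A j ∩ colSupp A w).card) p
    rw [Finset.mem_inter] at hy
    exact hiso y hy.1 hyp ⟨w, by
      simp only [otherCols, Finset.mem_filter, Finset.mem_univ, true_and]; exact ⟨hpw, hy.2, hne⟩⟩
  · -- the neighbours of `x` are the two rows of the support different from `p` and `x`
    have hsub : ((colSupp A j).erase x).filter (fun y => (otherCols A j x y).Nonempty) ⊆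
        ((colSupp A j).erase x).erase p := by
      intro y hy
      rw [Finset.mem_filter, Finset.mem_erase] at hy
      rw [Finset.mem_erase, Finset.mem_erase]
      refine ⟨?_, hy.1⟩
      rintro rfl
      refine hiso x hx hxp ?_
      convert hy.2 using 1
      ext w; simp only [otherCols, Finset.mem_filter]; tauto
    have heq := Finset.eq_of_subset_of_card_le hsub (by
      rw [Finset.card_erase_of_mem (Finset.mem_erase.2 ⟨hxp.symm, hp⟩), Finset.card_erase_of_mem hx,
        h.card_col]
      exact (h2 x hx hxp).ge)
    have hy' : y ∈ ((colSupp A j).erase x).erase p :=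
      Finset.mem_erase.2 ⟨hyp, Finset.mem_erase.2 ⟨hxy.symm, hy⟩⟩
    rw [← heq, Finset.mem_filter] at hy'
    exact hy'.2

/-- The weights of the rows are constant on the support of a column, unless the column is special. -/
theorem lam_const_or_isSpecial (h : IsWeightedFrame A lam lam') (j : κ) :
    (∀ x ∈ colSupp A j, ∀ y ∈ colSupp A j, lam x = lam y) ∨ ∃ p, IsSpecial A lam lam' j p := by
  obtain ⟨x, y, z, t, hxy, hxz, hxt, hyz, hyt, hzt, hT⟩ := Finset.card_eq_four.1 (h.card_col j)
  have hlink : ∀ u ∈ colSupp A j, ∀ v ∈ colSupp A j, u ≠ v → (otherCols A j u v).Nonempty →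
      linkDegree A j u = linkDegree A j v := by
    rintro u hu v hv huv ⟨w, hw⟩
    simp only [otherCols, Finset.mem_filter, Finset.mem_univ, true_and] at hw
    have h1 := (h.link hw.2.2 huv hu hw.1 hv hw.2.1).1
    have h2 := h.lam_eq_linkDegree hu
    have h3 := h.lam_eq_linkDegree hv
    rw [h1, h3] at h2
    have hm : (0 : ℝ) < (sameSupp A j).card * lam' j :=
      mul_pos (by exact_mod_cast card_sameSupp_pos j) (h.pos' j)
    have := mul_left_cancel₀ hm.ne' h2
    have h4 : (linkDegree A j u : ℝ) = linkDegree A j v := by linarith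
    exact_mod_cast h4
  have hfour := four_vertices hxy hxz hxt hyz hyt hzt (r := fun u v => (otherCols A j u v).Nonempty)
    (d := linkDegree A j) (fun u v huv => by
      convert huv using 1
      ext w; simp only [otherCols, Finset.mem_filter]; tauto)
    (fun u => by rw [linkDegree, hT]) (by rwa [← hT])
  have hmem : ∀ u, u ∈ colSupp A j ↔ u = x ∨ u = y ∨ u = z ∨ u = t := by
    intro u; rw [hT]; simp
  rcases hfour with hc | hc | hc | hc | hc | hc
  · left
    have hconst : ∀ u ∈ colSupp A j, linkDegree A j u = linkDegree A j x := by
      intro u hu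
      rcases (hmem u).1 hu with rfl | rfl | rfl | rfl <;> omega
    intro u hu v hv
    have h2 := h.lam_eq_linkDegree hu
    have h3 := h.lam_eq_linkDegree hv
    rw [hconst u hu] at h2
    rw [hconst v hv] at h3
    linarith
  · exact Or.inr ⟨x, h.isSpecial_of_linkDegree ((hmem x).2 (by tauto)) hc.1 fun u hu hne => by
      rcases (hmem u).1 hu with rfl | rfl | rfl | rfl <;> tauto⟩
  · exact Or.inr ⟨y, h.isSpecial_of_linkDegree ((hmem y).2 (by tauto)) hc.2.1 fun u hu hne => by
      rcases (hmem u).1 hu with rfl | rfl | rfl | rfl <;> tauto⟩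
  · exact Or.inr ⟨z, h.isSpecial_of_linkDegree ((hmem z).2 (by tauto)) hc.2.2.1 fun u hu hne => by
      rcases (hmem u).1 hu with rfl | rfl | rfl | rfl <;> tauto⟩
  · exact Or.inr ⟨t, h.isSpecial_of_linkDegree ((hmem t).2 (by tauto)) hc.2.2.2 fun u hu hne => by
      rcases (hmem u).1 hu with rfl | rfl | rfl | rfl <;> tauto⟩
  · -- an edge and two isolated vertices: there would be three columns of this support, but their
    -- number must be even because of the isolated vertices
    exfalso
    have h1 := h.sum_inv_linkDegree j
    have h3 : (sameSupp A j).card = 3 := by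
      have h2 : ∀ u ∈ colSupp A j, 1 / (1 + linkDegree A j u : ℝ) =
          1 - (linkDegree A j u : ℝ) / 2 := by
        intro u hu
        have : linkDegree A j u = 0 ∨ linkDegree A j u = 1 := by
          rcases (hmem u).1 hu with rfl | rfl | rfl | rfl <;> omega
        rcases this with e | e <;> rw [e] <;> norm_num
      rw [Finset.sum_congr rfl h2, Finset.sum_sub_distrib, ← Finset.sum_div, ← Nat.cast_sum] at h1
      have h4 : ∑ u ∈ colSupp A j, linkDegree A j u = 2 := by
        rw [hT, Finset.sum_insert (by simp [*]), Finset.sum_insert (by simp [*]),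
          Finset.sum_insert (by simp [*]), Finset.sum_singleton]
        omega
      rw [h4, Finset.sum_const, h.card_col] at h1
      have h5 : ((sameSupp A j).card : ℝ) = 3 := by rw [← h1]; norm_num
      exact_mod_cast h5
    have hiso : ∃ u ∈ colSupp A j, linkDegree A j u = 0 := by
      by_contra! hcon
      have := hcon x ((hmem x).2 (by tauto))
      have := hcon y ((hmem y).2 (by tauto))
      have := hcon z ((hmem z).2 (by tauto))
      omega
    obtain ⟨u, hu, hu0⟩ := hiso
    obtain ⟨v, hv, hvu⟩ := Finset.exists_mem_ne (by rw [h.card_col]; norm_num :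
      1 < (colSupp A j).card) u
    have := h.even_card_sameSupp hvu.symm hu hv (by
      rw [linkDegree, Finset.card_eq_zero, Finset.filter_eq_empty_iff] at hu0
      exact hu0 (Finset.mem_erase.2 ⟨hvu, hv⟩))
    rw [h3] at this
    exact absurd this (by decide)

/-- Next to a special support there is exactly one other support through two given rows of large
weight, and it is again special. -/
theorem IsSpecial.exists_next (h : IsWeightedFrame A lam lam') {j : κ} {p : ι}
    (hs : IsSpecial A lam lam' j p) {x y : ι} (hx : x ∈ colSupp A j) (hy : y ∈ colSupp A j)
    (hxp : x ≠ p) (hyp : y ≠ p) (hxy : x ≠ y) :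
    ∃ w q, IsSpecial A lam lam' w q ∧ lam q = lam p ∧ x ∈ colSupp A w ∧ y ∈ colSupp A w ∧ q ≠ x ∧
      q ≠ y ∧ colSupp A w ≠ colSupp A j ∧
      ∀ v, x ∈ colSupp A v → y ∈ colSupp A v →
        colSupp A v = colSupp A j ∨ colSupp A v = colSupp A w := by
  have hne := hs.nonempty x hx y hy hxp hyp hxy
  have hsum := h.sum_otherCols hxy hx hy hne
  rw [hs.card_sameSupp, hs.lam'_eq] at hsum
  push_cast at hsum
  have hc := h.pos p
  have hlx := hs.lam_eq x hx hxp
  have hly := hs.lam_eq y hy hyp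
  by_cases hsp : ∃ w ∈ otherCols A j x y, ∃ q, IsSpecial A lam lam' w q
  · obtain ⟨w, hw, q, hq⟩ := hsp
    have hw' := hw
    simp only [otherCols, Finset.mem_filter, Finset.mem_univ, true_and] at hw
    have hqpos := h.pos q
    have hqx : q ≠ x := by
      rintro rfl
      have := hq.lam_eq y hw.2.1 hxy.symm
      linarith
    have hqy : q ≠ y := by
      rintro rfl
      have := hq.lam_eq x hw.1 hxy
      linarith
    have hqp : lam q = lam p := by
      have := hq.lam_eq x hw.1 hqx.symm
      linarith
    refine ⟨w, q, hq, hqp, hw.1, hw.2.1, hqx, hqy, hw.2.2, fun v hxv hyv => ?_⟩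
    by_contra! hcon
    -- the two columns with the support of `w` exhaust the total weight
    have hsub : sameSupp A w ⊆ otherCols A j x y := by
      intro u hu
      simp only [otherCols, Finset.mem_filter, Finset.mem_univ, true_and, (Finset.mem_filter.1 hu).2]
      exact hw
    have hlt := Finset.sum_lt_sum_of_subset (f := lam') hsub (i := v)
      (by simp only [otherCols, Finset.mem_filter, Finset.mem_univ, true_and]
          exact ⟨hxv, hyv, hcon.1⟩)
      (by simp only [sameSupp, Finset.mem_filter, Finset.mem_univ, true_and]; exact hcon.2)
      (h.pos' v) (fun u _ _ => (h.pos' u).le)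
    rw [hsum, h.sum_sameSupp, hq.card_sameSupp, hq.lam'_eq, hqp] at hlt
    push_cast at hlt
    linarith
  · -- otherwise all these columns have the weight `3 c`, but their total weight is `4 c`
    exfalso
    have hw : ∀ w ∈ otherCols A j x y, lam' w = 3 * lam p := by
      intro w hw
      have hconst := (h.lam_const_or_isSpecial w).resolve_right fun hq => hsp ⟨w, hw, hq⟩
      simp only [otherCols, Finset.mem_filter, Finset.mem_univ, true_and] at hw
      have h1 := h.col_norm' w
      rw [Finset.sum_congr rfl fun u hu => by rw [hconst u hu x hw.1, hlx], Finset.sum_const,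
        h.card_col, nsmul_eq_mul] at h1
      have := h.pos' w
      push_cast at h1
      field_simp at h1
      linarith
    rw [Finset.sum_congr rfl hw, Finset.sum_const, nsmul_eq_mul] at hsum
    have h3 : ((otherCols A j x y).card : ℝ) * 3 = 4 := by
      refine mul_right_cancel₀ hc.ne' ?_
      linarith
    have h4 : (otherCols A j x y).card * 3 = 4 := by exact_mod_cast h3
    omega

end IsWeightedFrame

/-! ### The irregular relation -/

namespace IsWeightedFrame

variable {ι κ : Type*} [Fintype ι] [Fintype κ] [DecidableEq ι]
variable {A : ι → κ → ℤ} {lam : ι → ℝ} {lam' : κ → ℝ}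

/-- The two columns of a special support agree up to sign, except in the row of small weight. -/
theorem IsSpecial.exists_twin (h : IsWeightedFrame A lam lam') {j : κ} {p : ι}
    (hs : IsSpecial A lam lam' j p) : ∃ v, v ≠ j ∧ colSupp A v = colSupp A j ∧
      (∀ w, colSupp A w = colSupp A j → w = j ∨ w = v) ∧
      (∀ x ∈ colSupp A j, ∀ y ∈ colSupp A j, x ≠ p → y ≠ p → A x j * A y j = A x v * A y v) ∧
      (∀ x ∈ colSupp A j, x ≠ p → A p j * A x j = -(A p v * A x v)) := by
  classical
  obtain ⟨u, v, huv, he⟩ := Finset.card_eq_two.1 hs.card_sameSupp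
  have hmem : ∀ w, colSupp A w = colSupp A j ↔ w = u ∨ w = v := by
    intro w
    have : w ∈ sameSupp A j ↔ w ∈ ({u, v} : Finset κ) := by rw [he]
    simpa [sameSupp] using this
  obtain ⟨v, hvj, hmem⟩ : ∃ v, v ≠ j ∧ ∀ w, colSupp A w = colSupp A j ↔ w = j ∨ w = v := by
    rcases (hmem j).1 rfl with rfl | rfl
    · exact ⟨v, huv.symm, hmem⟩
    · exact ⟨u, huv, fun w => by rw [hmem, or_comm]⟩
  have hv := (hmem v).2 (Or.inr rfl)
  refine ⟨v, hvj, hv, fun w => (hmem w).1, fun x hx y hy hxp hyp => ?_, fun x hx hxp => ?_⟩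
  · by_cases hxy : x = y
    · rw [← hxy, h.sq_entry hx, h.sq_entry (by rwa [hv])]
    obtain ⟨w, hw⟩ := hs.nonempty x hx y hy hxp hyp hxy
    simp only [otherCols, Finset.mem_filter, Finset.mem_univ, true_and] at hw
    rw [(h.link hw.2.2 hxy hx hw.1 hy hw.2.1).2]
    exact ((h.link (j := v) (by rw [hv]; exact hw.2.2) hxy (by rwa [hv]) hw.1 (by rwa [hv])
      hw.2.1).2).symm
  · have h1 := h.row_orth' hxp.symm hs.mem hx
    have h2 : otherCols A j p x = ∅ := by
      rw [Finset.eq_empty_iff_forall_notMem]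
      intro w hw
      simp only [otherCols, Finset.mem_filter, Finset.mem_univ, true_and] at hw
      exact hw.2.2 (hs.eq_of_mem w hw.1)
    have h3 : sameSupp A j = {j, v} := by
      ext w; simp [sameSupp, hmem]
    rw [h2, Finset.sum_empty, h3, Finset.sum_pair hvj.symm] at h1
    have h4 := (mul_eq_zero.1 h1).resolve_left (h.pos' j).ne'
    have h5 : A p j * A x j + A p v * A x v = 0 := by exact_mod_cast h4
    linarith

/-- The coordinates of the vectors `2 g_j` of the irregular relation: the entry `(i, j)` is the
coefficient of `f_i` in `2 g_j`. -/
def irregularMatrix : Matrix (Fin 8) (Fin 8) ℤ :=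
  !![1, -1, 0, 0, 0, 0, 0, 0;
     0, 0, 1, 1, 1, 1, 1, 1;
     0, 0, 1, -1, 0, 0, 0, 0;
     1, 1, -1, -1, 1, 1, 0, 0;
     0, 0, 0, 0, 1, -1, 0, 0;
     1, 1, 0, 0, -1, -1, 1, 1;
     0, 0, 0, 0, 0, 0, 1, -1;
     1, 1, 1, 1, 0, 0, -1, -1]

/-- The three supports next to a special support `{p, x, y, z}` through two of the rows `x`, `y`, `z` are
special as well and meet in a further row `s`. No other support meets the eight rows obtained in this
way, so by connectedness there are no other rows and supports. -/
theorem IsSpecial.support_structure (h : IsWeightedFrame A lam lam') {j : κ} {p : ι}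
    (hs : IsSpecial A lam lam' j p) :
    ∃ (p₁ p₂ p₃ x y z s : ι) (j₁ j₂ j₃ : κ),
      [p, s, p₁, x, p₂, y, p₃, z].Nodup ∧ (∀ i, i ∈ [p, s, p₁, x, p₂, y, p₃, z]) ∧
      IsSpecial A lam lam' j₁ p₁ ∧ IsSpecial A lam lam' j₂ p₂ ∧ IsSpecial A lam lam' j₃ p₃ ∧
      lam p₁ = lam p ∧ lam p₂ = lam p ∧ lam p₃ = lam p ∧
      colSupp A j = {p, x, y, z} ∧ colSupp A j₁ = {p₁, x, z, s} ∧ colSupp A j₂ = {p₂, x, y, s} ∧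
      colSupp A j₃ = {p₃, y, z, s} ∧
      (∀ w, colSupp A w = colSupp A j ∨ colSupp A w = colSupp A j₁ ∨ colSupp A w = colSupp A j₂ ∨
        colSupp A w = colSupp A j₃) := by
  obtain ⟨x, hx, hxp⟩ := Finset.exists_mem_ne (by rw [h.card_col]; norm_num :
    1 < (colSupp A j).card) p
  obtain ⟨y, z, hyz, hpy, hpz, hxy, hxz, hT⟩ :=
    exists_eq_of_card_four (h.card_col j) hs.mem hx hxp.symm
  have hy : y ∈ colSupp A j := by simp [hT]
  have hz : z ∈ colSupp A j := by simp [hT]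
  obtain ⟨j₁, p₁, s₁, l₁, hx₁, hz₁, hpx₁, hpz₁, hne₁, hall₁⟩ :=
    hs.exists_next h hx hz hxp hpz.symm hxz
  obtain ⟨j₂, p₂, s₂, l₂, hx₂, hy₂, hpx₂, hpy₂, hne₂, hall₂⟩ :=
    hs.exists_next h hx hy hxp hpy.symm hxy
  obtain ⟨j₃, p₃, s₃, l₃, hy₃, hz₃, hpy₃, hpz₃, hne₃, hall₃⟩ :=
    hs.exists_next h hy hz hpy.symm hpz.symm hyz
  have i₁ : ∀ w, w ∈ colSupp A j → w ∈ colSupp A j₁ → w = x ∨ w = z := fun w h1 h2 => by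
    have := Finset.mem_inter.2 ⟨h1, h2⟩
    rwa [h.inter_eq hne₁ hxz hx hx₁ hz hz₁, Finset.mem_insert, Finset.mem_singleton] at this
  have i₂ : ∀ w, w ∈ colSupp A j → w ∈ colSupp A j₂ → w = x ∨ w = y := fun w h1 h2 => by
    have := Finset.mem_inter.2 ⟨h1, h2⟩
    rwa [h.inter_eq hne₂ hxy hx hx₂ hy hy₂, Finset.mem_insert, Finset.mem_singleton] at this
  have i₃ : ∀ w, w ∈ colSupp A j → w ∈ colSupp A j₃ → w = y ∨ w = z := fun w h1 h2 => by
    have := Finset.mem_inter.2 ⟨h1, h2⟩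
    rwa [h.inter_eq hne₃ hyz hy hy₃ hz hz₃, Finset.mem_insert, Finset.mem_singleton] at this
  have hy₁ : y ∉ colSupp A j₁ := fun hm => by have := i₁ y hy hm; grind
  have hz₂ : z ∉ colSupp A j₂ := fun hm => by have := i₂ z hz hm; grind
  have hx₃ : x ∉ colSupp A j₃ := fun hm => by have := i₃ x hx hm; grind
  have hne₁₂ : colSupp A j₂ ≠ colSupp A j₁ := fun e => hy₁ (e ▸ hy₂)
  have hne₁₃ : colSupp A j₃ ≠ colSupp A j₁ := fun e => hy₁ (e ▸ hy₃)
  have hne₂₃ : colSupp A j₃ ≠ colSupp A j₂ := fun e => hz₂ (e ▸ hz₃)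
  obtain ⟨s, hps, hxs, hzs, hT₁⟩ := exists_fourth (h.card_col j₁) s₁.mem hx₁ hz₁ hpx₁ hpz₁ hxz
  have hs₁ : s ∈ colSupp A j₁ := by simp [hT₁]
  -- the second common point of two of the new supports is always `s`
  have hs₂ : s ∈ colSupp A j₂ := by
    obtain ⟨w, hw, hwx⟩ := Finset.exists_mem_ne (by
      rw [h.card_inter hne₁₂ hx₁ hx₂]; norm_num : 1 < (colSupp A j₁ ∩ colSupp A j₂).card) x
    rw [Finset.mem_inter] at hw
    have : w = p₁ ∨ w = x ∨ w = z ∨ w = s := by simpa [hT₁] using hw.1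
    rcases this with rfl | rfl | rfl | rfl
    · exact absurd (s₁.eq_of_mem _ hw.2) hne₁₂
    · exact absurd rfl hwx
    · exact absurd hw.2 hz₂
    · exact hw.2
  have hs₃ : s ∈ colSupp A j₃ := by
    obtain ⟨w, hw, hwz⟩ := Finset.exists_mem_ne (by
      rw [h.card_inter hne₁₃ hz₁ hz₃]; norm_num : 1 < (colSupp A j₁ ∩ colSupp A j₃).card) z
    rw [Finset.mem_inter] at hw
    have : w = p₁ ∨ w = x ∨ w = z ∨ w = s := by simpa [hT₁] using hw.1
    rcases this with rfl | rfl | rfl | rfl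
    · exact absurd (s₁.eq_of_mem _ hw.2) hne₁₃
    · exact absurd hw.2 hx₃
    · exact absurd rfl hwz
    · exact hw.2
  have hys : y ≠ s := fun e => hy₁ (e ▸ hs₁)
  have hps₂ : p₂ ≠ s := fun e => hne₁₂ (s₂.eq_of_mem j₁ (e ▸ hs₁)).symm
  have hps₃ : p₃ ≠ s := fun e => hne₁₃ (s₃.eq_of_mem j₁ (e ▸ hs₁)).symm
  have eq_four : ∀ {T : Finset ι} {a b c d : ι}, T.card = 4 → a ∈ T → b ∈ T → c ∈ T → d ∈ T →
      a ≠ b → a ≠ c → a ≠ d → b ≠ c → b ≠ d → c ≠ d → T = {a, b, c, d} := by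
    intro T a b c d hT ha hb hc hd h1 h2 h3 h4 h5 h6
    refine (Finset.eq_of_subset_of_card_le ?_ (by rw [hT, card_four h1 h2 h3 h4 h5 h6])).symm
    intro w hw
    simp only [Finset.mem_insert, Finset.mem_singleton] at hw
    rcases hw with rfl | rfl | rfl | rfl <;> assumption
  have hT₂ := eq_four (h.card_col j₂) s₂.mem hx₂ hy₂ hs₂ hpx₂ hpy₂ hps₂ hxy hxs hys
  have hT₃ := eq_four (h.card_col j₃) s₃.mem hy₃ hz₃ hs₃ hpy₃ hpz₃ hps₃ hyz hys hzs
  have hsT : s ∉ colSupp A j := fun hm => by have := i₁ s hm hs₁; grind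
  have hp₁ : ∀ w, colSupp A w ≠ colSupp A j₁ → p₁ ∉ colSupp A w := fun w hw hm =>
    hw (s₁.eq_of_mem w hm)
  have hp₂ : ∀ w, colSupp A w ≠ colSupp A j₂ → p₂ ∉ colSupp A w := fun w hw hm =>
    hw (s₂.eq_of_mem w hm)
  have hp₃ : ∀ w, colSupp A w ≠ colSupp A j₃ → p₃ ∉ colSupp A w := fun w hw hm =>
    hw (s₃.eq_of_mem w hm)
  have a₁ := hp₁ j hne₁.symm
  have a₂ := hp₂ j hne₂.symm
  have a₃ := hp₃ j hne₃.symm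
  have b₂ := hp₂ j₁ hne₁₂.symm
  have b₃ := hp₃ j₁ hne₁₃.symm
  have c₃ := hp₃ j₂ hne₂₃.symm
  have hpp : ∀ w, colSupp A w ≠ colSupp A j → p ∉ colSupp A w := fun w hw hm =>
    hw (hs.eq_of_mem w hm)
  have hnd : [p, s, p₁, x, p₂, y, p₃, z].Nodup := by
    have d₂ := s₂.mem
    have d₃ := s₃.mem
    have d₁ := s₁.mem
    simp only [hT, hT₁, hT₂, Finset.mem_insert, Finset.mem_singleton, not_or] at a₁ a₂ a₃ b₂ b₃ c₃ hsT
    simp only [List.nodup_cons, List.mem_cons, List.not_mem_nil, not_or, or_false, not_false_iff,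
      List.nodup_nil, and_true]
    clear * - hsT hps hxs hzs hys hps₂ hps₃ hpy hpz hxy hxz hxp hyz a₁ a₂ a₃ b₂ b₃ c₃ hpx₁ hpz₁
      hpx₂ hpy₂ hpy₃ hpz₃
    grind
  -- the only columns through the eight rows found so far are those with one of the four supports
  have hclosed : ∀ w, ∀ i ∈ colSupp A w, i ∈ [p, s, p₁, x, p₂, y, p₃, z] →
      colSupp A w = colSupp A j ∨ colSupp A w = colSupp A j₁ ∨ colSupp A w = colSupp A j₂ ∨
        colSupp A w = colSupp A j₃ := by
    intro w
    have key : ∀ i, i ∈ colSupp A j → i ∈ colSupp A w → colSupp A w = colSupp A j ∨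
        colSupp A w = colSupp A j₁ ∨ colSupp A w = colSupp A j₂ ∨ colSupp A w = colSupp A j₃ := by
      intro i hi hiw
      by_cases hw : colSupp A w = colSupp A j
      · exact Or.inl hw
      have hpw := hpp w hw
      obtain ⟨k, hk, hki⟩ := Finset.exists_mem_ne (by
        rw [h.card_inter hw hi hiw]; norm_num : 1 < (colSupp A j ∩ colSupp A w).card) i
      rw [Finset.mem_inter] at hk
      have e1 : i = x ∨ i = y ∨ i = z := by
        have : i = p ∨ i = x ∨ i = y ∨ i = z := by simpa [hT] using hi
        rcases this with rfl | e
        · exact absurd hiw hpw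
        · exact e
      have e2 : k = x ∨ k = y ∨ k = z := by
        have : k = p ∨ k = x ∨ k = y ∨ k = z := by simpa [hT] using hk.1
        rcases this with rfl | e
        · exact absurd hk.2 hpw
        · exact e
      have e3 : (x ∈ colSupp A w ∧ z ∈ colSupp A w) ∨ (x ∈ colSupp A w ∧ y ∈ colSupp A w) ∨
          (y ∈ colSupp A w ∧ z ∈ colSupp A w) := by
        have hkw := hk.2
        clear * - e1 e2 hkw hiw hki
        rcases e1 with rfl | rfl | rfl <;> rcases e2 with rfl | rfl | rfl <;> tauto
      rcases e3 with e | e | e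
      · exact (hall₁ w e.1 e.2).imp_right Or.inl
      · exact (hall₂ w e.1 e.2).imp_right fun e => Or.inr (Or.inl e)
      · exact (hall₃ w e.1 e.2).imp_right fun e => Or.inr (Or.inr e)
    intro i hi hmem
    simp only [List.mem_cons, List.not_mem_nil, or_false] at hmem
    rcases hmem with rfl | rfl | rfl | rfl | rfl | rfl | rfl | rfl
    · exact Or.inl (hs.eq_of_mem w hi)
    · by_cases hw : colSupp A w = colSupp A j₁
      · exact Or.inr (Or.inl hw)
      obtain ⟨k, hk, hki⟩ := Finset.exists_mem_ne (by
        rw [h.card_inter hw hs₁ hi]; norm_num : 1 < (colSupp A j₁ ∩ colSupp A w).card) i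
      rw [Finset.mem_inter] at hk
      have : k = p₁ ∨ k = x ∨ k = z ∨ k = i := by simpa [hT₁] using hk.1
      rcases this with rfl | rfl | rfl | rfl
      · exact absurd (s₁.eq_of_mem _ hk.2) hw
      · exact key _ hx hk.2
      · exact key _ hz hk.2
      · exact absurd rfl hki
    · exact Or.inr (Or.inl (s₁.eq_of_mem w hi))
    · exact key _ hx hi
    · exact Or.inr (Or.inr (Or.inl (s₂.eq_of_mem w hi)))
    · exact key _ hy hi
    · exact Or.inr (Or.inr (Or.inr (s₃.eq_of_mem w hi)))
    · exact key _ hz hi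
  have huniv : ∀ i, i ∈ [p, s, p₁, x, p₂, y, p₃, z] := by
    refine h.connected {i | i ∈ [p, s, p₁, x, p₂, y, p₃, z]} ⟨p, by simp⟩ fun w => ?_
    by_cases hw : ∃ i ∈ colSupp A w, i ∈ [p, s, p₁, x, p₂, y, p₃, z]
    · left
      obtain ⟨i, hi, hi'⟩ := hw
      intro k hk
      simp only [Set.mem_ofPred_eq, List.mem_cons, List.not_mem_nil, or_false]
      rcases hclosed w i hi hi' with e | e | e | e <;> rw [e] at hk
      on_goal 1 => rw [hT] at hk
      on_goal 2 => rw [hT₁] at hk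
      on_goal 3 => rw [hT₂] at hk
      on_goal 4 => rw [hT₃] at hk
      all_goals
        simp only [Finset.mem_insert, Finset.mem_singleton] at hk
        clear * - hk
        tauto
    · right
      push Not at hw
      exact hw
  refine ⟨p₁, p₂, p₃, x, y, z, s, j₁, j₂, j₃, hnd, huniv, s₁, s₂, s₃, l₁, l₂, l₃, hT, hT₁, hT₂, hT₃,
    fun w => ?_⟩
  obtain ⟨i, hi⟩ := Finset.card_pos.1 (by rw [h.card_col]; norm_num : 0 < (colSupp A w).card)
  exact hclosed w i hi (huniv i)

/-- Normalisation of the signs of the two columns of a special support: up to signs they are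
`e_p + v` and `-e_p + v`, and one entry of `v` can be prescribed. -/
theorem IsSpecial.exists_signs (h : IsWeightedFrame A lam lam') {j : κ} {p : ι}
    (hs : IsSpecial A lam lam' j p) {u₀ : ι} (hu₀ : u₀ ∈ colSupp A j) (hu₀p : u₀ ≠ p) {s₀ : ℤ}
    (hs₀ : s₀ * s₀ = 1) :
    ∃ (v : κ) (t t' sp : ℤ), v ≠ j ∧ colSupp A v = colSupp A j ∧
      (∀ w, colSupp A w = colSupp A j → w = j ∨ w = v) ∧
      t * t = 1 ∧ t' * t' = 1 ∧ sp * sp = 1 ∧ t * A p j = sp ∧ t' * A p v = -sp ∧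
      (∀ u ∈ colSupp A j, u ≠ p → t' * A u v = t * A u j) ∧ t * A u₀ j = s₀ ∧
      (∀ u ∈ colSupp A j, (t * A u j) * (t * A u j) = 1) ∧
      (∀ u w, A u j * A w j = (t * A u j) * (t * A w j)) := by
  obtain ⟨v, hvj, hv, hall, h1, h2⟩ := hs.exists_twin h
  have q := h.sq_entry hu₀
  have q' := h.sq_entry (i := u₀) (j := v) (by rwa [hv])
  have qp := h.sq_entry hs.mem
  have ht : (s₀ * A u₀ j) * (s₀ * A u₀ j) = 1 := by
    linear_combination A u₀ j * A u₀ j * hs₀ + q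
  have ht' : (s₀ * A u₀ v) * (s₀ * A u₀ v) = 1 := by
    linear_combination A u₀ v * A u₀ v * hs₀ + q'
  refine ⟨v, s₀ * A u₀ j, s₀ * A u₀ v, s₀ * A u₀ j * A p j, hvj, hv, hall, ht, ht', ?_, rfl, ?_, ?_,
    ?_, ?_, ?_⟩
  · linear_combination A p j * A p j * ht + qp
  · linear_combination s₀ * h2 u₀ hu₀ hu₀p
  · intro u hu hup
    linear_combination -s₀ * h1 u hu u₀ hu₀ hup hu₀p
  · linear_combination s₀ * q
  · intro u hu
    linear_combination A u j * A u j * ht + h.sq_entry hu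
  · intro u w
    linear_combination -A u j * A w j * ht

/-- A special column forces the irregular relation. -/
theorem IsSpecial.exists_irregular (h : IsWeightedFrame A lam lam') {j : κ} {p : ι}
    (hs : IsSpecial A lam lam' j p) :
    ∃ (σ : Fin 8 ≃ ι) (τ : Fin 8 ≃ κ) (s t : Fin 8 → ℤ) (c : ℝ), 0 < c ∧
      (∀ i, s i * s i = 1) ∧ (∀ k, t k * t k = 1) ∧
      (∀ i k, s i * (t k * A (σ i) (τ k)) = irregularMatrix i k) ∧
      (∀ i, lam (σ i) = if i = 0 ∨ i = 2 ∨ i = 4 ∨ i = 6 then c else 3 * c) ∧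
      (∀ k, lam' (τ k) = 2 * c) := by
  obtain ⟨p₁, p₂, p₃, x, y, z, s, j₁, j₂, j₃, hnd, huniv, s₁, s₂, s₃, l₁, l₂, l₃, hT, hT₁, hT₂, hT₃,
    hall⟩ := hs.support_structure h
  have hnd' := hnd
  simp only [List.nodup_cons, List.mem_cons, List.not_mem_nil, not_or, or_false, not_false_iff,
    List.nodup_nil, and_true] at hnd
  obtain ⟨⟨n1, n2, n3, n4, n5, n6, n7⟩, ⟨n8, n9, n10, n11, n12, n13⟩, ⟨n14, n15, n16, n17, n18⟩,
    ⟨n19, n20, n21, n22⟩, ⟨n23, n24, n25⟩, ⟨n26, n27⟩, n28⟩ := hnd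
  have mx : x ∈ colSupp A j := by simp [hT]
  have my : y ∈ colSupp A j := by simp [hT]
  have mz : z ∈ colSupp A j := by simp [hT]
  have mx₁ : x ∈ colSupp A j₁ := by simp [hT₁]
  have mz₁ : z ∈ colSupp A j₁ := by simp [hT₁]
  have ms₁ : s ∈ colSupp A j₁ := by simp [hT₁]
  have mx₂ : x ∈ colSupp A j₂ := by simp [hT₂]
  have my₂ : y ∈ colSupp A j₂ := by simp [hT₂]
  have ms₂ : s ∈ colSupp A j₂ := by simp [hT₂]
  have my₃ : y ∈ colSupp A j₃ := by simp [hT₃]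
  have mz₃ : z ∈ colSupp A j₃ := by simp [hT₃]
  have ms₃ : s ∈ colSupp A j₃ := by simp [hT₃]
  have d₁ : colSupp A j₁ ≠ colSupp A j := fun e => by
    have := e ▸ ms₁; simp [hT] at this; grind
  have d₂ : colSupp A j₂ ≠ colSupp A j := fun e => by
    have := e ▸ ms₂; simp [hT] at this; grind
  have d₃ : colSupp A j₃ ≠ colSupp A j := fun e => by
    have := e ▸ ms₃; simp [hT] at this; grind
  have d₁₂ : colSupp A j₂ ≠ colSupp A j₁ := fun e => by
    have := e ▸ my₂; simp [hT₁] at this; grind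
  have d₁₃ : colSupp A j₃ ≠ colSupp A j₁ := fun e => by
    have := e ▸ my₃; simp [hT₁] at this; grind
  have d₂₃ : colSupp A j₃ ≠ colSupp A j₂ := fun e => by
    have := e ▸ mz₃; simp [hT₂] at this; grind
  obtain ⟨k, t, t', sp, hk, hTk, ak, ht, ht', hsp, vp, vp', vtw, vx, vsq, vmul⟩ :=
    hs.exists_signs h mx (Ne.symm n3) (s₀ := 1) rfl
  obtain ⟨k₁, t₁, t₁', sp₁, hk₁, hTk₁, ak₁, ht₁, ht₁', hsp₁, vp₁, vp₁', vtw₁, vz₁, vsq₁, vmul₁⟩ :=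
    s₁.exists_signs h mz₁ (Ne.symm n18) (vsq z mz)
  obtain ⟨k₂, t₂, t₂', sp₂, hk₂, hTk₂, ak₂, ht₂, ht₂', hsp₂, vp₂, vp₂', vtw₂, vx₂, vsq₂, vmul₂⟩ :=
    s₂.exists_signs h mx₂ n19 (vsq x mx)
  obtain ⟨k₃, t₃, t₃', sp₃, hk₃, hTk₃, ak₃, ht₃, ht₃', hsp₃, vp₃, vp₃', vtw₃, vy₃, vsq₃, vmul₃⟩ :=
    s₃.exists_signs h my₃ n26 (vsq y my)
  have sx := vsq x mx
  have sy := vsq y my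
  have sz := vsq z mz
  have ss := vsq₁ s ms₁
  -- the remaining signs follow from the orthogonality of columns with different supports
  have vx₁ : t₁ * A x j₁ = -(t * A x j) := by
    have := (h.link d₁ n22 mx mx₁ mz mz₁).2
    rw [vmul, vmul₁, vz₁] at this
    linear_combination (t * A z j) * this - (t₁ * A x j₁ + t * A x j) * sz
  have vy₂ : t₂ * A y j₂ = -(t * A y j) := by
    have := (h.link d₂ n20 mx mx₂ my my₂).2
    rw [vmul, vmul₂, vx₂] at this
    linear_combination (t * A x j) * this - (t₂ * A y j₂ + t * A y j) * sx
  have vz₃ : t₃ * A z j₃ = -(t * A z j) := by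
    have := (h.link d₃ n27 my my₃ mz mz₃).2
    rw [vmul, vmul₃, vy₃] at this
    linear_combination (t * A y j) * this - (t₃ * A z j₃ + t * A z j) * sy
  have vs₂ : t₂ * A s j₂ = t₁ * A s j₁ := by
    have := (h.link d₁₂ (Ne.symm n9) mx₁ mx₂ ms₁ ms₂).2
    rw [vmul₁, vmul₂, vx₂, vx₁] at this
    linear_combination (t * A x j) * this - (t₂ * A s j₂ - t₁ * A s j₁) * sx
  have vs₃ : t₃ * A s j₃ = t₁ * A s j₁ := by
    have := (h.link d₁₃ (Ne.symm n13) mz₁ mz₃ ms₁ ms₃).2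
    rw [vmul₁, vmul₃, vz₃, vz₁] at this
    linear_combination -(t * A z j) * this - (t₃ * A s j₃ - t₁ * A s j₁) * sz
  have zero : ∀ {i : ι} {l l' : κ}, colSupp A l' = colSupp A l → i ∉ colSupp A l → A i l' = 0 := by
    intro i l l' e hi
    rw [← e] at hi
    simpa using hi
  have z₀ : ∀ i, i ≠ p → i ≠ x → i ≠ y → i ≠ z → A i j = 0 ∧ A i k = 0 :=
    fun i a b c d => ⟨zero rfl (by simp [hT, a, b, c, d]), zero hTk (by simp [hT, a, b, c, d])⟩
  have z₁ : ∀ i, i ≠ p₁ → i ≠ x → i ≠ z → i ≠ s → A i j₁ = 0 ∧ A i k₁ = 0 :=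
    fun i a b c d => ⟨zero rfl (by simp [hT₁, a, b, c, d]), zero hTk₁ (by simp [hT₁, a, b, c, d])⟩
  have z₂ : ∀ i, i ≠ p₂ → i ≠ x → i ≠ y → i ≠ s → A i j₂ = 0 ∧ A i k₂ = 0 :=
    fun i a b c d => ⟨zero rfl (by simp [hT₂, a, b, c, d]), zero hTk₂ (by simp [hT₂, a, b, c, d])⟩
  have z₃ : ∀ i, i ≠ p₃ → i ≠ y → i ≠ z → i ≠ s → A i j₃ = 0 ∧ A i k₃ = 0 :=
    fun i a b c d => ⟨zero rfl (by simp [hT₃, a, b, c, d]), zero hTk₃ (by simp [hT₃, a, b, c, d])⟩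
  let F : Fin 8 → ι := ![p, s, p₁, x, p₂, y, p₃, z]
  let G : Fin 8 → κ := ![j, k, j₁, k₁, j₂, k₂, j₃, k₃]
  have hF : Function.Bijective F := by
    constructor
    · rw [← List.nodup_ofFn]
      have : List.ofFn F = [p, s, p₁, x, p₂, y, p₃, z] := by simp [F, List.ofFn_succ]
      rwa [this]
    · intro w
      have := huniv w
      simp only [List.mem_cons, List.not_mem_nil, or_false] at this
      rcases this with e | e | e | e | e | e | e | e
      exacts [⟨0, e.symm⟩, ⟨1, e.symm⟩, ⟨2, e.symm⟩, ⟨3, e.symm⟩, ⟨4, e.symm⟩, ⟨5, e.symm⟩,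
        ⟨6, e.symm⟩, ⟨7, e.symm⟩]
  have hG : Function.Bijective G := by
    constructor
    · rw [← List.nodup_ofFn]
      have : List.ofFn G = [j, k, j₁, k₁, j₂, k₂, j₃, k₃] := by simp [G, List.ofFn_succ]
      rw [this]
      simp only [List.nodup_cons, List.mem_cons, List.not_mem_nil, not_or, or_false, not_false_iff,
        List.nodup_nil, and_true]
      clear * - hk hk₁ hk₂ hk₃ hTk hTk₁ hTk₂ hTk₃ d₁ d₂ d₃ d₁₂ d₁₃ d₂₃
      split_ands <;> grind
    · intro w
      rcases hall w with e | e | e | e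
      · rcases ak w e with rfl | rfl
        exacts [⟨0, rfl⟩, ⟨1, rfl⟩]
      · rcases ak₁ w e with rfl | rfl
        exacts [⟨2, rfl⟩, ⟨3, rfl⟩]
      · rcases ak₂ w e with rfl | rfl
        exacts [⟨4, rfl⟩, ⟨5, rfl⟩]
      · rcases ak₃ w e with rfl | rfl
        exacts [⟨6, rfl⟩, ⟨7, rfl⟩]
  refine ⟨Equiv.ofBijective F hF, Equiv.ofBijective G hG,
    ![sp, t₁ * A s j₁, sp₁, t * A x j, sp₂, t * A y j, sp₃, t * A z j],
    ![t, t', t₁, t₁', t₂, t₂', t₃, t₃'], lam p, h.pos p, ?_, ?_, ?_, ?_, ?_⟩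
  · intro i; fin_cases i <;> assumption
  · intro i; fin_cases i <;> assumption
  · intro i k'
    -- the entries outside of the supports vanish, and twin columns agree outside of `p`, ..., `p₃`
    fin_cases i <;> fin_cases k' <;>
      simp [F, G, irregularMatrix, z₀ s (Ne.symm n1) n9 n11 n13, z₀ p₁ (Ne.symm n2) n14 n16 n18,
        z₀ p₂ (Ne.symm n4) (Ne.symm n19) n23 n25,
        z₀ p₃ (Ne.symm n6) (Ne.symm n21) (Ne.symm n26) n28, z₁ p n2 n3 n7 n1,
        z₁ p₂ (Ne.symm n15) (Ne.symm n19) n25 (Ne.symm n10),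
        z₁ y (Ne.symm n16) (Ne.symm n20) n27 (Ne.symm n11),
        z₁ p₃ (Ne.symm n17) (Ne.symm n21) n28 (Ne.symm n12), z₂ p n4 n3 n5 n1,
        z₂ p₁ n15 n14 n16 (Ne.symm n8),
        z₂ p₃ (Ne.symm n24) (Ne.symm n21) (Ne.symm n26) (Ne.symm n12),
        z₂ z (Ne.symm n25) (Ne.symm n22) (Ne.symm n27) (Ne.symm n13), z₃ p n6 n5 n7 n1,
        z₃ p₁ n17 n16 n18 (Ne.symm n8), z₃ x n21 n20 n22 (Ne.symm n9),
        z₃ p₂ n24 n23 n25 (Ne.symm n10), vtw x mx (Ne.symm n3), vtw y my (Ne.symm n5),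
        vtw z mz (Ne.symm n7), vtw₁ x mx₁ (Ne.symm n14), vtw₁ z mz₁ (Ne.symm n18), vtw₁ s ms₁ n8,
        vtw₂ x mx₂ n19, vtw₂ y my₂ (Ne.symm n23), vtw₂ s ms₂ n10, vtw₃ y my₃ n26,
        vtw₃ z mz₃ (Ne.symm n28), vtw₃ s ms₃ n12, vp, vp', vp₁, vp₁', vp₂, vp₂', vp₃, vp₃', vz₁,
        vx₂, vy₃, vx₁, vy₂, vz₃, vs₂, vs₃, sx, sy, sz, ss, hsp, hsp₁, hsp₂, hsp₃]
  · intro i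
    fin_cases i
    · simp [F]
    · simpa [F, l₁] using s₁.lam_eq s ms₁ n8
    · simpa [F] using l₁
    · simpa [F] using hs.lam_eq x mx (Ne.symm n3)
    · simpa [F] using l₂
    · simpa [F] using hs.lam_eq y my (Ne.symm n5)
    · simpa [F] using l₃
    · simpa [F] using hs.lam_eq z mz (Ne.symm n7)
  · intro i
    fin_cases i
    · simpa [G] using hs.lam'_eq
    · simpa [G, h.lam'_eq hTk] using hs.lam'_eq
    · simpa [G, l₁] using s₁.lam'_eq
    · simpa [G, h.lam'_eq hTk₁, l₁] using s₁.lam'_eq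
    · simpa [G, l₂] using s₂.lam'_eq
    · simpa [G, h.lam'_eq hTk₂, l₂] using s₂.lam'_eq
    · simpa [G, l₃] using s₃.lam'_eq
    · simpa [G, h.lam'_eq hTk₃, l₃] using s₃.lam'_eq

end IsWeightedFrame

/-! ### Half-integral systems of minimal vectors -/

section Frames

variable {E : Type*} [NormedAddCommGroup E] [InnerProductSpace ℝ E]
variable {ι κ : Type*} [Fintype ι]

/-- The code of the system `e` with respect to `L`, its words being given by their supports: the
sets `S` such that the half sum of the `e i`, `i ∈ S`, belongs to `L`. -/
def frameCode (L : Submodule ℤ E) (e : ι → E) : Set (Finset ι) :=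
  {S | (1 / 2 : ℝ) • ∑ i ∈ S, e i ∈ L}

theorem IsMinimalVector.norm_eq {E : Type*} [NormedAddCommGroup E] {L : Submodule ℤ E} {x y : E}
    (hx : IsMinimalVector L x) (hy : IsMinimalVector L y) : ‖x‖ = ‖y‖ :=
  le_antisymm (hx.2.2 y hy.1 hy.2.1) (hy.2.2 x hx.1 hx.2.1)

theorem coeff_eq_of_sum_eq {e : ι → E} (he : LinearIndependent ℝ e) {c d : ι → ℝ}
    (h : ∑ i, c i • e i = ∑ i, d i • e i) (i : ι) : c i = d i := by
  have h1 : ∑ i, (c i - d i) • e i = 0 := by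
    simp [sub_smul, Finset.sum_sub_distrib, h]
  have := Fintype.linearIndependent_iff.1 he _ h1 i
  linarith

/-- Whether a half-integral combination of the `e i` belongs to `L` depends only on its numerators mod
`2`. -/
theorem half_sum_mem_iff {L : Submodule ℤ E} {e : ι → E} (heL : ∀ i, e i ∈ L) (a : ι → ℤ) :
    (1 / 2 : ℝ) • ∑ i, (a i : ℝ) • e i ∈ L ↔ oddSet a ∈ frameCode L e := by
  have h1 : (1 / 2 : ℝ) • ∑ i, (a i : ℝ) • e i =
      ∑ i, (a i / 2) • e i + (1 / 2 : ℝ) • ∑ i ∈ oddSet a, e i := by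
    rw [oddSet, Finset.sum_filter, Finset.smul_sum, Finset.smul_sum, ← Finset.sum_add_distrib]
    refine Finset.sum_congr rfl fun i _ => ?_
    rw [← Int.cast_smul_eq_zsmul ℝ, smul_smul]
    rcases Int.even_or_odd' (a i) with ⟨k, hk | hk⟩
    · have h2 : ¬ Odd (a i) := by rw [hk]; simp
      have h3 : a i / 2 = k := by omega
      rw [if_neg h2, h3, hk]; push_cast; simp
    · have h2 : Odd (a i) := ⟨k, hk⟩
      have h3 : a i / 2 = k := by omega
      rw [if_pos h2, h3, hk, ← add_smul]; push_cast; congr 1; ring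
  have h2 : ∑ i, (a i / 2) • e i ∈ L := sum_mem fun i _ => L.smul_mem _ (heL i)
  rw [h1, Submodule.add_mem_iff_right _ h2]
  rfl

/-- Signs can be chosen one after the other such that the inner products in the expansion of the
square of a signed sum contribute a non-positive amount. -/
theorem exists_signs_norm_le {ι : Type*} [DecidableEq ι] (e : ι → E) (S : Finset ι) (v : E) :
    ∃ ε : ι → ℤ, (∀ i, ε i = 1 ∨ ε i = -1) ∧
      ‖v + ∑ i ∈ S, (ε i : ℝ) • e i‖ ^ 2 ≤ ‖v‖ ^ 2 + ∑ i ∈ S, ‖e i‖ ^ 2 := by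
  induction S using Finset.induction_on generalizing v with
  | empty => exact ⟨fun _ => 1, fun _ => Or.inl rfl, by simp⟩
  | insert x S hx ih =>
    obtain ⟨δ, hδ, hle⟩ : ∃ δ : ℤ, (δ = 1 ∨ δ = -1) ∧
        ‖v + (δ : ℝ) • e x‖ ^ 2 ≤ ‖v‖ ^ 2 + ‖e x‖ ^ 2 := by
      rcases le_total (inner ℝ v (e x)) 0 with h | h
      · refine ⟨1, Or.inl rfl, ?_⟩
        have := norm_add_sq_real v (e x)
        simp only [Int.cast_one, one_smul]
        linarith
      · refine ⟨-1, Or.inr rfl, ?_⟩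
        have := norm_sub_sq_real v (e x)
        simp only [Int.cast_neg, Int.cast_one, neg_smul, one_smul, ← sub_eq_add_neg]
        linarith
    obtain ⟨ε, hε, hle'⟩ := ih (v + (δ : ℝ) • e x)
    refine ⟨Function.update ε x δ, fun i => ?_, ?_⟩
    · by_cases hi : i = x
      · subst hi; simpa using hδ
      · simpa [hi] using hε i
    · rw [Finset.sum_insert hx, Finset.sum_insert hx, Function.update_self, ← add_assoc]
      have : ∑ i ∈ S, ((Function.update ε x δ i : ℤ) : ℝ) • e i = ∑ i ∈ S, (ε i : ℝ) • e i := by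
        refine Finset.sum_congr rfl fun i hi => ?_
        rw [Function.update_of_ne (by rintro rfl; exact hx hi)]
      rw [this]
      linarith

/-- Two systems `e`, `e'` of minimal vectors of the lattice `L` they generate, related by
`e' j = (1 / 2) ∑ A i j e i` with a matrix `A` with entries `0, ±1` and columns of weight `4`, which
are orthogonal for some weights, and with connected bipartite graph. -/
structure IsHalfSystem (L : Submodule ℤ E) (e : ι → E) (e' : κ → E) (A : ι → κ → ℤ) : Prop where
  eq_span : L = span ℤ (Set.range e ∪ Set.range e')
  linInd : LinearIndependent ℝ e
  minimal : ∀ i, IsMinimalVector L (e i)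
  minimal' : ∀ j, IsMinimalVector L (e' j)
  eq_half : ∀ j, e' j = (1 / 2 : ℝ) • ∑ i, (A i j : ℝ) • e i
  entry : ∀ i j, A i j = 0 ∨ A i j = 1 ∨ A i j = -1
  card_col : ∀ j, (colSupp A j).card = 4
  orth : ∃ μ : ι → ℝ, (∀ i, μ i ≠ 0) ∧ ∀ j k, j ≠ k → ∑ i, (A i j : ℝ) * A i k / μ i = 0
  connected : ∀ I : Set ι, I.Nonempty →
    (∀ j, (∀ i ∈ colSupp A j, i ∈ I) ∨ (∀ i ∈ colSupp A j, i ∉ I)) → ∀ i, i ∈ I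

namespace IsHalfSystem

variable {L : Submodule ℤ E} {e : ι → E} {e' : κ → E} {A : ι → κ → ℤ}

theorem oddSet_col (h : IsHalfSystem L e e' A) (j : κ) : oddSet (fun i => A i j) = colSupp A j := by
  ext i
  rcases h.entry i j with h | h | h <;> simp [h]

theorem colSupp_mem (h : IsHalfSystem L e e' A) (j : κ) : colSupp A j ∈ frameCode L e := by
  rw [← h.oddSet_col j, ← half_sum_mem_iff fun i => (h.minimal i).1, ← h.eq_half]
  exact (h.minimal' j).1

theorem symmDiff_mem [DecidableEq ι] (h : IsHalfSystem L e e' A) {S T : Finset ι}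
    (hS : S ∈ frameCode L e) (hT : T ∈ frameCode L e) : S ∆ T ∈ frameCode L e := by
  rw [← oddSet_indicator S, ← half_sum_mem_iff fun i => (h.minimal i).1] at hS
  rw [← oddSet_indicator T, ← half_sum_mem_iff fun i => (h.minimal i).1] at hT
  have := add_mem hS hT
  rw [← smul_add, ← Finset.sum_add_distrib] at this
  simp_rw [← add_smul, ← Int.cast_add] at this
  rw [← oddSet_indicator S, ← oddSet_indicator T, ← oddSet_add]
  exact (half_sum_mem_iff (fun i => (h.minimal i).1) _).1 this

/-- The half sums with arbitrary signs over a word of the code are non-zero vectors of `L`. -/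
theorem le_norm_signed_sum [DecidableEq ι] (h : IsHalfSystem L e e' A) {S : Finset ι}
    (hS : S ∈ frameCode L e) {x : ι} (hx : x ∈ S) {ε : ι → ℤ} (hε : ∀ i, ε i = 1 ∨ ε i = -1) :
    4 * ‖e x‖ ^ 2 ≤ ‖∑ i ∈ S, (ε i : ℝ) • e i‖ ^ 2 := by
  let a : ι → ℤ := fun i => if i ∈ S then ε i else 0
  have h1 : oddSet a = S := by
    ext i
    by_cases hi : i ∈ S
    · rcases hε i with e | e <;> simp [a, hi, e]
    · simp [a, hi]
  have h2 : ∑ i, (a i : ℝ) • e i = ∑ i ∈ S, (ε i : ℝ) • e i := by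
    rw [← Finset.sum_subset (Finset.subset_univ S)]
    · exact Finset.sum_congr rfl fun i hi => by simp [a, hi]
    · intro i _ hi; simp [a, hi]
  rw [← h1, ← half_sum_mem_iff fun i => (h.minimal i).1, h2] at hS
  have h3 : (1 / 2 : ℝ) • ∑ i ∈ S, (ε i : ℝ) • e i ≠ 0 := by
    intro h0
    rw [← h2] at h0
    have h4 := (smul_eq_zero.1 h0).resolve_left (by norm_num)
    have := Fintype.linearIndependent_iff.1 h.linInd _ h4 x
    rcases hε x with e | e <;> simp [a, hx, e] at this
  have h4 := (h.minimal x).2.2 _ hS h3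
  rw [norm_smul] at h4
  norm_num at h4
  nlinarith [norm_nonneg (e x), norm_nonneg (∑ i ∈ S, (ε i : ℝ) • e i)]

theorem sum_norm_sq (h : IsHalfSystem L e e' A) (S : Finset ι) (x : ι) :
    ∑ i ∈ S, ‖e i‖ ^ 2 = S.card * ‖e x‖ ^ 2 := by
  rw [← nsmul_eq_mul]
  exact Finset.sum_eq_card_nsmul fun i _ => by rw [(h.minimal i).norm_eq (h.minimal x)]

/-- For suitable signs, a half sum over `S` has square norm at most `|S| m / 4`, where `m` is the minimal
square norm. -/
theorem four_le_card [DecidableEq ι] (h : IsHalfSystem L e e' A) {S : Finset ι}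
    (hS : S ∈ frameCode L e) (hne : S.Nonempty) : 4 ≤ S.card := by
  obtain ⟨x, hx⟩ := hne
  obtain ⟨ε, hε, hle⟩ := exists_signs_norm_le e S 0
  have h1 := h.le_norm_signed_sum hS hx hε
  rw [zero_add, h.sum_norm_sq S x, norm_zero] at hle
  have h2 : 0 < ‖e x‖ ^ 2 := by
    have := norm_pos_iff.2 (h.minimal x).2.1
    positivity
  have h3 : (4 : ℝ) ≤ S.card := by
    refine le_of_mul_le_mul_right ?_ h2
    linarith
  exact_mod_cast h3

/-- The vectors `e i`, `i ∈ S`, are orthogonal if `S` is a tetrad of the code: otherwise some signed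
half sum over `S` would be shorter than the minimal vectors. -/
theorem inner_eq_zero_of_tetrad [DecidableEq ι] (h : IsHalfSystem L e e' A) {S : Finset ι}
    (hS : S ∈ frameCode L e) (hcard : S.card = 4) {x y : ι} (hx : x ∈ S) (hy : y ∈ S)
    (hxy : x ≠ y) : inner ℝ (e x) (e y) = 0 := by
  by_contra hne
  obtain ⟨δ, hδ, hlt⟩ : ∃ δ : ℤ, (δ = 1 ∨ δ = -1) ∧
      ‖e x + (δ : ℝ) • e y‖ ^ 2 < ‖e x‖ ^ 2 + ‖e y‖ ^ 2 := by
    rcases lt_or_gt_of_ne hne with h | h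
    · refine ⟨1, Or.inl rfl, ?_⟩
      have := norm_add_sq_real (e x) (e y)
      simp only [Int.cast_one, one_smul]
      linarith
    · refine ⟨-1, Or.inr rfl, ?_⟩
      have := norm_sub_sq_real (e x) (e y)
      simp only [Int.cast_neg, Int.cast_one, neg_smul, one_smul, ← sub_eq_add_neg]
      linarith
  let S' := (S.erase x).erase y
  have hy' : y ∈ S.erase x := Finset.mem_erase.2 ⟨hxy.symm, hy⟩
  obtain ⟨ε, hε, hle⟩ := exists_signs_norm_le e S' (e x + (δ : ℝ) • e y)
  let η : ι → ℤ := Function.update (Function.update ε x 1) y δ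
  have hη : ∀ i, η i = 1 ∨ η i = -1 := by
    intro i
    by_cases h1 : i = y
    · subst h1; simpa [η] using hδ
    by_cases h2 : i = x
    · subst h2; simp [η, h1]
    · simpa [η, h1, h2] using hε i
  have h1 := h.le_norm_signed_sum hS hx hη
  have h2 : ∑ i ∈ S, (η i : ℝ) • e i = e x + (δ : ℝ) • e y + ∑ i ∈ S', (ε i : ℝ) • e i := by
    rw [← Finset.add_sum_erase _ _ hx, ← Finset.add_sum_erase _ _ hy', ← add_assoc]
    congr 1
    · simp [η, hxy]
    · refine Finset.sum_congr rfl fun i hi => ?_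
      simp only [S', Finset.mem_erase] at hi
      simp [η, hi.1, hi.2.1]
  have hS' : S'.card = 2 := by
    rw [Finset.card_erase_of_mem hy', Finset.card_erase_of_mem hx, hcard]
  rw [h.sum_norm_sq S' x, hS'] at hle
  rw [h2] at h1
  rw [(h.minimal y).norm_eq (h.minimal x)] at hlt
  push_cast at hle
  linarith

/-- Supports of columns meet in at most two rows, if they are different, since their sum has weight at
least `4`; and not in a single row, because of the weighted orthogonality. -/
theorem even_inter [DecidableEq ι] (h : IsHalfSystem L e e' A) (j k : κ) :
    Even (colSupp A j ∩ colSupp A k).card := by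
  by_cases hjk : colSupp A j = colSupp A k
  · rw [hjk, Finset.inter_self, h.card_col]; decide
  have hsum := card_symmDiff_add (colSupp A j) (colSupp A k)
  have hne : (colSupp A j ∆ colSupp A k).Nonempty := by
    rw [Finset.nonempty_iff_ne_empty]
    intro h0
    exact hjk (symmDiff_eq_bot.1 h0)
  have hmin := h.four_le_card (h.symmDiff_mem (h.colSupp_mem j) (h.colSupp_mem k)) hne
  rw [h.card_col, h.card_col] at hsum
  have hone : (colSupp A j ∩ colSupp A k).card ≠ 1 := by
    intro h1
    obtain ⟨x, hx⟩ := Finset.card_eq_one.1 h1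
    obtain ⟨μ, hμ, hor⟩ := h.orth
    have h2 := hor j k (by rintro rfl; exact hjk rfl)
    rw [Finset.sum_eq_single x] at h2
    · have hxm : x ∈ colSupp A j ∩ colSupp A k := by rw [hx]; simp
      simp only [Finset.mem_inter, mem_colSupp] at hxm
      have h3 : (A x j : ℝ) ≠ 0 := by exact_mod_cast hxm.1
      have h4 : (A x k : ℝ) ≠ 0 := by exact_mod_cast hxm.2
      exact div_ne_zero (mul_ne_zero h3 h4) (hμ x) h2
    · intro i _ hi
      have : i ∉ colSupp A j ∩ colSupp A k := by rw [hx]; simpa using hi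
      simp only [Finset.mem_inter, mem_colSupp, not_and_or, not_not] at this
      rcases this with e | e <;> simp [e]
    · simp
  generalize (colSupp A j ∩ colSupp A k).card = c at *
  have hc : c = 0 ∨ c = 2 := by omega
  rcases hc with rfl | rfl <;> decide

/-- Every vector of `L` is a half-integral combination of the `e i`, and its coefficients are, modulo
`1`, given by a sum of supports of columns. -/
theorem exists_coords [DecidableEq ι] (h : IsHalfSystem L e e' A) {x : E} (hx : x ∈ L) :
    ∃ a : ι → ℤ, x = (1 / 2 : ℝ) • ∑ i, (a i : ℝ) • e i ∧
      SymmDiffSpan (Set.range (colSupp A)) (oddSet a) := by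
  rw [h.eq_span] at hx
  induction hx using Submodule.span_induction with
  | mem x hx =>
    rcases hx with ⟨i, rfl⟩ | ⟨j, rfl⟩
    · refine ⟨Pi.single i 2, ?_, ?_⟩
      · rw [Finset.sum_eq_single i]
        · rw [Pi.single_eq_same, smul_smul]; norm_num
        · intro k _ hk; simp [hk]
        · simp
      · have : oddSet (Pi.single i (2 : ℤ)) = ∅ := by
          ext k
          by_cases hk : k = i
          · subst hk; simp
          · simp [hk]
        rw [this]; exact .empty
    · refine ⟨fun i => A i j, h.eq_half j, ?_⟩
      have := (SymmDiffSpan.empty (𝒯 := Set.range (colSupp A))).step ⟨j, rfl⟩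
      rw [h.oddSet_col]
      simpa [symmDiff_def] using this
  | zero =>
    refine ⟨0, by simp, ?_⟩
    have : oddSet (0 : ι → ℤ) = ∅ := by ext; simp
    rw [this]; exact .empty
  | add x y _ _ hx hy =>
    obtain ⟨a, rfl, ha⟩ := hx
    obtain ⟨b, rfl, hb⟩ := hy
    refine ⟨a + b, ?_, ?_⟩
    · simp [add_smul, Finset.sum_add_distrib]
    · rw [oddSet_add]; exact ha.symmDiff hb
  | smul z x _ hx =>
    obtain ⟨a, rfl, ha⟩ := hx
    refine ⟨fun i => z * a i, ?_, ?_⟩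
    · rw [← Int.cast_smul_eq_zsmul ℝ, smul_comm, Finset.smul_sum]
      simp [smul_smul]
    · rcases Int.even_or_odd z with hz | hz
      · have : oddSet (fun i => z * a i) = ∅ := by ext i; simp [hz]
        rw [this]; exact .empty
      · have : oddSet (fun i => z * a i) = oddSet a := by ext i; simp [Int.odd_mul, hz]
        rwa [this]

theorem generated [DecidableEq ι] (h : IsHalfSystem L e e' A) {S : Finset ι}
    (hS : S ∈ frameCode L e) : SymmDiffSpan (Set.range (colSupp A)) S := by
  have hS' := hS
  rw [← oddSet_indicator S, ← half_sum_mem_iff fun i => (h.minimal i).1] at hS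
  obtain ⟨a, ha, hspan⟩ := h.exists_coords hS
  have : (fun i => if i ∈ S then (1 : ℤ) else 0) = a := by
    funext i
    have := coeff_eq_of_sum_eq h.linInd (smul_right_injective E (by norm_num : (1 / 2 : ℝ) ≠ 0) ha) i
    exact_mod_cast this
  rwa [← this, oddSet_indicator] at hspan

/-- The code of the system is a tetrad code. That any two coordinates lie in a common tetrad follows
from the connectedness, since this relation is transitive: two tetrads which meet in exactly two
points have a tetrad as their sum. -/
theorem isTetradCode [DecidableEq ι] (h : IsHalfSystem L e e' A)
    (hrow : ∀ i, ∃ j, A i j ≠ 0) : IsTetradCode (frameCode L e) := by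
  have heven : ∀ {S T}, S ∈ frameCode L e → T ∈ frameCode L e → Even (S ∩ T).card := by
    intro S T hS hT
    refine (h.generated hS).even_inter ?_
    rintro _ ⟨j, rfl⟩
    rw [Finset.inter_comm]
    refine (h.generated hT).even_inter ?_
    rintro _ ⟨k, rfl⟩
    exact h.even_inter k j
  refine ⟨h.symmDiff_mem, h.four_le_card, fun hS => (h.generated hS).mono ?_, heven, fun i k => ?_⟩
  · rintro _ ⟨j, rfl⟩
    exact ⟨h.colSupp_mem j, h.card_col j⟩
  · obtain ⟨j₀, hj₀⟩ := hrow i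
    refine h.connected {k | ∃ T ∈ frameCode L e, T.card = 4 ∧ i ∈ T ∧ k ∈ T}
      ⟨i, colSupp A j₀, h.colSupp_mem j₀, h.card_col j₀, mem_colSupp.2 hj₀, mem_colSupp.2 hj₀⟩
      (fun j => ?_) k
    by_contra! hcon
    obtain ⟨⟨l, hl, hlI⟩, k, hk, T, hT, hT4, hiT, hkT⟩ := hcon
    apply hlI
    have hC := h.colSupp_mem j
    have hC4 := h.card_col j
    by_cases hlT : l ∈ T
    · exact ⟨T, hT, hT4, hiT, hlT⟩
    by_cases hij : i ∈ colSupp A j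
    · exact ⟨colSupp A j, hC, hC4, hij, hl⟩
    have h2 := card_inter_eq_two hT4 hC4 (heven hT hC) (by rintro rfl; exact hij hiT) hkT hk
    have h3 := card_symmDiff_add T (colSupp A j)
    exact ⟨T ∆ colSupp A j, h.symmDiff_mem hT hC, by omega,
      Finset.mem_symmDiff.2 (Or.inl ⟨hiT, hij⟩), Finset.mem_symmDiff.2 (Or.inr ⟨hl, hlT⟩)⟩

theorem inner_eq_zero [DecidableEq ι] (h : IsHalfSystem L e e' A) (hrow : ∀ i, ∃ j, A i j ≠ 0)
    {i k : ι} (hik : i ≠ k) : inner ℝ (e i) (e k) = 0 := by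
  obtain ⟨T, hT, hT4, hi, hk⟩ := (h.isTetradCode hrow).exists_tetrad i k
  exact h.inner_eq_zero_of_tetrad hT hT4 hi hk hik

end IsHalfSystem
end Frames

/-! ### Perfection relations -/

section Relation

variable {E : Type*} [NormedAddCommGroup E] [InnerProductSpace ℝ E]

/-- Two minimal vectors which do not span the same line form an angle of at least `60` degrees. -/
theorem IsMinimalVector.abs_inner_le {L : Submodule ℤ E} {x y : E} (hx : IsMinimalVector L x)
    (hy : IsMinimalVector L y) (hne : span ℝ {x} ≠ span ℝ {y}) :
    2 * |inner ℝ x y| ≤ ‖x‖ ^ 2 := by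
  have hxy := hx.norm_eq hy
  have h1 : x - y ≠ 0 := fun h => hne (by rw [sub_eq_zero.1 h])
  have h2 : x + y ≠ 0 := fun h => hne (by
    rw [eq_neg_of_add_eq_zero_left h, ← Set.neg_singleton, Submodule.span_neg])
  have h3 := hx.2.2 _ (sub_mem hx.1 hy.1) h1
  have h4 := hx.2.2 _ (add_mem hx.1 hy.1) h2
  have h5 := norm_sub_sq_real x y
  have h6 := norm_add_sq_real x y
  have h7 := pow_le_pow_left₀ (norm_nonneg x) h3 2
  have h8 := pow_le_pow_left₀ (norm_nonneg x) h4 2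
  rw [← hxy] at h5 h6
  rcases abs_cases (inner ℝ x y) with ⟨e, -⟩ | ⟨e, -⟩ <;> rw [e] <;> linarith

variable {ι κ : Type*} [Fintype ι] [Fintype κ]

/-- The coordinates of a perfection relation with respect to `e`, applied to an arbitrary vector `v`: the
coefficient of `e i` is the inner product of `v` with both sides of this identity, up to the factor
`m⁻¹`. -/
theorem smul_eq_of_relation {e : ι → E} {e' : κ → E} (he : LinearIndependent ℝ e)
    {m : ℝ} (hm : m ≠ 0) (hn : ∀ i, ‖e i‖ ^ 2 = m) (hn' : ∀ j, ‖e' j‖ ^ 2 = m)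
    {a : ι → ℝ} {a' : κ → ℝ}
    (hrel : ∑ i, a i • lineProj (e i) = ∑ j, a' j • lineProj (e' j))
    {A : ι → κ → ℤ} (hA : ∀ j, e' j = (1 / 2 : ℝ) • ∑ i, (A i j : ℝ) • e i) (i : ι) :
    a i • e i = (1 / 2 : ℝ) • ∑ j, (a' j * A i j) • e' j := by
  refine ext_inner_right ℝ fun v => ?_
  have h1 := congrArg (fun f : E →L[ℝ] E => m • f v) hrel
  have hproj : ∀ x : E, ‖x‖ ^ 2 = m → ∀ c : ℝ, m • (c • lineProj x v) = (c * inner ℝ x v) • x := by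
    intro x hx c
    rw [lineProj, Submodule.starProjection_singleton]
    simp only [RCLike.ofReal_real_eq_id, id_eq]
    rw [hx, smul_smul, smul_smul]
    congr 1; field_simp
  simp only [sum_apply, smul_apply, Finset.smul_sum] at h1
  rw [Finset.sum_congr rfl fun i _ => hproj (e i) (hn i) (a i),
    Finset.sum_congr rfl fun j _ => hproj (e' j) (hn' j) (a' j)] at h1
  have h2 : ∑ j, (a' j * inner ℝ (e' j) v) • e' j =
      ∑ i, (∑ j, a' j * inner ℝ (e' j) v * (A i j / 2)) • e i := by
    have : ∀ j, (a' j * inner ℝ (e' j) v) • e' j =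
        ∑ i, (a' j * inner ℝ (e' j) v * (A i j / 2)) • e i := by
      intro j
      nth_rw 2 [hA j]
      rw [Finset.smul_sum, Finset.smul_sum]
      refine Finset.sum_congr rfl fun i _ => ?_
      rw [smul_smul, smul_smul]; congr 1; ring
    rw [Finset.sum_congr rfl fun j _ => this j, Finset.sum_comm]
    exact Finset.sum_congr rfl fun i _ => (Finset.sum_smul ..).symm
  have h3 := coeff_eq_of_sum_eq he (h1.trans h2) i
  rw [inner_smul_left, inner_smul_left, sum_inner]
  simp only [inner_smul_left, conj_trivial]
  rw [h3, Finset.mul_sum]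
  exact Finset.sum_congr rfl fun j _ => by ring

/-- The weighted orthogonality of the rows of `A`. -/
theorem row_relations [DecidableEq ι] {e : ι → E} {e' : κ → E} (he : LinearIndependent ℝ e)
    {a : ι → ℝ} {a' : κ → ℝ} {A : ι → κ → ℤ}
    (hA : ∀ j, e' j = (1 / 2 : ℝ) • ∑ i, (A i j : ℝ) • e i)
    (hB : ∀ i, a i • e i = (1 / 2 : ℝ) • ∑ j, (a' j * A i j) • e' j) (i k : ι) :
    ∑ j, a' j * ((A i j : ℝ) * A k j) = if k = i then 4 * a i else 0 := by
  have h1 : ∑ k, (∑ j, a' j * ((A i j : ℝ) * A k j) / 4) • e k =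
      ∑ k, (if k = i then a i else 0) • e k := by
    simp only [ite_smul, zero_smul, Finset.sum_ite_eq', Finset.mem_univ, if_true]
    rw [hB i, Finset.smul_sum]
    simp_rw [Finset.sum_smul]
    rw [Finset.sum_comm]
    refine Finset.sum_congr rfl fun j _ => ?_
    rw [hA j, Finset.smul_sum, Finset.smul_sum, Finset.smul_sum]
    refine Finset.sum_congr rfl fun k _ => ?_
    rw [smul_smul, smul_smul, smul_smul]; congr 1; ring
  have h2 := coeff_eq_of_sum_eq he h1 k
  rw [← Finset.sum_div] at h2
  split_ifs at h2 ⊢ <;> linarith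

/-- The weighted orthogonality of the columns of `A`. -/
theorem col_relations [DecidableEq κ] {e : ι → E} {e' : κ → E} (he' : LinearIndependent ℝ e')
    {a : ι → ℝ} {a' : κ → ℝ} (ha : ∀ i, 0 < a i) (ha' : ∀ j, 0 < a' j) {A : ι → κ → ℤ}
    (hA : ∀ j, e' j = (1 / 2 : ℝ) • ∑ i, (A i j : ℝ) • e i)
    (hB : ∀ i, a i • e i = (1 / 2 : ℝ) • ∑ j, (a' j * A i j) • e' j) (j k : κ) :
    ∑ i, (A i j : ℝ) * A i k / a i = if k = j then 4 / a' j else 0 := by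
  have h1 : ∑ k, (a' k / 4 * ∑ i, (A i j : ℝ) * A i k / a i) • e' k =
      ∑ k, (if k = j then (1 : ℝ) else 0) • e' k := by
    simp only [ite_smul, zero_smul, one_smul, Finset.sum_ite_eq', Finset.mem_univ, if_true]
    have h2 : ∀ i, e i = ∑ k, ((a i)⁻¹ * (a' k * A i k / 2)) • e' k := by
      intro i
      have : e i = (a i)⁻¹ • (a i • e i) := by
        rw [smul_smul, inv_mul_cancel₀ (ha i).ne', one_smul]
      rw [this, hB i, Finset.smul_sum, Finset.smul_sum]
      refine Finset.sum_congr rfl fun k _ => ?_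
      rw [smul_smul, smul_smul]; congr 1; ring
    simp_rw [Finset.mul_sum, Finset.sum_smul]
    rw [Finset.sum_comm, hA j, Finset.smul_sum]
    refine Finset.sum_congr rfl fun i _ => ?_
    rw [h2 i, Finset.smul_sum, Finset.smul_sum]
    refine Finset.sum_congr rfl fun k _ => ?_
    rw [smul_smul, smul_smul]; congr 1; ring
  have h3 := coeff_eq_of_sum_eq he' h1 k
  have h4 := ha' k
  split_ifs at h3 ⊢ with hkj
  · subst hkj
    field_simp
    field_simp at h3
    linarith
  · exact (mul_eq_zero.1 h3).resolve_left (by positivity)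

/-- A perfection relation between two systems of minimal vectors of the lattice they generate, the
second one having half-integral coordinates with respect to the first. The entries of `A` are
bounded by `1` for the following reason: with `m` the minimal norm, taking the inner product of
`a i e_i = (1 / 2) ∑ a' j A i j e'_j` with `e_i` gives `∑ a' j (2 A i j ⟨e_i, e'_j⟩ - m (A i j)²) = 0`,
where no term is positive since `2 |⟨e_i, e'_j⟩| ≤ m`. Hence all terms vanish. -/
theorem isHalfSystem_of_relation [DecidableEq ι] {L : Submodule ℤ E} {e : ι → E} {e' : κ → E}
    (he : LinearIndependent ℝ e) (he' : LinearIndependent ℝ e')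
    (hgen : L = span ℤ (Set.range e ∪ Set.range e'))
    (hmin : ∀ i, IsMinimalVector L (e i)) (hmin' : ∀ j, IsMinimalVector L (e' j))
    (hlines : ∀ i j, span ℝ {e i} ≠ span ℝ {e' j})
    {a : ι → ℝ} {a' : κ → ℝ} (ha : ∀ i, 0 < a i) (ha' : ∀ j, 0 < a' j)
    {A : ι → κ → ℤ} (hA : ∀ j, e' j = (1 / 2 : ℝ) • ∑ i, (A i j : ℝ) • e i)
    (hB : ∀ i, a i • e i = (1 / 2 : ℝ) • ∑ j, (a' j * A i j) • e' j)
    (hconn : ∀ I : Set ι, I.Nonempty →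
      (∀ j, (∀ i ∈ colSupp A j, i ∈ I) ∨ (∀ i ∈ colSupp A j, i ∉ I)) → ∀ i, i ∈ I) :
    IsHalfSystem L e e' A ∧ IsWeightedFrame A a a' := by
  classical
  have hrow := row_relations he hA hB
  have hcol := col_relations he' ha ha' hA hB
  have key : ∀ i j, 2 * (A i j : ℝ) * inner ℝ (e i) (e' j) ≤ |(A i j : ℝ)| * ‖e i‖ ^ 2 := by
    intro i j
    have h1 := (hmin i).abs_inner_le (hmin' j) (hlines i j)
    calc 2 * (A i j : ℝ) * inner ℝ (e i) (e' j) ≤ |2 * (A i j : ℝ) * inner ℝ (e i) (e' j)| :=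
          le_abs_self _
      _ = |(A i j : ℝ)| * (2 * |inner ℝ (e i) (e' j)|) := by
          rw [abs_mul, abs_mul, abs_two]; ring
      _ ≤ |(A i j : ℝ)| * ‖e i‖ ^ 2 := mul_le_mul_of_nonneg_left h1 (abs_nonneg _)
  have hsq : ∀ z : ℤ, |(z : ℝ)| ≤ (z : ℝ) ^ 2 := by
    intro z
    have : |z| ≤ z ^ 2 := by
      rw [← sq_abs]
      rcases (abs_nonneg z).eq_or_lt with h | h
      · rw [← h]; norm_num
      · nlinarith
    exact_mod_cast this
  have hterm : ∀ i j, 2 * (A i j : ℝ) * inner ℝ (e i) (e' j) = (A i j : ℝ) ^ 2 * ‖e i‖ ^ 2 := by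
    intro i
    have h1 : ∀ j ∈ Finset.univ, 0 ≤ a' j *
        ((A i j : ℝ) ^ 2 * ‖e i‖ ^ 2 - 2 * (A i j : ℝ) * inner ℝ (e i) (e' j)) := by
      intro j _
      have h3 := mul_le_mul_of_nonneg_right (hsq (A i j)) (sq_nonneg ‖e i‖)
      exact mul_nonneg (ha' j).le (by linarith [key i j])
    have h2 : ∑ j, a' j *
        ((A i j : ℝ) ^ 2 * ‖e i‖ ^ 2 - 2 * (A i j : ℝ) * inner ℝ (e i) (e' j)) = 0 := by
      have e1 := hrow i i
      rw [if_pos rfl] at e1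
      have e2 := congrArg (fun v => inner ℝ (e i) v) (hB i)
      simp only [inner_smul_right, inner_sum, real_inner_self_eq_norm_sq] at e2
      have e3 : ∑ j, a' j * ((A i j : ℝ) ^ 2 * ‖e i‖ ^ 2 - 2 * (A i j : ℝ) * inner ℝ (e i) (e' j)) =
          (∑ j, a' j * ((A i j : ℝ) * A i j)) * ‖e i‖ ^ 2 -
            2 * ∑ j, a' j * A i j * inner ℝ (e i) (e' j) := by
        rw [Finset.sum_mul, Finset.mul_sum, ← Finset.sum_sub_distrib]
        exact Finset.sum_congr rfl fun j _ => by ring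
      rw [e3, e1]
      linarith
    intro j
    have h3 := (Finset.sum_eq_zero_iff_of_nonneg h1).1 h2 j (Finset.mem_univ j)
    have := (mul_eq_zero.1 h3).resolve_left (ha' j).ne'
    linarith
  have hpos : ∀ i, 0 < ‖e i‖ ^ 2 := fun i => by
    have := norm_pos_iff.2 (hmin i).2.1
    positivity
  have hentry : ∀ i j, A i j = 0 ∨ A i j = 1 ∨ A i j = -1 := by
    intro i j
    have h1 := key i j
    rw [hterm i j] at h1
    have h2 : (A i j : ℝ) ^ 2 ≤ |(A i j : ℝ)| := le_of_mul_le_mul_right h1 (hpos i)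
    have h3 : (A i j) ^ 2 ≤ |A i j| := by exact_mod_cast h2
    rw [← sq_abs] at h3
    have h4 : |A i j| ≤ 1 := by
      by_contra! h
      nlinarith
    rw [abs_le] at h4
    omega
  have hcard : ∀ j, (colSupp A j).card = 4 := by
    intro j
    have e1 := congrArg (fun v => inner ℝ (e' j) v) (hA j)
    simp only [inner_smul_right, inner_sum, real_inner_self_eq_norm_sq] at e1
    have e2 : ∑ i, (A i j : ℝ) * inner ℝ (e' j) (e i) = (colSupp A j).card * (‖e' j‖ ^ 2 / 2) := by
      rw [← nsmul_eq_mul, ← Finset.sum_subset (Finset.subset_univ (colSupp A j))]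
      · refine Finset.sum_eq_card_nsmul fun i hi => ?_
        have h1 := hterm i j
        rw [mem_colSupp] at hi
        have h2 : (A i j : ℝ) ^ 2 = 1 := by
          rcases (hentry i j).resolve_left hi with e | e <;> rw [e] <;> norm_num
        rw [h2, (hmin i).norm_eq (hmin' j)] at h1
        rw [real_inner_comm]
        linarith
      · intro i _ hi
        have : A i j = 0 := by simpa using hi
        simp [this]
    rw [e2] at e1
    have h3 : 0 < ‖e' j‖ ^ 2 := by
      have := norm_pos_iff.2 (hmin' j).2.1
      positivity
    have h4 : ((colSupp A j).card : ℝ) = 4 := mul_right_cancel₀ h3.ne' (by linarith)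
    exact_mod_cast h4
  have hhalf : IsHalfSystem L e e' A :=
    ⟨hgen, he, hmin, hmin', hA, hentry, hcard, ⟨a, fun i => (ha i).ne', fun j k hjk => by
      rw [hcol, if_neg hjk.symm]⟩, hconn⟩
  refine ⟨hhalf, ha, ha', hentry, hcard, fun i k hik => ?_, fun i => ?_, fun j k hjk => ?_,
    fun j => ?_, hhalf.even_inter, hconn⟩
  · rw [hrow, if_neg hik.symm]
  · simp_rw [sq]; rw [hrow, if_pos rfl]
  · rw [hcol, if_neg hjk.symm]
  · simp_rw [sq]; rw [hcol, if_pos rfl]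

end Relation

section Irreducible

variable {E : Type*} [NormedAddCommGroup E] [InnerProductSpace ℝ E]

/-- Perf-irreducibility is the connectedness of the bipartite graph of the matrix `A`. -/
theorem PerfIrreducible.connected {n : ℕ} {e e' : Fin n → E} (hirr : PerfIrreducible e e')
    {A : Fin n → Fin n → ℤ} (hA : ∀ j, e' j = (1 / 2 : ℝ) • ∑ i, (A i j : ℝ) • e i)
    (hrow : ∀ i, ∃ j, A i j ≠ 0) (I : Set (Fin n)) (hI : I.Nonempty)
    (h : ∀ j, (∀ i ∈ colSupp A j, i ∈ I) ∨ (∀ i ∈ colSupp A j, i ∉ I)) (i : Fin n) : i ∈ I := by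
  by_contra hi
  apply hirr
  obtain ⟨i₀, hi₀⟩ := hI
  have hmem : ∀ (I : Set (Fin n)) j, (∀ i ∈ colSupp A j, i ∈ I) → e' j ∈ span ℝ (e '' I) := by
    intro I j hj
    rw [hA j]
    refine Submodule.smul_mem _ _ (sum_mem fun i _ => ?_)
    by_cases hij : A i j = 0
    · simp [hij]
    · exact Submodule.smul_mem _ _ (subset_span ⟨i, hj i (mem_colSupp.2 hij), rfl⟩)
  obtain ⟨j₀, hj₀⟩ := hrow i₀
  obtain ⟨j₁, hj₁⟩ := hrow i
  refine ⟨I, {j | ∀ i ∈ colSupp A j, i ∈ I}, ⟨i₀, hi₀⟩, ⟨i, hi⟩, ⟨j₀, ?_⟩, ⟨j₁, ?_⟩,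
    fun j hj => hmem I j hj, fun j hj => hmem Iᶜ j ((h j).resolve_left hj)⟩
  · exact (h j₀).resolve_right fun hc => hc i₀ (mem_colSupp.2 hj₀) hi₀
  · exact fun hc => hi (hc i (mem_colSupp.2 hj₁))

end Irreducible

/-! ### Lattices with an orthogonal frame, and root lattices -/

section Similarity

variable {E : Type*} [NormedAddCommGroup E] [InnerProductSpace ℝ E]
variable {ι κ : Type*} [Fintype ι] [Fintype κ]

/-- An orthogonal basis of vectors of `L` of square norm `m`, with respect to which the vectors of `L`
have half-integral coordinates. -/
structure IsFrame (L : Submodule ℤ E) (e : ι → E) (m : ℝ) : Prop where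
  linInd : LinearIndependent ℝ e
  span_eq : span ℝ (Set.range e) = ⊤
  mem : ∀ i, e i ∈ L
  exists_coords : ∀ x ∈ L, ∃ a : ι → ℤ, x = (1 / 2 : ℝ) • ∑ i, (a i : ℝ) • e i
  pos : 0 < m
  orth : ∀ i k, i ≠ k → inner ℝ (e i) (e k) = 0
  norm_sq : ∀ i, inner ℝ (e i) (e i) = m

/-- A lattice with an orthogonal frame is determined up to similarity by the code of the frame. -/
theorem IsFrame.isSimilar {F : Type*} [NormedAddCommGroup F] [InnerProductSpace ℝ F]
    {L : Submodule ℤ E} {e : ι → E} {m : ℝ} (h : IsFrame L e m) {N : (κ → ℤ) → Prop} (π : κ ≃ ι)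
    (hN : ∀ a : ι → ℤ, oddSet a ∈ frameCode L e ↔ N (a ∘ π)) {M : Submodule ℤ F} {t : κ → F}
    (ht : ∀ i, inner ℝ (t i) (t i) = (2 : ℝ)) (ht' : ∀ i k, i ≠ k → inner ℝ (t i) (t k) = (0 : ℝ))
    (hM : ∀ x, x ∈ M ↔ ∃ a : κ → ℤ, N a ∧ x = (1 / 2 : ℝ) • ∑ i, (a i : ℝ) • t i) :
    IsSimilar L M := by
  classical
  let c : ℝ := (Real.sqrt m)⁻¹
  have hsm : 0 < Real.sqrt m := Real.sqrt_pos.2 h.pos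
  have hc : 0 < c := inv_pos.2 hsm
  have hcm : c * c * m = 1 := by
    have h1 := Real.mul_self_sqrt h.pos.le
    have h2 : c * Real.sqrt m = 1 := inv_mul_cancel₀ hsm.ne'
    linear_combination (c * Real.sqrt m + 1) * h2 - c * c * h1
  let s : ℝ := (Real.sqrt 2)⁻¹
  have hs2 : 0 < Real.sqrt 2 := Real.sqrt_pos.2 (by norm_num)
  have hs : 0 < s := inv_pos.2 hs2
  have hss : s * s * 2 = 1 := by
    have h1 := Real.mul_self_sqrt (show (0 : ℝ) ≤ 2 by norm_num)
    have h2 : s * Real.sqrt 2 = 1 := inv_mul_cancel₀ hs2.ne'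
    linear_combination (s * Real.sqrt 2 + 1) * h2 - s * s * h1
  let b : Module.Basis ι ℝ E := (Module.Basis.mk h.linInd h.span_eq.ge)
  let v : Module.Basis ι ℝ E := b.isUnitSMul (w := fun _ => c) fun _ => hc.ne'.isUnit
  have hv : ∀ i, v i = c • e i := fun i => by
    rw [Module.Basis.isUnitSMul_apply, Module.Basis.mk_apply]
  let f : E →ₗ[ℝ] F := v.constr ℝ fun i => s • t (π.symm i)
  have hf : ∀ i, f (v i) = s • t (π.symm i) := fun i => v.constr_basis ℝ _ i
  have hvo : Orthonormal ℝ v := by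
    rw [orthonormal_iff_ite]
    intro i k
    rw [hv, hv, inner_smul_left, inner_smul_right]
    split_ifs with hik
    · subst hik; rw [h.norm_sq]; simp only [conj_trivial]; linarith
    · rw [h.orth i k hik]; simp
  have hfo : Orthonormal ℝ (f ∘ v) := by
    rw [orthonormal_iff_ite]
    intro i k
    rw [Function.comp, Function.comp, hf, hf, inner_smul_left, inner_smul_right]
    split_ifs with hik
    · subst hik; rw [ht]; simp only [conj_trivial]; linarith
    · rw [ht' _ _ fun e => hik (π.symm.injective e)]; simp
  let φ := f.isometryOfOrthonormal hvo hfo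
  have hφ : ∀ i, (c / s) • φ (e i) = t (π.symm i) := by
    intro i
    have h1 : f (c • e i) = s • t (π.symm i) := by rw [← hv, hf]
    have h2 : φ (e i) = f (e i) := rfl
    rw [map_smul] at h1
    rw [h2, div_eq_inv_mul, mul_smul, h1, smul_smul, inv_mul_cancel₀ hs.ne', one_smul]
  have himg : ∀ a : ι → ℤ, (c / s) • φ ((1 / 2 : ℝ) • ∑ i, (a i : ℝ) • e i) =
      (1 / 2 : ℝ) • ∑ k, ((a ∘ π) k : ℝ) • t k := by
    intro a
    rw [map_smul, smul_comm, map_sum, Finset.smul_sum, ← π.sum_comp]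
    congr 1
    refine Finset.sum_congr rfl fun k _ => ?_
    rw [map_smul, smul_comm, hφ, π.symm_apply_apply]
    rfl
  refine ⟨c / s, φ, div_pos hc hs, ?_⟩
  ext x
  simp only [SetLike.mem_coe, Set.mem_image]
  rw [hM]
  constructor
  · rintro ⟨a, ha, rfl⟩
    refine ⟨(1 / 2 : ℝ) • ∑ i, (a (π.symm i) : ℝ) • e i, ?_, ?_⟩
    · refine (half_sum_mem_iff h.mem (fun i => a (π.symm i))).2 ((hN _).2 ?_)
      convert ha using 1
      funext k; simp
    · rw [himg fun i => a (π.symm i)]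
      simp
  · rintro ⟨y, hy, rfl⟩
    obtain ⟨a, rfl⟩ := h.exists_coords y hy
    exact ⟨a ∘ π, (hN a).1 ((half_sum_mem_iff h.mem a).1 hy), himg a⟩

/-- A lattice of type `D` is not its own dual, up to scaling: its dual contains the half sum of one vector
of each pair. -/
theorem IsFrame.exists_dual_of_normD {L : Submodule ℤ E} {e : ι → E} {m : ℝ} (h : IsFrame L e m)
    {k : ℕ} (hk : 0 < k) (π : Fin k × Bool ≃ ι)
    (hN : ∀ a : ι → ℤ, oddSet a ∈ frameCode L e ↔ NormD (a ∘ π)) :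
    ∃ x, x ∉ L ∧ ∀ y ∈ L, ∃ z : ℤ, 2 * inner ℝ x y = z * m := by
  classical
  let w : ι → ℤ := fun i => if (π.symm i).2 then 1 else 0
  refine ⟨(1 / 2 : ℝ) • ∑ i, (w i : ℝ) • e i, ?_, fun y hy => ?_⟩
  · rw [half_sum_mem_iff h.mem, hN]
    rintro ⟨h1, -⟩
    simpa [w] using h1 ⟨0, hk⟩
  · obtain ⟨a, rfl⟩ := h.exists_coords y hy
    rw [half_sum_mem_iff h.mem, hN] at hy
    obtain ⟨z, hz⟩ := hy.2
    refine ⟨z, ?_⟩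
    have h1 : inner ℝ (∑ i, (w i : ℝ) • e i) (∑ i, (a i : ℝ) • e i) = ((∑ i, w i * a i : ℤ) : ℝ) * m := by
      rw [sum_inner]
      push_cast
      rw [Finset.sum_mul]
      refine Finset.sum_congr rfl fun i _ => ?_
      rw [inner_sum, Finset.sum_eq_single i]
      · rw [inner_smul_left, inner_smul_right, h.norm_sq]; simp only [conj_trivial]; ring
      · intro j _ hj
        rw [inner_smul_left, inner_smul_right, h.orth i j hj.symm]; simp
      · simp
    have h2 : ∑ i, w i * a i = z + z := by
      rw [← hz, ← π.sum_comp, Fintype.sum_prod_type]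
      exact Finset.sum_congr rfl fun b _ => by simp [w]
    rw [inner_smul_left, inner_smul_right, h1, h2]
    simp only [conj_trivial]; push_cast; ring

/-- A lattice whose code is the extended Hamming code is, up to scaling, its own dual. -/
theorem IsFrame.mem_of_dual_of_normE8 {L : Submodule ℤ E} {e : ι → E} {m : ℝ} (h : IsFrame L e m)
    (π : Fin 8 ≃ ι) (hN : ∀ a : ι → ℤ, oddSet a ∈ frameCode L e ↔ NormE8 (a ∘ π)) {x : E}
    (hx : ∀ y ∈ L, ∃ z : ℤ, 2 * inner ℝ x y = z * m) : x ∈ L := by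
  classical
  have hinner : ∀ c : ι → ℝ, ∀ k, inner ℝ (∑ i, c i • e i) (e k) = c k * m := by
    intro c k
    rw [sum_inner, Finset.sum_eq_single k]
    · rw [inner_smul_left, h.norm_sq]; simp
    · intro j _ hj; rw [inner_smul_left, h.orth j k hj]; simp
    · simp
  obtain ⟨c, rfl⟩ : ∃ c : ι → ℝ, ∑ i, c i • e i = x := by
    rw [← mem_span_range_iff_exists_fun, h.span_eq]; trivial
  choose z hz using fun k => hx (e k) (h.mem k)
  have hcz : ∀ i, c i = 1 / 2 * z i := by
    intro i
    have h1 := hz i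
    rw [hinner] at h1
    have : 2 * c i = z i := mul_right_cancel₀ h.pos.ne' (by linarith)
    linarith
  have hsum : ∑ i, c i • e i = (1 / 2 : ℝ) • ∑ i, (z i : ℝ) • e i := by
    rw [Finset.smul_sum]
    exact Finset.sum_congr rfl fun i _ => by rw [hcz, mul_smul]
  -- the parity checks of the code are themselves words of the code
  have key : ∀ d : Fin 8 → ℤ, NormE8 d → Even (∑ k, z (π k) * d k) := by
    intro d hd
    have h1 : (1 / 2 : ℝ) • ∑ i, (d (π.symm i) : ℝ) • e i ∈ L := by
      refine (half_sum_mem_iff h.mem (fun i => d (π.symm i))).2 ((hN _).2 ?_)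
      convert hd using 1
      funext k; simp
    obtain ⟨q, hq⟩ := hx _ h1
    rw [inner_smul_right, inner_sum] at hq
    simp only [inner_smul_right, hinner, hcz] at hq
    rw [← π.sum_comp] at hq
    simp only [π.symm_apply_apply] at hq
    have h2 : (∑ k, (z (π k) : ℝ) * d k) * m = (2 * q : ℝ) * m := by
      rw [mul_assoc (2 : ℝ), ← hq, Finset.sum_mul, Finset.mul_sum, Finset.mul_sum, Finset.mul_sum]
      exact Finset.sum_congr rfl fun k _ => by ring
    have h3 := mul_right_cancel₀ h.pos.ne' h2
    have h4 : ∑ k, z (π k) * d k = 2 * q := by exact_mod_cast h3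
    exact ⟨q, by omega⟩
  rw [hsum, half_sum_mem_iff h.mem, hN]
  refine ⟨?_, ?_, ?_, ?_⟩
  · simpa [Fin.sum_univ_eight] using key ![1, 1, 1, 1, 0, 0, 0, 0] (by simp [NormE8]; decide)
  · simpa [Fin.sum_univ_eight] using key ![1, 1, 0, 0, 1, 1, 0, 0] (by simp [NormE8]; decide)
  · simpa [Fin.sum_univ_eight] using key ![1, 1, 0, 0, 0, 0, 1, 1] (by simp [NormE8]; decide)
  · simpa [Fin.sum_univ_eight] using key ![1, 0, 1, 0, 1, 0, 1, 0] (by simp [NormE8]; decide)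

end Similarity

section RootLatticeFrames

/-- The vectors `ε + ε'` and `ε - ε'` for the pairs of coordinates defined by `π`. -/
noncomputable def pairVec {n k : ℕ} (π : Fin k × Bool ≃ Fin n) (x : Fin k × Bool) :
    EuclideanSpace ℝ (Fin n) :=
  WithLp.toLp 2 fun l =>
    if (π.symm l).1 = x.1 then if x.2 || (π.symm l).2 then 1 else -1 else 0

theorem inner_pairVec {n k : ℕ} (π : Fin k × Bool ≃ Fin n) (x y : Fin k × Bool) :
    inner ℝ (pairVec π x) (pairVec π y) = if x = y then (2 : ℝ) else 0 := by
  rw [PiLp.inner_apply, ← π.sum_comp, Fintype.sum_prod_type]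
  simp only [pairVec, Equiv.symm_apply_apply, Fintype.sum_bool]
  obtain ⟨b, s⟩ := x
  obtain ⟨b', s'⟩ := y
  rw [Finset.sum_eq_single b]
  · by_cases hb : b = b'
    · subst hb
      cases s <;> cases s' <;> simp <;> norm_num
    · simp [hb]
  · intro c _ hc; simp [hc]
  · simp

theorem sum_pairVec_apply {n k : ℕ} (π : Fin k × Bool ≃ Fin n) (a : Fin k × Bool → ℤ) (b : Fin k)
    (s : Bool) : ((1 / 2 : ℝ) • ∑ x, (a x : ℝ) • pairVec π x) (π (b, s)) =
      (1 / 2 : ℝ) * (a (b, true) + (if s then 1 else -1) * a (b, false)) := by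
  simp only [PiLp.smul_apply, WithLp.ofLp_sum, Finset.sum_apply, smul_eq_mul]
  congr 1
  rw [Fintype.sum_prod_type, Finset.sum_eq_single b]
  · cases s <;> simp [pairVec]
  · intro c _ hc; simp [pairVec, hc.symm]
  · simp

/-- The vectors `ε ± ε'` form an orthogonal frame of `D_n`, whose code is that of `NormD`. -/
theorem mem_latticeD_iff {n k : ℕ} (π : Fin k × Bool ≃ Fin n) (x : EuclideanSpace ℝ (Fin n)) :
    x ∈ latticeD n ↔
      ∃ a : Fin k × Bool → ℤ, NormD a ∧ x = (1 / 2 : ℝ) • ∑ y, (a y : ℝ) • pairVec π y := by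
  constructor
  · rintro ⟨c, hc, hsum⟩
    refine ⟨fun y => c (π (y.1, true)) + (if y.2 then 1 else -1) * c (π (y.1, false)),
      ⟨fun b => ?_, ?_⟩, ?_⟩
    · exact ⟨c (π (b, true)), by simp; ring⟩
    · rw [← π.sum_comp, Fintype.sum_prod_type] at hsum
      simpa using hsum
    · ext l
      obtain ⟨⟨b, s⟩, rfl⟩ := π.surjective l
      rw [sum_pairVec_apply, hc]
      cases s <;> push_cast <;> simp <;> ring
  · rintro ⟨a, ⟨h1, h2⟩, rfl⟩
    choose z hz using h1
    refine ⟨fun l => if (π.symm l).2 then z (π.symm l).1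
      else z (π.symm l).1 - a ((π.symm l).1, false), fun l => ?_, ?_⟩
    · obtain ⟨⟨b, s⟩, rfl⟩ := π.surjective l
      rw [sum_pairVec_apply]
      have : (a (b, true) : ℝ) + a (b, false) = z b + z b := by exact_mod_cast hz b
      cases s <;> simp <;> linarith
    · rw [← π.sum_comp, Fintype.sum_prod_type]
      convert h2 using 1
      refine Finset.sum_congr rfl fun b _ => ?_
      have := hz b
      simp
      omega

/-- The coordinates of the vectors `ε₁ ± ε₂`, `ε₃ ± ε₄`, `ε₅ ± ε₆`, `ε₇ ± ε₈`. -/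
def octaMatrix : Matrix (Fin 8) (Fin 8) ℤ :=
  !![1, 1, 0, 0, 0, 0, 0, 0;
     1, -1, 0, 0, 0, 0, 0, 0;
     0, 0, 1, 1, 0, 0, 0, 0;
     0, 0, 1, -1, 0, 0, 0, 0;
     0, 0, 0, 0, 1, 1, 0, 0;
     0, 0, 0, 0, 1, -1, 0, 0;
     0, 0, 0, 0, 0, 0, 1, 1;
     0, 0, 0, 0, 0, 0, 1, -1]

/-- The orthogonal frame `ε₁ ± ε₂`, `ε₃ ± ε₄`, `ε₅ ± ε₆`, `ε₇ ± ε₈` of the lattice `E_8`. -/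
noncomputable def octaVec (i : Fin 8) : EuclideanSpace ℝ (Fin 8) :=
  WithLp.toLp 2 fun l => (octaMatrix i l : ℝ)

theorem inner_octaVec (i k : Fin 8) :
    inner ℝ (octaVec i) (octaVec k) = if i = k then (2 : ℝ) else 0 := by
  have h : ∑ l, octaMatrix k l * octaMatrix i l = if i = k then 2 else 0 := by
    revert i k; decide
  rw [PiLp.inner_apply]
  simp only [octaVec, RCLike.inner_apply, conj_trivial]
  exact_mod_cast h

theorem sum_octaVec (a : Fin 8 → ℤ) : (1 / 2 : ℝ) • ∑ i, (a i : ℝ) • octaVec i =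
    WithLp.toLp 2 (fun l => (1 / 2 : ℝ) * ![(a 0 + a 1 : ℝ), a 0 - a 1, a 2 + a 3, a 2 - a 3,
      a 4 + a 5, a 4 - a 5, a 6 + a 7, a 6 - a 7] l) := by
  ext l
  simp only [PiLp.smul_apply, smul_eq_mul, Fin.sum_univ_eight,
    octaVec]
  congr 1
  fin_cases l <;> simp [octaMatrix] <;> ring

theorem mem_latticeE8_iff (x : EuclideanSpace ℝ (Fin 8)) :
    x ∈ latticeE8 ↔ ∃ a : Fin 8 → ℤ, NormE8 a ∧ x = (1 / 2 : ℝ) • ∑ i, (a i : ℝ) • octaVec i := by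
  rw [latticeE8, Submodule.mem_sup]
  constructor
  · rintro ⟨y, ⟨c, hc, hsum⟩, w, hw, rfl⟩
    obtain ⟨z, rfl⟩ := mem_span_singleton.1 hw
    refine ⟨![c 0 + c 1 + z, c 0 - c 1, c 2 + c 3 + z, c 2 - c 3, c 4 + c 5 + z, c 4 - c 5,
      c 6 + c 7 + z, c 6 - c 7], ?_, ?_⟩
    · rw [Fin.sum_univ_eight] at hsum
      refine ⟨?_, ?_, ?_, ?_⟩ <;> simp <;> grind
    · rw [sum_octaVec]
      ext l
      rw [PiLp.add_apply, hc, ← Int.cast_smul_eq_zsmul ℝ]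
      fin_cases l <;> simp <;> ring
  · rintro ⟨a, ⟨h1, h2, h3, h4⟩, rfl⟩
    obtain ⟨z1, h1⟩ := h1
    obtain ⟨z2, h2⟩ := h2
    obtain ⟨z3, h3⟩ := h3
    have e1 : (a 0 + a 1 + a 2 + a 3 : ℝ) = z1 + z1 := by exact_mod_cast h1
    have e2 : (a 0 + a 1 + a 4 + a 5 : ℝ) = z2 + z2 := by exact_mod_cast h2
    have e3 : (a 0 + a 1 + a 6 + a 7 : ℝ) = z3 + z3 := by exact_mod_cast h3
    let c : Fin 8 → ℤ := ![0, -a 1, z1 - a 0 - a 1, z1 - a 0 - a 1 - a 3, z2 - a 0 - a 1,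
      z2 - a 0 - a 1 - a 5, z3 - a 0 - a 1, z3 - a 0 - a 1 - a 7]
    refine ⟨WithLp.toLp 2 fun l => (c l : ℝ), ⟨c, fun i => rfl, ?_⟩,
      (a 0 + a 1) • WithLp.toLp 2 (fun _ => (1 / 2 : ℝ)), mem_span_singleton.2 ⟨_, rfl⟩, ?_⟩
    · rw [Fin.sum_univ_eight]
      simp [c]
      grind
    · rw [sum_octaVec, ← Int.cast_smul_eq_zsmul ℝ]
      ext l
      fin_cases l <;> simp [c] <;> linarith

/-- The last vector of the frame of `E_8` is the root to which `E_7` is orthogonal. -/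
theorem mem_latticeE7_iff (x : EuclideanSpace ℝ (Fin 8)) :
    x ∈ latticeE7 ↔ ∃ a : Fin 7 → ℤ, NormE7 a ∧
      x = (1 / 2 : ℝ) • ∑ i : Fin 7, (a i : ℝ) • octaVec i.castSucc := by
  have h0 : x ∈ latticeE7 ↔ x ∈ latticeE8 ∧ x 6 = x 7 := Iff.rfl
  rw [h0, mem_latticeE8_iff]
  constructor
  · rintro ⟨⟨a, ⟨h1, h2, h3, h4⟩, rfl⟩, h67⟩
    have h7 : a 7 = 0 := by
      rw [sum_octaVec] at h67
      have h67' : (1 / 2 : ℝ) * (a 6 + a 7) = 1 / 2 * (a 6 - a 7) := h67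
      have : (a 7 : ℝ) = 0 := by linarith
      exact_mod_cast this
    refine ⟨fun i => a i.castSucc, ⟨h1, h2, ?_, h4⟩, ?_⟩
    · rw [h7, add_zero] at h3; exact h3
    · rw [Fin.sum_univ_castSucc]
      have : a (Fin.last 7) = 0 := h7
      rw [this]; simp
  · rintro ⟨a, ⟨h1, h2, h3, h4⟩, rfl⟩
    have e : (1 / 2 : ℝ) • ∑ i : Fin 7, (a i : ℝ) • octaVec i.castSucc =
        (1 / 2 : ℝ) • ∑ i : Fin 8, ((Fin.snoc a 0 : Fin 8 → ℤ) i : ℝ) • octaVec i := by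
      have h7 : (Fin.snoc a 0 : Fin 8 → ℤ) (Fin.last 7) = 0 := Fin.snoc_last ..
      rw [Fin.sum_univ_castSucc (n := 7), h7]; simp
    refine ⟨⟨Fin.snoc a 0, ⟨h1, h2, ?_, h4⟩, e⟩, ?_⟩
    · change Even (a 0 + a 1 + a 6 + 0)
      rwa [add_zero]
    · rw [e, sum_octaVec]
      change (1 / 2 : ℝ) * ((a 6 : ℝ) + ((0 : ℤ) : ℝ)) = 1 / 2 * ((a 6 : ℝ) - ((0 : ℤ) : ℝ))
      simp

end RootLatticeFrames

/-! ### Regular and irregular relations -/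

section Frames

variable {E : Type*} [NormedAddCommGroup E] [InnerProductSpace ℝ E]
variable {ι κ : Type*} [Fintype ι]

theorem IsHalfSystem.isFrame [FiniteDimensional ℝ E] {L : Submodule ℤ E} {e : ι → E} {e' : κ → E}
    {A : ι → κ → ℤ} (h : IsHalfSystem L e e' A) (hrow : ∀ i, ∃ j, A i j ≠ 0)
    (hcard : Fintype.card ι = Module.finrank ℝ E) {m : ℝ} (hm : 0 < m)
    (hnorm : ∀ i, ‖e i‖ ^ 2 = m) : IsFrame L e m := by
  classical
  refine ⟨h.linInd, h.linInd.span_eq_top_of_card_eq_finrank' hcard, fun i => (h.minimal i).1,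
    fun x hx => ?_, hm, fun i k hik => h.inner_eq_zero hrow hik, fun i => ?_⟩
  · obtain ⟨a, ha, -⟩ := h.exists_coords hx
    exact ⟨a, ha⟩
  · rw [real_inner_self_eq_norm_sq, hnorm]

/-- If `e' j = (1 / 2) ∑ A i j e i` with constant weights, the roles of the two systems can be
exchanged. -/
theorem IsHalfSystem.transpose [Fintype κ] [DecidableEq ι] {L : Submodule ℤ E} {e : ι → E}
    {e' : κ → E} {A : ι → κ → ℤ} (h : IsHalfSystem L e e' A) (he' : LinearIndependent ℝ e')
    {c : ℝ} (hw : IsWeightedFrame A (fun _ => c) (fun _ => c))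
    (hB : ∀ i, c • e i = (1 / 2 : ℝ) • ∑ j, (c * A i j) • e' j) :
    IsHalfSystem L e' e fun j i => A i j := by
  have hc : ∀ i : ι, c ≠ 0 := fun i => (hw.pos i).ne'
  have hcol : ∀ j, ∃ i, A i j ≠ 0 := by
    intro j
    obtain ⟨i, hi⟩ := Finset.card_pos.1 (by rw [h.card_col j]; norm_num : 0 < (colSupp A j).card)
    exact ⟨i, mem_colSupp.1 hi⟩
  refine ⟨?_, he', h.minimal', h.minimal, fun i => ?_, fun j i => h.entry i j, fun i => ?_,
    ⟨fun _ => 1, fun _ => one_ne_zero, fun i k hik => ?_⟩, fun J hJ hsep j => ?_⟩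
  · rw [Set.union_comm]; exact h.eq_span
  · have h1 := hB i
    simp_rw [mul_smul] at h1
    rw [← Finset.smul_sum, smul_comm] at h1
    exact smul_right_injective E (hc i) h1
  · have h1 := hw.row_norm i
    rw [← Finset.mul_sum, mul_comm] at h1
    have h2 := mul_right_cancel₀ (hc i) h1
    have h3 : ∑ j, (A i j : ℝ) ^ 2 = ((colSupp (fun j i => A i j) i).card : ℝ) := by
      rw [colSupp, Finset.card_filter]
      push_cast
      refine Finset.sum_congr rfl fun j _ => ?_
      rcases h.entry i j with e | e | e <;> simp [e]
    rw [h3] at h2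
    exact_mod_cast h2
  · have h1 := hw.row_orth i k hik
    rw [← Finset.mul_sum] at h1
    simpa using (mul_eq_zero.1 h1).resolve_left (hc i)
  · obtain ⟨j₀, hj₀⟩ := hJ
    obtain ⟨i₀, hi₀⟩ := hcol j₀
    have hall := h.connected {i | ∃ j ∈ J, A i j ≠ 0} ⟨i₀, j₀, hj₀, hi₀⟩ fun j => by
      by_cases hj : j ∈ J
      · exact Or.inl fun i hi => ⟨j, hj, mem_colSupp.1 hi⟩
      · refine Or.inr fun i hi => ?_
        rintro ⟨k, hk, hik⟩
        rcases hsep i with hs | hs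
        · exact hj (hs j (mem_colSupp.2 (mem_colSupp.1 hi)))
        · exact hs k (mem_colSupp.2 hik) hk
    obtain ⟨i, hi⟩ := hcol j
    obtain ⟨k, hk, hik⟩ := hall i
    rcases hsep i with hs | hs
    · exact hs j (mem_colSupp.2 hi)
    · exact absurd hk (hs k (mem_colSupp.2 hik))

/-- The exponent divides `2` by the half-integrality of coordinates, and is not `1` since `e' j` is not an
integral combination of the `e i`. -/
theorem IsHalfSystem.annihilator_eq_two {n : ℕ} [Nonempty κ] {L : Submodule ℤ E} {e : Fin n → E}
    {e' : κ → E} {A : Fin n → κ → ℤ} (h : IsHalfSystem L e e' A) : annihilator L e = 2 := by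
  have hdvd : annihilator L e ∣ 2 := by
    refine AddMonoid.exponent_dvd_of_forall_nsmul_eq_zero fun q => ?_
    obtain ⟨x, rfl⟩ := Submodule.Quotient.mk_surjective _ q
    obtain ⟨a, ha, -⟩ := h.exists_coords x.2
    rw [← Submodule.Quotient.mk_smul, Submodule.Quotient.mk_eq_zero, Submodule.submoduleOf, Submodule.mem_comap]
    have h1 : L.subtype (2 • x) = ∑ i, a i • e i := by
      rw [map_nsmul, Submodule.subtype_apply, ha, two_nsmul, ← add_smul]
      norm_num [Int.cast_smul_eq_zsmul]
    rw [h1]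
    exact sum_mem fun i _ => Submodule.smul_mem _ _ (subset_span ⟨i, rfl⟩)
  refine ((Nat.dvd_prime Nat.prime_two).1 hdvd).resolve_left fun h1 => ?_
  obtain ⟨j⟩ := ‹Nonempty κ›
  have h2 := AddMonoid.exponent_nsmul_eq_zero
    (Submodule.Quotient.mk ⟨e' j, (h.minimal' j).1⟩ : LatQuot L (span ℤ (Set.range e)))
  rw [← annihilator, h1, one_nsmul, Submodule.Quotient.mk_eq_zero, Submodule.submoduleOf, Submodule.mem_comap] at h2
  obtain ⟨z, hz⟩ := mem_span_range_iff_exists_fun ℤ |>.1 h2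
  obtain ⟨i, hi⟩ := Finset.card_pos.1 (by rw [h.card_col j]; norm_num : 0 < (colSupp A j).card)
  have h3 : ∑ i, (z i : ℝ) • e i = ∑ i, ((A i j : ℝ) / 2) • e i := by
    simp_rw [Int.cast_smul_eq_zsmul]
    refine hz.trans ((h.eq_half j).trans ?_)
    rw [Finset.smul_sum]
    refine Finset.sum_congr rfl fun i _ => ?_
    rw [smul_smul]; congr 1; ring
  have h4 := coeff_eq_of_sum_eq h.linInd h3 i
  have h5 : (A i j : ℝ) = 2 * z i := by linarith
  have h6 : A i j = 2 * z i := by exact_mod_cast h5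
  have h7 := mem_colSupp.1 hi
  rcases h.entry i j with e | e | e <;> omega

theorem mem_code_two_iff {n : ℕ} {L : Submodule ℤ E} {e : Fin n → E} (heL : ∀ i, e i ∈ L)
    (w : Fin n → ZMod 2) :
    w ∈ code L e 2 ↔ ∃ a : Fin n → ℤ, oddSet a ∈ frameCode L e ∧ ∀ i, w i = (a i : ZMod 2) := by
  have h1 : ∀ a : Fin n → ℤ, ∑ i, ((a i : ℝ) / ((2 : ℕ) : ℝ)) • e i =
      (1 / 2 : ℝ) • ∑ i, (a i : ℝ) • e i := by
    intro a
    rw [Finset.smul_sum]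
    refine Finset.sum_congr rfl fun i _ => ?_
    rw [smul_smul]; congr 1; push_cast; ring
  simp only [code, Set.mem_ofPred_eq, h1, half_sum_mem_iff heL]

theorem codeEquivalent_of_normal_form {n : ℕ} {L : Submodule ℤ E} {e e' : Fin n → E}
    (he : ∀ i, e i ∈ L) (he' : ∀ i, e' i ∈ L) {N : (κ → ℤ) → Prop} (π π' : κ ≃ Fin n)
    (h : ∀ a : Fin n → ℤ, oddSet a ∈ frameCode L e ↔ N (a ∘ π))
    (h' : ∀ a : Fin n → ℤ, oddSet a ∈ frameCode L e' ↔ N (a ∘ π')) :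
    CodeEquivalent (code L e 2) (code L e' 2) := by
  refine ⟨π'.symm.trans π, fun _ => 1, fun w => ?_⟩
  simp only [one_smul, mem_code_two_iff he, mem_code_two_iff he', h, h']
  constructor
  · rintro ⟨a, ha, hw⟩
    refine ⟨fun i => a (π (π'.symm i)), ?_, fun i => hw _⟩
    convert ha using 1
    funext k; simp
  · rintro ⟨a, ha, hw⟩
    refine ⟨fun i => a (π' (π.symm i)), ?_, fun i => ?_⟩
    · convert ha using 1
      funext k; simp
    · have := hw (π' (π.symm i))
      simpa using this

end Frames

section Conclusions

variable {E : Type*} [NormedAddCommGroup E] [InnerProductSpace ℝ E]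

/-- Two frames of the same norm in a lattice have equivalent codes: a tetrad code is determined by its
length, except that `D_8` and `E_8` both have codes of length `8`; but `E_8` is its own dual and `D_8` is
not. -/
theorem codeEquivalent_and_isSimilar {n : ℕ} (hn : 0 < n) {L : Submodule ℤ E} {e e' : Fin n → E}
    {m : ℝ} (hf : IsFrame L e m) (hf' : IsFrame L e' m) (ht : IsTetradCode (frameCode L e))
    (ht' : IsTetradCode (frameCode L e')) :
    CodeEquivalent (code L e 2) (code L e' 2) ∧
      ((4 ≤ n ∧ Even n ∧ IsSimilar L (latticeD n)) ∨ IsSimilar L latticeE7 ∨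
        IsSimilar L latticeE8) := by
  have : Nonempty (Fin n) := ⟨⟨0, hn⟩⟩
  have hcard : ∀ {k : ℕ}, (Fin k × Bool ≃ Fin n) → k * 2 = n := fun π => by
    simpa using Fintype.card_congr π
  have hcard' : ∀ {k : ℕ}, (Fin k ≃ Fin n) → k = n := fun π => by
    simpa using Fintype.card_congr π
  have ho : ∀ i, inner ℝ (octaVec i) (octaVec i) = (2 : ℝ) := fun i => by rw [inner_octaVec, if_pos rfl]
  have ho' : ∀ i k, i ≠ k → inner ℝ (octaVec i) (octaVec k) = (0 : ℝ) := fun i k hik => by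
    simp [inner_octaVec, hik]
  rcases ht.classification with ⟨k, hk, π, hN⟩ | ⟨π, hN⟩ | ⟨π, hN⟩
  · have hkn := hcard π
    rcases ht'.classification with ⟨k', hk', π', hN'⟩ | ⟨π', hN'⟩ | ⟨π', hN'⟩
    · have hkn' := hcard π'
      obtain rfl : k = k' := by omega
      refine ⟨codeEquivalent_of_normal_form hf.mem hf'.mem π π' hN hN', Or.inl ⟨by omega,
        ⟨k, by omega⟩, hf.isSimilar π hN (fun i => ?_) (fun i j hij => ?_)
        fun x => mem_latticeD_iff π x⟩⟩
      · rw [inner_pairVec, if_pos rfl]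
      · simp [inner_pairVec, hij]
    · have := hcard' π'
      omega
    · obtain ⟨x, hx, hdual⟩ := hf.exists_dual_of_normD (by omega) π hN
      exact absurd (hf'.mem_of_dual_of_normE8 π' hN' hdual) hx
  · have hkn := hcard' π
    rcases ht'.classification with ⟨k', hk', π', hN'⟩ | ⟨π', hN'⟩ | ⟨π', hN'⟩
    · have := hcard π'
      omega
    · exact ⟨codeEquivalent_of_normal_form hf.mem hf'.mem π π' hN hN', Or.inr (Or.inl
        (hf.isSimilar π hN (fun i => ho _)
          (fun i j hij => ho' _ _ ((Fin.castSucc_injective 7).ne hij)) mem_latticeE7_iff))⟩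
    · have := hcard' π'
      omega
  · have hkn := hcard' π
    rcases ht'.classification with ⟨k', hk', π', hN'⟩ | ⟨π', hN'⟩ | ⟨π', hN'⟩
    · obtain ⟨x, hx, hdual⟩ := hf'.exists_dual_of_normD (by omega) π' hN'
      exact absurd (hf.mem_of_dual_of_normE8 π hN hdual) hx
    · have := hcard' π'
      omega
    · exact ⟨codeEquivalent_of_normal_form hf.mem hf'.mem π π' hN hN', Or.inr (Or.inr
        (hf.isSimilar π hN ho ho' mem_latticeE8_iff))⟩

open IsWeightedFrame in
/-- The supports of the columns of the irregular matrix generate the extended Hamming code, so that the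
lattice of the irregular relation is `E_8`. -/
theorem isSimilar_latticeE8_of_irregular {ι κ : Type*} [Fintype ι] [DecidableEq ι]
    {L : Submodule ℤ E} {e : ι → E} {e' : κ → E} {A : ι → κ → ℤ} (h : IsHalfSystem L e e' A)
    (hrow : ∀ i, ∃ j, A i j ≠ 0) {m : ℝ} (hf : IsFrame L e m) (σ : Fin 8 ≃ ι) (τ : Fin 8 → κ)
    (hA : ∀ i k, A (σ i) (τ k) ≠ 0 ↔ irregularMatrix i k ≠ 0) : IsSimilar L latticeE8 := by
  have hcol : ∀ k, (Finset.univ.filter fun i => irregularMatrix i k ≠ 0).image σ ∈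
      frameCode L e := by
    intro k
    convert h.colSupp_mem (τ k) using 1
    ext i
    obtain ⟨i, rfl⟩ := σ.surjective i
    simp only [Finset.mem_image, Finset.mem_filter, Finset.mem_univ, true_and, mem_colSupp, hA,
      σ.injective.eq_iff, exists_eq_right]
  have hadd : ∀ S T : Finset (Fin 8), S.image σ ∈ frameCode L e → T.image σ ∈ frameCode L e →
      (S ∆ T).image σ ∈ frameCode L e := by
    intro S T hS hT
    rw [Finset.image_symmDiff _ _ σ.injective]
    exact h.symmDiff_mem hS hT
  -- `ρ` renumbers the rows in such a way that the parity checks take the form of `NormE8`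
  let ρ : Fin 8 ≃ Fin 8 := Equiv.ofBijective ![0, 1, 5, 2, 7, 4, 3, 6] (by decide)
  have hN := (h.isTetradCode hrow).normE8 (ρ.trans σ)
    (by simpa [show (Finset.univ.filter fun i => irregularMatrix i 0 ≠ 0) ∆
      (Finset.univ.filter fun i => irregularMatrix i 2 ≠ 0) = {0, 1, 5, 2} by decide, ρ]
      using hadd _ _ (hcol 0) (hcol 2))
    (by simpa [show (Finset.univ.filter fun i => irregularMatrix i 0 ≠ 0) ∆
      (Finset.univ.filter fun i => irregularMatrix i 4 ≠ 0) = {0, 1, 7, 4} by decide, ρ]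
      using hadd _ _ (hcol 0) (hcol 4))
    (by simpa [show (Finset.univ.filter fun i => irregularMatrix i 0 ≠ 0) ∆
      (Finset.univ.filter fun i => irregularMatrix i 6 ≠ 0) = {0, 1, 3, 6} by decide, ρ]
      using hadd _ _ (hcol 0) (hcol 6))
    (by simpa [show (Finset.univ.filter fun i => irregularMatrix i 0 ≠ 0) = {0, 5, 7, 3} by decide,
      ρ] using hcol 0)
  exact hf.isSimilar (ρ.trans σ) hN (fun i => by rw [inner_octaVec, if_pos rfl])
    (fun i k hik => by simp [inner_octaVec, hik]) mem_latticeE8_iff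

open IsWeightedFrame in
theorem isIrregularE8Relation_of_matrix {n : ℕ} {e e' : Fin n → E} {A : Fin n → Fin n → ℤ}
    {a a' : Fin n → ℝ} (horth : ∀ i k, i ≠ k → inner ℝ (e i) (e k) = 0)
    (hnorm : ∀ i k, ‖e i‖ = ‖e k‖)
    (hA : ∀ j, e' j = (1 / 2 : ℝ) • ∑ i, (A i j : ℝ) • e i) (σ τ : Fin 8 ≃ Fin n)
    (s t : Fin 8 → ℤ) (c : ℝ) (hc : 0 < c) (hs : ∀ i, s i * s i = 1) (ht : ∀ k, t k * t k = 1)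
    (hM : ∀ i k, s i * (t k * A (σ i) (τ k)) = irregularMatrix i k)
    (ha : ∀ i, a (σ i) = if i = 0 ∨ i = 2 ∨ i = 4 ∨ i = 6 then c else 3 * c)
    (ha' : ∀ k, a' (τ k) = 2 * c) : IsIrregularE8Relation e e' a a' := by
  let u : Fin 8 → ℤˣ := fun i => ⟨s i, s i, hs i, hs i⟩
  let v : Fin 8 → ℤˣ := fun k => ⟨t k, t k, ht k, ht k⟩
  have hu : ∀ i x, u i • (x : E) = (s i : ℝ) • x := fun i x => by
    rw [Int.cast_smul_eq_zsmul]; rfl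
  have hv : ∀ i x, v i • (x : E) = (t i : ℝ) • x := fun i x => by
    rw [Int.cast_smul_eq_zsmul]; rfl
  have hsr : ∀ i, (s i : ℝ) * s i = 1 := fun i => by exact_mod_cast hs i
  obtain ⟨f, hf⟩ : ∃ f : Fin 8 → E, ∀ i, f i = u i • e (σ i) := ⟨_, fun _ => rfl⟩
  have hg : ∀ k, v k • e' (τ k) =
      (1 / 2 : ℝ) • ∑ i, (irregularMatrix i k : ℝ) • f i := by
    intro k
    rw [hv, hA, smul_comm, ← σ.sum_comp, Finset.smul_sum]
    congr 1
    refine Finset.sum_congr rfl fun i _ => ?_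
    rw [hf, hu, smul_smul, smul_smul, ← hM]
    congr 1
    push_cast
    linear_combination (-(t k * A (σ i) (τ k) : ℝ)) * hsr i
  refine ⟨σ, τ, u, v, f, fun k => v k • e' (τ k), c, hf,
    fun _ => rfl, fun i k hik => ?_, fun i k => ?_, ?_, ?_, ?_, ?_, ?_, ?_, ?_, ?_, hc, ha, ha'⟩
  · beta_reduce
    rw [hf, hf, hu, hu, inner_smul_left, inner_smul_right, horth _ _ (σ.injective.ne hik)]
    simp
  · have habs : ∀ i, |(s i : ℝ)| = 1 := fun i => by
      rcases mul_self_eq_one_iff.1 (hsr i) with e | e <;> simp [e]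
    rw [hf, hf, hu, hu, norm_smul, norm_smul, Real.norm_eq_abs, Real.norm_eq_abs, habs, habs, hnorm]
  all_goals
    refine (hg _).trans ?_
    rw [Fin.sum_univ_eight]
    simp only [irregularMatrix, Matrix.of_apply, Matrix.cons_val]
    push_cast
    module

end Conclusions
end PerfRel

open PerfRel in
theorem mainTheorem1 {E : Type*} [NormedAddCommGroup E] [InnerProductSpace ℝ E]
    [FiniteDimensional ℝ E] (n : ℕ) (hn : 0 < n) (hdim : Module.finrank ℝ E = n)
    (L : Submodule ℤ E) [DiscreteTopology L] [IsZLattice ℝ L]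
    (e e' : Fin n → E)
    (he : LinearIndependent ℝ e) (he' : LinearIndependent ℝ e')
    (hgen : L = span ℤ (Set.range e ∪ Set.range e'))
    (hmin : ∀ i, PerfRel.IsMinimalVector L (e i))
    (hmin' : ∀ i, PerfRel.IsMinimalVector L (e' i))
    (hlines : ∀ i j, span ℝ {e i} ≠ span ℝ {e' j})
    (a a' : Fin n → ℝ) (ha : ∀ i, 0 < a i) (ha' : ∀ i, 0 < a' i)
    (hrel : ∑ i, a i • PerfRel.lineProj (e i) = ∑ i, a' i • PerfRel.lineProj (e' i))
    (hirr : PerfRel.PerfIrreducible e e')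
    (helem : ∀ x : PerfRel.LatQuot L (span ℤ (Set.range e)), 2 • x = 0) :
    ((PerfRel.IsRegular L e e' ∧ PerfRel.IsOrthogonalFrameRelation e e' a a') ∧
      ((4 ≤ n ∧ Even n ∧ PerfRel.IsSimilar L (PerfRel.latticeD n)) ∨
        PerfRel.IsSimilar L PerfRel.latticeE7 ∨
        PerfRel.IsSimilar L PerfRel.latticeE8)) ∨
    (PerfRel.IsSimilar L PerfRel.latticeE8 ∧ PerfRel.IsIrregularE8Relation e e' a a') := by
  have i₀ : Fin n := ⟨0, hn⟩
  have hne : Nonempty (Fin n) := ⟨i₀⟩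
  have hm : 0 < ‖e i₀‖ ^ 2 := by
    have := norm_pos_iff.2 (hmin i₀).2.1
    positivity
  have hnorm : ∀ i, ‖e i‖ ^ 2 = ‖e i₀‖ ^ 2 := fun i => by rw [(hmin i).norm_eq (hmin i₀)]
  have hnorm' : ∀ j, ‖e' j‖ ^ 2 = ‖e i₀‖ ^ 2 := fun j => by rw [(hmin' j).norm_eq (hmin i₀)]
  -- the coordinates of the second system are half-integral since `2 L` is contained in the span
  have hcoord : ∀ j, ∃ b : Fin n → ℤ, e' j = (1 / 2 : ℝ) • ∑ i, (b i : ℝ) • e i := by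
    intro j
    have h1 := helem (Submodule.Quotient.mk ⟨e' j, (hmin' j).1⟩)
    rw [← Submodule.Quotient.mk_smul, Submodule.Quotient.mk_eq_zero,
      Submodule.submoduleOf, Submodule.mem_comap] at h1
    obtain ⟨b, hb⟩ := mem_span_range_iff_exists_fun ℤ |>.1 h1
    refine ⟨b, ?_⟩
    simp_rw [Int.cast_smul_eq_zsmul]
    rw [hb, map_nsmul, Submodule.subtype_apply, two_nsmul, ← two_smul ℝ, smul_smul]
    norm_num
  choose B hB using hcoord
  let A : Fin n → Fin n → ℤ := fun i j => B j i
  have hA : ∀ j, e' j = (1 / 2 : ℝ) • ∑ i, (A i j : ℝ) • e i := hB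
  have hA' := smul_eq_of_relation he hm.ne' hnorm hnorm' hrel hA
  have hrow : ∀ i, ∃ j, A i j ≠ 0 := by
    intro i
    by_contra! h0
    have h1 := hA' i
    simp only [h0, Int.cast_zero, mul_zero, zero_smul, Finset.sum_const_zero, smul_zero] at h1
    exact (smul_ne_zero (ha i).ne' (hmin i).2.1) h1
  obtain ⟨hhalf, hw⟩ := isHalfSystem_of_relation he he' hgen hmin hmin' hlines ha ha' hA hA'
    (hirr.connected hA hrow)
  have hframe := hhalf.isFrame hrow (by rw [Fintype.card_fin, hdim]) hm hnorm
  by_cases hsp : ∃ j p, IsWeightedFrame.IsSpecial A a a' j p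
  · obtain ⟨j, p, hs⟩ := hsp
    obtain ⟨σ, τ, s, t, c, hc, hs, ht, hM, hσ, hτ⟩ := hs.exists_irregular hw
    refine Or.inr ⟨isSimilar_latticeE8_of_irregular hhalf hrow hframe σ τ fun i k => ?_,
      isIrregularE8Relation_of_matrix hframe.orth
        (fun i k => (hmin i).norm_eq (hmin k)) hA σ τ s t c hc hs ht hM hσ hτ⟩
    rw [← hM]
    have h1 : s i ≠ 0 := left_ne_zero_of_mul_eq_one (hs i)
    have h2 : t k ≠ 0 := left_ne_zero_of_mul_eq_one (ht k)
    simp [h1, h2]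
  · left
    have hconst : ∀ j, ∀ x ∈ colSupp A j, ∀ y ∈ colSupp A j, a x = a y := fun j =>
      (hw.lam_const_or_isSpecial j).resolve_right fun ⟨p, hp⟩ => hsp ⟨j, p, hp⟩
    -- the rows of a given weight are a union of components of the bipartite graph
    have hc : ∀ i, a i = a i₀ := by
      refine hw.connected {i | a i = a i₀} ⟨i₀, rfl⟩ fun j => ?_
      by_cases hj : ∃ x ∈ colSupp A j, a x = a i₀
      · obtain ⟨x, hx, hxa⟩ := hj
        exact Or.inl fun y hy => (hconst j y hy x hx).trans hxa
      · exact Or.inr fun y hy hya => hj ⟨y, hy, hya⟩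
    have hc' : ∀ j, a' j = a i₀ := by
      intro j
      have h1 := hw.col_norm' j
      rw [Finset.sum_congr rfl fun i _ => by rw [hc i], Finset.sum_const, hw.card_col,
        nsmul_eq_mul] at h1
      have := ha' j
      have := ha i₀
      push_cast at h1
      field_simp at h1
      linarith
    have hae : a = fun _ => a i₀ := funext hc
    have hae' : a' = fun _ => a i₀ := funext hc'
    rw [hae, hae'] at hw
    have hhalf' := hhalf.transpose he' hw fun i => by
      have h1 := hA' i
      simp only [hc, hc'] at h1
      exact h1
    have hrow' : ∀ j, ∃ i, A i j ≠ 0 := by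
      intro j
      obtain ⟨i, hi⟩ := Finset.card_pos.1
        (by rw [hhalf.card_col j]; norm_num : 0 < (colSupp A j).card)
      exact ⟨i, mem_colSupp.1 hi⟩
    have hframe' := hhalf'.isFrame hrow' (by rw [Fintype.card_fin, hdim]) hm hnorm'
    obtain ⟨hcode, hsim⟩ := codeEquivalent_and_isSimilar hn hframe hframe'
      (hhalf.isTetradCode hrow) (hhalf'.isTetradCode hrow')
    refine ⟨⟨⟨?_, ?_⟩, fun i k hik => hframe.orth i k hik, fun i k hik => hframe'.orth i k hik,
      a i₀, ha i₀, fun i => ⟨hc i, hc' i⟩⟩, hsim⟩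
    · rw [hhalf.annihilator_eq_two, hhalf'.annihilator_eq_two]
    · rw [hhalf.annihilator_eq_two]
      exact hcode
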